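/- **Proposition (weak rationality theorem at split primes).** Let $K=\mathbb{Q}(i)$, $\mathcal{O}_K=\mathbb{Z}[i]$, $J=\begin{pmatrix}0&-1_2\\1_2&0\end{pmatrix}$, $e(z)=e^{2\pi i z}$, and let $\Gamma_2=\{g\in GL_4(\mathcal{O}_K): \bar g^tJg=J\}$. Let $S^2$ be the set of $g\in M_4(K)$ with $\bar g^tJg=\mu(g)J$, $\mu(g)>0$, and let $\Gamma_{1,1}\subset\Gamma_2$ be the subgroup of matrices with last row $(0,0,0,*)$. Let $\mathbb{H}_2$ be the upper Hermitian plane of degree $2$. For $g=\begin{pmatrix}A&B\\C&D\end{pmatrix}\in S^2$ and a function $F$ on $\mathbb{H}_2$ put $$(F\mid g)(Z)=\mu(g)^{2k-4}\det(CZ+D)^{-k}F\big((AZ+B)(CZ+D)^{-1}\big),$$ and let a double coset $\Gamma g\Gamma=\bigsqcup_i\Gamma g_i$ ($\Gamma=\Gamma_2$ or $\Gamma_{1,1}$) act by $F\mid\Gamma g\Gamma=\sum_iF\mid g_i$ on functions invariant under $\Gamma$. Let $k\in\mathbb{Z}$ and let $F\in S_2^k$ be a nonzero Hermitian cusp form of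 degree $2$ and weight $k$ for $\Gamma_2$ that is an eigenfunction of all the operators $\Gamma_2g\Gamma_2$, $g\in S^2$. Write its Fourier–Jacobi expansion as $$F\begin{pmatrix}\tau&z_1\\z_2&\omega\end{pmatrix}=\sum_{m\ge1}\phi_m(\tau,z_1,z_2)\,e(m\omega),$$ and put $\phi_{m/p}=0$ if $p\nmid m$. For a double coset $X=\Gamma_{1,1}g\Gamma_{1,1}$, where $g\in S^2$ has second column $(0,a,0,0)^t$ and last row $(0,0,0,b)$, let $s=b/a$ be its signature. On Jacobi forms $\phi$ of weight $k$ and index $m$ put $$(\phi\mid X)(\tau,z_1,z_2)=(\tilde\phi\mid X)\begin{pmatrix}\tau&z_1\\z_2&\omega\end{pmatrix}\,e\!\left(-\tfrac{m}{s}\omega\right),\qquad \tilde\phi\begin{pmatrix}\tau&z_1\\z_2&\omega\end{pmatrix}=\phi(\tau,z_1,z_2)e(m\omega),$$ which does not depend on $\omega$ and has index $m/s$. A product of operators acts by $\phi\mid XY=(\phi\mid X)\mid Y$. Let $p$ be an odd rational prime with $p=\pi\bar\pi$, $\pi\in\mathcal{O}_K$. Let $$\Lambda_+(\pi^\delta)=\Gamma_{1,1}\mathrm{diag}(\pi^\delta,1,\pi^\delta,p^\delta)\Gamma_{1,1},\qquad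 \Lambda_-(\pi)=\Gamma_{1,1}\mathrm{diag}(\pi,p,\pi,1)\Gamma_{1,1},$$ and let $T(\pi)$, $T(p)$, $T(\pi,\bar\pi)$, $\Delta_\pi$ be the double cosets of $\mathrm{diag}(1,\pi,p,\pi)$, $\mathrm{diag}(1,1,p,p)$, $\mathrm{diag}(\pi,\bar\pi,\pi,\bar\pi)$, $\mathrm{diag}(\pi,\pi,\pi,\pi)$ respectively, and likewise with $\pi$ and $\bar\pi$ exchanged. Let $$D^{(2)}_{\pi}(X)=1-T(\bar\pi)X+p\Delta_{\bar\pi}T(p)X^2-p^3\Delta_{\bar\pi}^2T(\pi)X^3+p^6\Delta_{\bar\pi}^3\Delta_\pi X^4$$ with double cosets taken with respect to $\Gamma_2$, and let $D^{(2)}_{\pi,F}(X)\in\mathbb{C}[X]$ be obtained from it by replacing each operator by its eigenvalue on $F$. Let $$S_\pi(X)=1-T(\bar\pi)X+p\Delta_{\bar\pi}T(\pi,\bar\pi)X^2$$ with double cosets taken with respect to $\Gamma_{1,1}$. Define $D^{(2)}_{\bar\pi,F}$ and $S_{\bar\pi}$ by exchanging $\pi$ and $\bar\pi$. Then for every $m\ge1$,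 as formal power series in $X$ whose coefficients are functions of $(\tau,z_1,z_2)\in\mathbb{H}_1\times\mathbb{C}^2$, $$D_{\pi,F}^{(2)}(X)\sum_{\delta\ge0}\phi_{mp^\delta}\mid\Lambda_+(\bar\pi^\delta)\,X^\delta=\Big(\phi_m-\phi_{m/p}\mid\Lambda_-(\bar\pi)\,X\Big)\mid S_\pi(X)$$ and $$D_{\bar\pi,F}^{(2)}(X)\sum_{\delta\ge0}\phi_{mp^\delta}\mid\Lambda_+(\pi^\delta)\,X^\delta=\Big(\phi_m-\phi_{m/p}\mid\Lambda_-(\pi)\,X\Big)\mid S_{\bar\pi}(X).$$ -/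

import Mathlib

open scoped ComplexOrder Matrix UpperHalfPlane

noncomputable section

namespace HermitianModular

/-- `2 × 2` complex matrices, the ambient space of the upper Hermitian plane of degree two. -/
abbrev Mat2 := Matrix (Fin 2) (Fin 2) ℂ

/-- `4 × 4` complex matrices in `2 × 2` blocks; the rows and columns `1, 2, 3, 4` are
`inl 0, inl 1, inr 0, inr 1`. -/
abbrev Mat4 := Matrix (Fin 2 ⊕ Fin 2) (Fin 2 ⊕ Fin 2) ℂ

/-- `e(z) = exp(2 π i z)`. -/
def e (z : ℂ) : ℂ := Complex.exp (2 * Real.pi * Complex.I * z)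

/-! ### Groups -/

/-- `U₂(ℤ[i])`, inside `GL₄(ℤ[i])`: the matrices with `gᴴ J g = J`, where `J = (0, -1; 1, 0)`. -/
def unitaryGroupInt : Subgroup (GL (Fin 2 ⊕ Fin 2) GaussianInt) where
  carrier := {g | g.valᴴ * Matrix.J (Fin 2) GaussianInt * g.val = Matrix.J (Fin 2) GaussianInt}
  one_mem' := by simp
  mul_mem' := by
    intro a b ha hb
    simp only [Set.mem_ofPred_eq] at ha hb ⊢
    calc (a * b).valᴴ * Matrix.J (Fin 2) GaussianInt * (a * b).val
        = b.valᴴ * (a.valᴴ * Matrix.J (Fin 2) GaussianInt * a.val) * b.val := by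
          simp only [Units.val_mul, Matrix.conjTranspose_mul, Matrix.mul_assoc]
      _ = _ := by rw [ha, hb]
  inv_mem' := by
    intro a ha
    simp only [Set.mem_ofPred_eq] at ha ⊢
    have h1 : a.val * (a⁻¹).val = 1 := by rw [← Units.val_mul]; simp
    have h2 : (a⁻¹).valᴴ * a.valᴴ = 1 := by
      rw [← Matrix.conjTranspose_mul, h1, Matrix.conjTranspose_one]
    calc (a⁻¹).valᴴ * Matrix.J (Fin 2) GaussianInt * (a⁻¹).val
        = (a⁻¹).valᴴ * (a.valᴴ * Matrix.J (Fin 2) GaussianInt * a.val) * (a⁻¹).val := by rw [ha]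
      _ = ((a⁻¹).valᴴ * a.valᴴ) * Matrix.J (Fin 2) GaussianInt * (a.val * (a⁻¹).val) := by
          simp only [Matrix.mul_assoc]
      _ = _ := by rw [h1, h2, Matrix.one_mul, Matrix.mul_one]

/-- The integral points of the parabolic subgroup `P_{2,1}`: the last row is `(0, 0, 0, *)`. -/
def parabolicGroupInt : Subgroup (GL (Fin 2 ⊕ Fin 2) GaussianInt) where
  carrier := {g | g ∈ unitaryGroupInt ∧ ∀ j, j ≠ Sum.inr 1 → g.val (Sum.inr 1) j = 0}
  one_mem' := ⟨one_mem _, fun j hj => by simp [hj.symm]⟩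
  mul_mem' := by
    rintro a b ⟨ha, ha'⟩ ⟨hb, hb'⟩
    refine ⟨mul_mem ha hb, fun j hj => ?_⟩
    rw [Units.val_mul, Matrix.mul_apply]
    refine Finset.sum_eq_zero fun l _ => ?_
    by_cases hl : l = Sum.inr 1
    · rw [hl, hb' j hj, mul_zero]
    · rw [ha' l hl, zero_mul]
  inv_mem' := by
    rintro a ⟨ha, ha'⟩
    refine ⟨inv_mem ha, fun j hj => ?_⟩
    have key : ∀ l, a.val (Sum.inr 1) (Sum.inr 1) * (a⁻¹).val (Sum.inr 1) l =
        (1 : Matrix (Fin 2 ⊕ Fin 2) (Fin 2 ⊕ Fin 2) GaussianInt) (Sum.inr 1) l := by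
      intro l
      have h1 : a.val * (a⁻¹).val = 1 := by rw [← Units.val_mul]; simp
      rw [← h1, Matrix.mul_apply, Finset.sum_eq_single (Sum.inr 1)]
      · intro b _ hb
        rw [ha' b hb, zero_mul]
      · simp
    have hne : a.val (Sum.inr 1) (Sum.inr 1) ≠ 0 := by
      intro h0
      have := key (Sum.inr 1)
      rw [h0, zero_mul, Matrix.one_apply_eq] at this
      exact zero_ne_one this
    have := key j
    rw [Matrix.one_apply_ne hj.symm] at this
    exact (mul_eq_zero.mp this).resolve_left hne

/-- The Hermitian modular group `Γ₂ = U₂(ℤ[i])`, as a subgroup of `GL₄(ℂ)`. -/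
def Gamma2 : Subgroup (GL (Fin 2 ⊕ Fin 2) ℂ) :=
  unitaryGroupInt.map (Matrix.GeneralLinearGroup.map GaussianInt.toComplex)

/-- The parabolic modular group `Γ_{1,1} = P_{2,1}(ℤ[i])`, as a subgroup of `GL₄(ℂ)`. -/
def Gamma11 : Subgroup (GL (Fin 2 ⊕ Fin 2) ℂ) :=
  parabolicGroupInt.map (Matrix.GeneralLinearGroup.map GaussianInt.toComplex)

/-- The group of similitudes `S²`: matrices over `ℚ(i)` with `gᴴ J g = μ J` for some `μ > 0`. -/
def similitudes : Set Mat4 :=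
  {g | (∀ i j, g i j ∈ IntermediateField.adjoin ℚ {Complex.I}) ∧
    ∃ μ : ℝ, 0 < μ ∧ gᴴ * Matrix.J (Fin 2) ℂ * g = (μ : ℂ) • Matrix.J (Fin 2) ℂ}

/-- The factor of similitude `μ(g)`, read off from `gᴴ J g = μ(g) J` at an entry where `J`
is `1`. -/
def simFactor (g : Mat4) : ℂ := (gᴴ * Matrix.J (Fin 2) ℂ * g) (Sum.inr 0) (Sum.inl 0)

/-! ### The upper Hermitian plane and the slash operator -/

/-- The upper Hermitian plane `ℍ₂`: the `Z = X + iY` with `X, Y` Hermitian and `Y > 0`;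
here `Y = (Z - Zᴴ) / 2i`. -/
def H2 : Set Mat2 := {Z | ((2 * Complex.I)⁻¹ • (Z - Zᴴ)).PosDef}

/-- `CZ + D` for `g = (A, B; C, D)`. -/
def denom (g : Mat4) (Z : Mat2) : Mat2 := g.toBlocks₂₁ * Z + g.toBlocks₂₂

/-- `g⟨Z⟩ = (AZ + B)(CZ + D)⁻¹`. -/
def moebius (g : Mat4) (Z : Mat2) : Mat2 :=
  (g.toBlocks₁₁ * Z + g.toBlocks₁₂) * (denom g Z)⁻¹

/-- `(F | g)(Z) = μ(g)^{2k-4} det(CZ + D)^{-k} F(g⟨Z⟩)`. -/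
def slash (k : ℤ) (g : Mat4) (F : Mat2 → ℂ) : Mat2 → ℂ := fun Z =>
  simFactor g ^ (2 * k - 4) * (denom g Z).det ^ (-k) * F (moebius g Z)

/-! ### Cusp forms of degree two -/

/-- The semi-integral Hermitian matrices: `n_{ii} ∈ ℤ` and `n_{ij} ∈ (1/2) ℤ[i]`. -/
def semiIntegral : Set Mat2 :=
  {N | N.IsHermitian ∧ (∀ i, ∃ n : ℤ, N i i = n) ∧
    ∀ i j, i ≠ j → ∃ a : GaussianInt, N i j = (a : ℂ) / 2}

/-- `F ∈ S₂ᵏ`: `F` is holomorphic on `ℍ₂`, invariant of weight `k` under `Γ₂`, and has a Fourier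
expansion `F(Z) = ∑ a(N) e(tr(NZ))` over semi-integral non-negative `N` in which `a(N) ≠ 0` only
for positive definite `N`. -/
structure IsCuspForm (k : ℤ) (F : Mat2 → ℂ) : Prop where
  holomorphic : DifferentiableOn ℂ F H2
  modular : ∀ γ ∈ Gamma2, ∀ Z ∈ H2, F (moebius γ.val Z) = (denom γ.val Z).det ^ k * F Z
  fourier : ∃ a : {N : Mat2 // N ∈ semiIntegral ∧ N.PosSemidef} → ℂ,
    (∀ N, a N ≠ 0 → N.val.PosDef) ∧
    ∀ Z ∈ H2, HasSum (fun N => a N * e ((N.val * Z).trace)) (F Z)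

/-! ### Hecke operators -/

/-- The set `Γ \ ΓgΓ` of left cosets `Γh` contained in the double coset `ΓgΓ`, as orbits of the
left multiplication action of `Γ` on matrices. -/
def leftCosets (Γ : Subgroup (GL (Fin 2 ⊕ Fin 2) ℂ)) (g : Mat4) :
    Set (MulAction.orbitRel.Quotient Γ Mat4) :=
  {c | ∃ γ₁ ∈ Γ, ∃ γ₂ ∈ Γ, c = Quotient.mk _ (γ₁.val * g * γ₂.val)}

/-- The action `F | ΓgΓ = ∑ F | gᵢ`, where `ΓgΓ` is the disjoint union of the `Γgᵢ`. -/
def hecke (k : ℤ) (Γ : Subgroup (GL (Fin 2 ⊕ Fin 2) ℂ)) (g : Mat4) (F : Mat2 → ℂ) : Mat2 → ℂ :=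
  fun Z => ∑ᶠ c ∈ leftCosets Γ g, slash k (Quotient.out c) F Z

/-- `F | Γ₂gΓ₂ = a F` on `ℍ₂`. -/
def IsHeckeEigenvalue (k : ℤ) (F : Mat2 → ℂ) (g : Mat4) (a : ℂ) : Prop :=
  ∀ Z ∈ H2, hecke k Gamma2 g F Z = a * F Z

/-- A Hecke eigenform in `S₂ᵏ`: a nonzero cusp form that is an eigenfunction of all the double
cosets `Γ₂gΓ₂` with `g ∈ S²`, hence of the whole Hecke ring `H(Γ₂, S²)`, which they span. -/
structure IsHeckeEigenform (k : ℤ) (F : Mat2 → ℂ) : Prop where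
  cusp : IsCuspForm k F
  ne_zero : ∃ Z ∈ H2, F Z ≠ 0
  eigen : ∀ g ∈ similitudes, ∃ a : ℂ, IsHeckeEigenvalue k F g a

/-- The eigenvalue of `Γ₂gΓ₂` on a Hecke eigenform `F`. -/
def heckeEigenvalue (k : ℤ) (F : Mat2 → ℂ) (g : Mat4) : ℂ :=
  Classical.epsilon (IsHeckeEigenvalue k F g)

/-! ### The matrices of the Hecke operators at a split prime -/

/-- `diag(a, b, c, d)` with Gaussian integer entries, as a complex matrix. -/
def diag4 (a b c d : GaussianInt) : Mat4 :=
  Matrix.diagonal (Sum.elim ![(a : ℂ), (b : ℂ)] ![(c : ℂ), (d : ℂ)])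

/-- The matrix of `Λ₊(π) = Γ_{1,1} diag(π, 1, π, p) Γ_{1,1}`; also used at `(p^δ, π^δ)`. -/
def lambdaPlus (p : ℕ) (ϖ : GaussianInt) : Mat4 := diag4 ϖ 1 ϖ p

/-- The matrix of `Λ₋(π) = Γ_{1,1} diag(π, p, π, 1) Γ_{1,1}`. -/
def lambdaMinus (p : ℕ) (ϖ : GaussianInt) : Mat4 := diag4 ϖ p ϖ 1

/-- The matrix of `T(π)`, the double coset of `diag(1, π, p, π)`, with respect to `Γ₂` or to
`Γ_{1,1}`. -/
def tOne (p : ℕ) (ϖ : GaussianInt) : Mat4 := diag4 1 ϖ p ϖ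

/-- The matrix of `T(p) = Γ₂ diag(1, 1, p, p) Γ₂`. -/
def tTwo (p : ℕ) : Mat4 := diag4 1 1 p p

/-- The matrix of `T(π, π') = Γ_{1,1} diag(π, π', π, π') Γ_{1,1}`, where `π'` is the conjugate
of `π`. -/
def tMixed (ϖ : GaussianInt) : Mat4 := diag4 ϖ (star ϖ) ϖ (star ϖ)

/-- The matrix of `Δ_π`, the double coset of `diag(π, π, π, π)`. -/
def deltaMat (ϖ : GaussianInt) : Mat4 := diag4 ϖ ϖ ϖ ϖ

/-- The polynomial `D_{π,F}⁽²⁾(X)`: the polynomial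
`1 - T(π')X + p Δ_{π'} T(p) X² - p³ Δ_{π'}² T(π) X³ + p⁶ Δ_{π'}³ Δ_π X⁴` (with `π'` the conjugate
of `π`) over the Hecke ring of `Γ₂`, with each operator replaced by its eigenvalue on `F`. -/
def standardPoly (k : ℤ) (F : Mat2 → ℂ) (p : ℕ) (ϖ : GaussianInt) : Polynomial ℂ :=
  1 - Polynomial.C (heckeEigenvalue k F (tOne p (star ϖ))) * Polynomial.X
    + Polynomial.C (p * heckeEigenvalue k F (deltaMat (star ϖ)) * heckeEigenvalue k F (tTwo p))
      * Polynomial.X ^ 2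
    - Polynomial.C (p ^ 3 * heckeEigenvalue k F (deltaMat (star ϖ)) ^ 2
        * heckeEigenvalue k F (tOne p ϖ)) * Polynomial.X ^ 3
    + Polynomial.C (p ^ 6 * heckeEigenvalue k F (deltaMat (star ϖ)) ^ 3
        * heckeEigenvalue k F (deltaMat ϖ)) * Polynomial.X ^ 4

/-! ### Fourier-Jacobi coefficients and the action of the parabolic Hecke operators -/

/-- Functions of `(τ, z₁, z₂) ∈ ℍ₁ × ℂ²`. -/
abbrev JacobiFun := ℍ × ℂ × ℂ → ℂ

/-- A choice of `ω` with `(τ, z₁; z₂, ω) ∈ ℍ₂`, that is, with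
`Im ω > |z₁ - conj z₂|² / (4 Im τ)`. -/
def basePoint (w : ℍ × ℂ × ℂ) : ℂ :=
  Complex.I * (1 + Complex.normSq (w.2.1 - star w.2.2) / (4 * w.1.im) : ℝ)

/-- The matrix `(τ, z₁; z₂, ω)`. -/
def pointMat (w : ℍ × ℂ × ℂ) (ω : ℂ) : Mat2 := !![(w.1 : ℂ), w.2.1; w.2.2, ω]

/-- The `m`-th Fourier-Jacobi coefficient `φ_m` of `F`, that is, the `m`-th Fourier coefficient in
`F(τ, z₁; z₂, ω) = ∑ φ_m(τ, z₁, z₂) e(mω)`. -/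
def fourierJacobi (F : Mat2 → ℂ) (m : ℕ) : JacobiFun := fun w =>
  ∫ x in (0 : ℝ)..1, F (pointMat w (basePoint w + x)) * e (-(m * (basePoint w + x)))

/-- `φ_{m/d}`, which is zero when `d` does not divide `m`. -/
def fourierJacobiDiv (F : Mat2 → ℂ) (m d : ℕ) : JacobiFun :=
  if d ∣ m then fourierJacobi F (m / d) else 0

/-- The function `φ(τ, z₁, z₂) e(mω)` of `(τ, z₁; z₂, ω) ∈ ℍ₂`. -/
def pForm (m : ℕ) (φ : JacobiFun) : Mat2 → ℂ := fun Z =>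
  φ (UpperHalfPlane.ofComplex (Z 0 0), Z 0 1, Z 1 0) * e (m * Z 1 1)

/-- The signature `b / a` of `Γ_{1,1}gΓ_{1,1}`, where `g` in the parabolic subgroup has second
column `(0, a, 0, 0)` and last row `(0, 0, 0, b)`. -/
def signature (g : Mat4) : ℂ := g (Sum.inr 1) (Sum.inr 1) / g (Sum.inl 1) (Sum.inl 1)

/-- The action of `X = Γ_{1,1}gΓ_{1,1}`, of signature `s`, on a Jacobi form `φ` of weight `k` and
index `m`: `(φ | X)(τ, z₁, z₂) = (φ e(m ·) | X)(τ, z₁; z₂, ω) e(-(m/s) ω)`, which does not depend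
on `ω`. -/
def jacobiHecke (k : ℤ) (m : ℕ) (g : Mat4) (φ : JacobiFun) : JacobiFun := fun w =>
  hecke k Gamma11 g (pForm m φ) (pointMat w (basePoint w))
    * e (-((m / signature g) * basePoint w))

/-- An operator on functions applied to the coefficients of a power series in `X`. -/
def coeffwise (T : JacobiFun → JacobiFun) (Ψ : PowerSeries JacobiFun) : PowerSeries JacobiFun :=
  PowerSeries.mk fun n => T (PowerSeries.coeff n Ψ)

/-- The action of `S_π(X) = 1 - T(π')X + p Δ_{π'} T(π, π') X²` (with `π'` the conjugate of `π`)
on power series in `X` whose coefficients are Jacobi forms of weight `k` and index `m`. The three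
operators have signature one, so they keep the index. -/
def sAction (k : ℤ) (m p : ℕ) (ϖ : GaussianInt) (Ψ : PowerSeries JacobiFun) :
    PowerSeries JacobiFun :=
  Ψ - coeffwise (jacobiHecke k m (tOne p (star ϖ))) Ψ * PowerSeries.X
    + (p : PowerSeries JacobiFun) *
      coeffwise (fun φ => jacobiHecke k m (tMixed ϖ) (jacobiHecke k m (deltaMat (star ϖ)) φ)) Ψ
      * PowerSeries.X ^ 2

/-- The power series `∑_{δ ≥ 0} φ_{m p^δ} | Λ₊(π^δ) X^δ`. -/
def lambdaPlusSeries (k : ℤ) (F : Mat2 → ℂ) (m p : ℕ) (ϖ : GaussianInt) :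
    PowerSeries JacobiFun :=
  PowerSeries.mk fun δ =>
    jacobiHecke k (m * p ^ δ) (lambdaPlus (p ^ δ) (ϖ ^ δ)) (fourierJacobi F (m * p ^ δ))

/-- A complex polynomial in `X`, seen as a power series with constant functions as
coefficients. -/
def scalarSeries (P : Polynomial ℂ) : PowerSeries JacobiFun :=
  ((P.map (algebraMap ℂ JacobiFun) : Polynomial JacobiFun) : PowerSeries JacobiFun)

end HermitianModular

end

open HermitianModular

open scoped ComplexOrder Matrix UpperHalfPlane

noncomputable section

namespace HermitianModular

/-! ### Similitudes and the slash operator -/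

/-! Write ϖ' for `star ϖ` and d for diag(ϖ', 1, ϖ', p), the matrix of Λ₊(ϖ'). The identity is proved
for functions on the upper Hermitian plane, by counting subspaces over 𝔽_p and eliminating; only at
the end is it transferred to Fourier–Jacobi coefficients.

At a split prime the unitary group looks like GL₄ modulo ϖ. A left coset Γ₂h inside the double coset
of T(ϖ') or of T(p) is determined by the kernel of h modulo ϖ, a line or a plane in 𝔽_p⁴. The group
Γ_{1,1} preserves the flag ⟨e₂⟩ ⊂ {x₄ = 0}, and the position of the kernel relative to this flag is
the only invariant of the Γ_{1,1}-orbit. So the lines form three orbits, of sizes 1, p(p+1), p³, and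
the planes form four, of sizes p+1, p², p², p³(p+1), all with diagonal representatives
(`tOne_cover`, `tTwo_cover`, the disjointness lemmas and the index lemmas). By `hecke_eq_sum` each
Hecke operator of Γ₂ is then a sum, over these representatives x, of the orbit size times the
average of F|x over Γ_{1,1} (`hecke_tOne`, `hecke_tTwo`).

Since Γ_{1,1}d ⊂ dΓ_{1,1}, slashing such a sum by dʲ and averaging again absorbs the inner averages
(`orbitAvg_comp_orbitAvg`, `SplitPrime.orbitAvg_plusPow_sum`). Each of the eigenvalue equations for
T(ϖ'), T(p), T(ϖ) thus gives one linear relation for every j. Multiplying by d a representative that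
has to be eliminated gives ϖ' times a representative occurring in a later equation, and at the last
stage the scalar matrix p; scalars act through the eigenvalues of the Δ's. Eliminating in turn
(`recursion_two`, `recursion_three`, `recursion_four`) shows that the quartic polynomial annihilates
the sequence F|Λ₊(ϖ'ʲ) from degree four on, and identifies the remainders in lower degree with the
right-hand side (`SplitPrime.hecke_identities`).

A parabolic element of signature s acts on a line ω ↦ (τ, z₁; z₂, ω) by an affine map of slope 1/s.
Therefore the m-th Fourier–Jacobi coefficient of F|X is φ_{ms}|X, and it vanishes when ms is not an
integer (`jacobiHecke_of_signature_natCast`, `jacobiHecke_of_signature_inv`). Taking m-th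
coefficients is linear, so the identities between functions become the coefficients of the identity
of power series. -/

/-- Complex similitudes of `J` with positive real multiplier. -/
def IsSimilitude (g : Mat4) : Prop :=
  ∃ μ : ℝ, 0 < μ ∧ gᴴ * Matrix.J (Fin 2) ℂ * g = (μ : ℂ) • Matrix.J (Fin 2) ℂ

lemma IsSimilitude.mul {g h : Mat4} (hg : IsSimilitude g) (hh : IsSimilitude h) :
    IsSimilitude (g * h) := by
  obtain ⟨μ, hμ, h1⟩ := hg
  obtain ⟨ν, hν, h2⟩ := hh
  refine ⟨μ * ν, mul_pos hμ hν, ?_⟩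
  calc (g * h)ᴴ * Matrix.J (Fin 2) ℂ * (g * h) = hᴴ * (gᴴ * Matrix.J (Fin 2) ℂ * g) * h := by
        simp only [Matrix.conjTranspose_mul, Matrix.mul_assoc]
    _ = _ := by
        rw [h1, Matrix.mul_smul, Matrix.smul_mul, h2, smul_smul]
        push_cast
        rfl

lemma simFactor_eq {g : Mat4} {μ : ℂ}
    (h : gᴴ * Matrix.J (Fin 2) ℂ * g = μ • Matrix.J (Fin 2) ℂ) : simFactor g = μ := by
  rw [simFactor, h]
  simp [Matrix.J]

lemma simFactor_mul {g h : Mat4} (hg : IsSimilitude g) (hh : IsSimilitude h) :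
    simFactor (g * h) = simFactor g * simFactor h := by
  obtain ⟨μ, hμ, h1⟩ := hg
  obtain ⟨ν, hν, h2⟩ := hh
  rw [simFactor_eq h1, simFactor_eq h2]
  refine simFactor_eq ?_
  calc (g * h)ᴴ * Matrix.J (Fin 2) ℂ * (g * h) = hᴴ * (gᴴ * Matrix.J (Fin 2) ℂ * g) * h := by
        simp only [Matrix.conjTranspose_mul, Matrix.mul_assoc]
    _ = _ := by
        rw [h1, Matrix.mul_smul, Matrix.smul_mul, h2, smul_smul]

/-- The `4 × 2` matrix with blocks `Z` and `W`. -/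
def stack (Z W : Mat2) : Matrix (Fin 2 ⊕ Fin 2) (Fin 2) ℂ := Matrix.fromRows Z W

lemma stack_mul (Z W D : Mat2) : stack Z W * D = stack (Z * D) (W * D) :=
  Matrix.fromRows_mul _ _ _

lemma stack_inj {Z W Z' W' : Mat2} (h : stack Z W = stack Z' W') : Z = Z' ∧ W = W' :=
  Matrix.fromRows_inj.eq_iff.mp h

lemma mul_stack (g : Mat4) (Z W : Mat2) :
    g * stack Z W = stack (g.toBlocks₁₁ * Z + g.toBlocks₁₂ * W)
      (g.toBlocks₂₁ * Z + g.toBlocks₂₂ * W) := by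
  conv_lhs => rw [← Matrix.fromBlocks_toBlocks g]
  rw [stack, Matrix.fromBlocks_mul_fromRows]
  rfl

lemma stack_conj_J (W D : Mat2) :
    (stack W D)ᴴ * Matrix.J (Fin 2) ℂ * stack W D = Dᴴ * W - Wᴴ * D := by
  rw [stack, Matrix.conjTranspose_fromRows_eq_fromCols_conjTranspose, Matrix.J,
    Matrix.fromCols_mul_fromBlocks, Matrix.fromCols_mul_fromRows]
  simp [sub_eq_add_neg]

/-- The form `J` evaluated on the columns of (Z; 1) is Z - Zᴴ, and g multiplies the form by μ while
sending (Z; 1) to (AZ + B; CZ + D). Both regularity of CZ + D and stability of the plane follow from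
this. -/
lemma denom_conj_mul {g : Mat4} {μ : ℂ}
    (h : gᴴ * Matrix.J (Fin 2) ℂ * g = μ • Matrix.J (Fin 2) ℂ) (Z : Mat2) :
    (denom g Z)ᴴ * (g.toBlocks₁₁ * Z + g.toBlocks₁₂)
      - (g.toBlocks₁₁ * Z + g.toBlocks₁₂)ᴴ * denom g Z = μ • (Z - Zᴴ) := by
  have h1 := mul_stack g Z 1
  rw [Matrix.mul_one, Matrix.mul_one] at h1
  rw [denom, ← stack_conj_J, ← h1, Matrix.conjTranspose_mul]
  calc _ = (stack Z 1)ᴴ * (gᴴ * Matrix.J (Fin 2) ℂ * g) * stack Z 1 := by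
        simp only [Matrix.mul_assoc]
    _ = _ := by
        rw [h, Matrix.mul_smul, Matrix.smul_mul, stack_conj_J]
        simp

/-- A kernel vector v of CZ + D would be isotropic for Z - Zᴴ by `denom_conj_mul`, against
positivity of the imaginary part. -/
lemma isUnit_denom {g : Mat4} (hg : IsSimilitude g) {Z : Mat2} (hZ : Z ∈ H2) :
    IsUnit (denom g Z).det := by
  obtain ⟨μ, hμ, h⟩ := hg
  by_contra hu
  have h0 : (denom g Z).det = 0 := by simpa using hu
  obtain ⟨v, hv, hv0⟩ := Matrix.exists_mulVec_eq_zero_iff.mpr h0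
  have key := denom_conj_mul h Z
  have hpos := Matrix.PosDef.dotProduct_mulVec_pos hZ hv
  have h2 : star v ⬝ᵥ ((μ : ℂ) • (Z - Zᴴ)) *ᵥ v = 0 := by
    rw [← key, Matrix.sub_mulVec, dotProduct_sub, ← Matrix.mulVec_mulVec, ← Matrix.mulVec_mulVec,
      hv0, Matrix.dotProduct_mulVec, ← Matrix.star_mulVec, hv0]
    simp
  rw [Matrix.smul_mulVec, dotProduct_smul, smul_eq_mul] at h2
  rw [Matrix.smul_mulVec, dotProduct_smul, smul_eq_mul] at hpos
  rcases mul_eq_zero.mp h2 with h3 | h3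
  · exact hμ.ne' (by exact_mod_cast h3)
  · rw [h3, mul_zero] at hpos
    exact lt_irrefl _ hpos

lemma moebius_mul_denom {g : Mat4} {Z : Mat2} (h : IsUnit (denom g Z).det) :
    moebius g Z * denom g Z = g.toBlocks₁₁ * Z + g.toBlocks₁₂ := by
  rw [moebius, Matrix.mul_assoc, Matrix.nonsing_inv_mul _ h, Matrix.mul_one]

lemma moebius_mem {g : Mat4} (hg : IsSimilitude g) {Z : Mat2} (hZ : Z ∈ H2) :
    moebius g Z ∈ H2 := by
  have hu := isUnit_denom hg hZ
  obtain ⟨μ, hμ, h⟩ := hg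
  have key := denom_conj_mul h Z
  rw [← moebius_mul_denom hu, Matrix.conjTranspose_mul] at key
  set D := denom g Z
  have hu' : IsUnit D⁻¹.det := by
    rw [Matrix.det_nonsing_inv]; exact hu.ringInverse
  -- The imaginary part of g⟨Z⟩ is congruent, through D⁻¹, to μ times that of Z.
  have e1 : moebius g Z - (moebius g Z)ᴴ = (D⁻¹)ᴴ * ((μ : ℂ) • (Z - Zᴴ)) * D⁻¹ := by
    have hD : D * D⁻¹ = 1 := Matrix.mul_nonsing_inv _ hu
    have hD' : (D⁻¹)ᴴ * Dᴴ = 1 := by rw [← Matrix.conjTranspose_mul, hD]; simp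
    rw [← key]
    calc _ = ((D⁻¹)ᴴ * Dᴴ) * moebius g Z * (D * D⁻¹)
          - ((D⁻¹)ᴴ * Dᴴ) * (moebius g Z)ᴴ * (D * D⁻¹) := by rw [hD, hD']; simp
      _ = _ := by
        simp only [Matrix.mul_assoc, Matrix.mul_sub, Matrix.sub_mul]
  change ((2 * Complex.I)⁻¹ • (moebius g Z - (moebius g Z)ᴴ)).PosDef
  rw [e1]
  have e2 : (2 * Complex.I)⁻¹ • ((D⁻¹)ᴴ * ((μ : ℂ) • (Z - Zᴴ)) * D⁻¹)
      = μ • ((D⁻¹)ᴴ * ((2 * Complex.I)⁻¹ • (Z - Zᴴ)) * D⁻¹) := by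
    ext i j
    simp only [Matrix.mul_smul, Matrix.smul_mul, Matrix.smul_apply, smul_eq_mul,
      Complex.real_smul]
    ring
  rw [e2]
  refine Matrix.PosDef.smul ?_ hμ
  refine Matrix.PosDef.conjTranspose_mul_mul_same hZ ?_
  exact Matrix.mulVec_injective_of_isUnit ((Matrix.isUnit_iff_isUnit_det _).mpr hu')

/-- In the coordinates (Z; 1) the fractional linear action is matrix multiplication up to a factor
on the right, so the cocycle relation and the composition law below reduce to associativity. -/
lemma mul_stack_one {g : Mat4} {Z : Mat2} (h : IsUnit (denom g Z).det) :
    g * stack Z 1 = stack (moebius g Z) 1 * denom g Z := by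
  rw [mul_stack, stack_mul, moebius_mul_denom h]
  simp [denom]

lemma denom_mul {g h : Mat4} (hh : IsSimilitude h) {Z : Mat2}
    (hZ : Z ∈ H2) : denom (g * h) Z = denom g (moebius h Z) * denom h Z := by
  have h2 := mul_stack_one (isUnit_denom hh hZ)
  have h3 : (g * h) * stack Z 1
      = stack (g.toBlocks₁₁ * moebius h Z + g.toBlocks₁₂)
        (denom g (moebius h Z)) * denom h Z := by
    rw [Matrix.mul_assoc, h2, ← Matrix.mul_assoc, mul_stack]
    simp [denom]
  rw [mul_stack, stack_mul] at h3
  have := stack_inj h3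
  simpa [denom] using this.2

lemma moebius_mul {g h : Mat4} (hg : IsSimilitude g) (hh : IsSimilitude h) {Z : Mat2}
    (hZ : Z ∈ H2) : moebius (g * h) Z = moebius g (moebius h Z) := by
  have h1 := mul_stack_one (isUnit_denom (hg.mul hh) hZ)
  have h2 := mul_stack_one (isUnit_denom hh hZ)
  have h3 := mul_stack_one (isUnit_denom hg (moebius_mem hh hZ))
  rw [Matrix.mul_assoc, h2, ← Matrix.mul_assoc, h3, Matrix.mul_assoc, ← denom_mul hh hZ,
    stack_mul, stack_mul] at h1
  have h4 := (stack_inj h1).1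
  have hu := isUnit_denom (hg.mul hh) hZ
  calc _ = moebius (g * h) Z * (denom (g * h) Z * (denom (g * h) Z)⁻¹) := by
        rw [Matrix.mul_nonsing_inv _ hu, Matrix.mul_one]
    _ = moebius g (moebius h Z) * (denom (g * h) Z * (denom (g * h) Z)⁻¹) := by
        rw [← Matrix.mul_assoc, ← h4, Matrix.mul_assoc]
    _ = _ := by rw [Matrix.mul_nonsing_inv _ hu, Matrix.mul_one]

lemma slash_mul (k : ℤ) {g h : Mat4} (hg : IsSimilitude g) (hh : IsSimilitude h) (F : Mat2 → ℂ)
    {Z : Mat2} (hZ : Z ∈ H2) : slash k (g * h) F Z = slash k h (slash k g F) Z := by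
  simp only [slash]
  rw [simFactor_mul hg hh, denom_mul hh hZ, moebius_mul hg hh hZ, Matrix.det_mul, mul_zpow,
    mul_zpow]
  ring

/-- Functions on the upper Hermitian plane. -/
abbrev PlaneFun := H2 → ℂ

/-- Extension by zero. -/
def extend (f : PlaneFun) : Mat2 → ℂ := fun Z => open Classical in if h : Z ∈ H2 then f ⟨Z, h⟩ else 0

/-- Restriction to the upper Hermitian plane. -/
def restrict (F : Mat2 → ℂ) : PlaneFun := fun Z => F Z

lemma extend_of_mem (f : PlaneFun) {Z : Mat2} (hZ : Z ∈ H2) : extend f Z = f ⟨Z, hZ⟩ := by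
  simp [extend, hZ]

/-- The slash operator as a linear map on functions on the upper Hermitian plane. -/
def slashMap (k : ℤ) (g : Mat4) : PlaneFun →ₗ[ℂ] PlaneFun where
  toFun f := fun Z => slash k g (extend f) Z
  map_add' f₁ f₂ := by
    ext Z
    by_cases h : moebius g Z ∈ H2 <;> simp [slash, extend, h, mul_add]
  map_smul' c f := by
    ext Z
    by_cases h : moebius g Z ∈ H2
    · simp only [slash, extend, h, dite_true, Pi.smul_apply, smul_eq_mul, RingHom.id_apply]
      ring
    · simp [slash, extend, h]

lemma slashMap_restrict (k : ℤ) {g : Mat4} (hg : IsSimilitude g) (F : Mat2 → ℂ) (Z : H2) :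
    slashMap k g (restrict F) Z = slash k g F Z := by
  simp only [slashMap, slash, LinearMap.coe_mk, AddHom.coe_mk]
  rw [extend_of_mem _ (moebius_mem hg Z.2)]
  rfl

/-- The composition law holds only at points of the upper Hermitian plane. Working with functions on
the plane alone makes it an equality of functions, as a group representation requires. -/
lemma slashMap_mul (k : ℤ) {g h : Mat4} (hg : IsSimilitude g) (hh : IsSimilitude h)
    (f : PlaneFun) : slashMap k (g * h) f = slashMap k h (slashMap k g f) := by
  ext Z
  have h1 : slashMap k (g * h) f Z = slash k (g * h) (extend f) Z := rfl
  have h2 : slashMap k h (slashMap k g f) Z = slash k h (extend (slashMap k g f)) Z := rfl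
  rw [h1, h2, slash_mul k hg hh _ Z.2]
  simp only [slash]
  rw [extend_of_mem _ (moebius_mem hh Z.2)]
  rfl

lemma isSimilitude_scalar {c : ℂ} (hc : c ≠ 0) : IsSimilitude (c • (1 : Mat4)) := by
  refine ⟨Complex.normSq c, Complex.normSq_pos.mpr hc, ?_⟩
  rw [Complex.normSq_eq_conj_mul_self]
  simp [smul_smul]
  rw [mul_comm]

lemma slashMap_scalar (k : ℤ) {c : ℂ} (hc : c ≠ 0) (f : PlaneFun) :
    slashMap k (c • 1) f = ((c * star c) ^ (2 * k - 4) * (c ^ 2) ^ (-k)) • f := by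
  ext Z
  have h1 : simFactor (c • (1 : Mat4)) = c * star c := by
    refine simFactor_eq ?_
    simp [smul_smul]
  have hd : denom (c • (1 : Mat4)) Z = c • 1 := by
    ext i j
    fin_cases i <;> fin_cases j <;>
      simp [denom, Matrix.toBlocks₂₁, Matrix.toBlocks₂₂, Matrix.mul_apply]
  have hm : moebius (c • (1 : Mat4)) Z = Z := by
    have hu := isUnit_denom (isSimilitude_scalar hc) Z.2
    have := moebius_mul_denom hu
    rw [hd] at this
    have h2 : (c • (1 : Mat4)).toBlocks₁₁ * Z.1 + (c • (1 : Mat4)).toBlocks₁₂ = c • Z.1 := by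
      ext i j
      fin_cases i <;> fin_cases j <;>
        simp [Matrix.toBlocks₁₁, Matrix.toBlocks₁₂, Matrix.mul_apply]
    rw [h2, Matrix.mul_smul, Matrix.mul_one] at this
    exact smul_right_injective _ hc this
  change slash k (c • 1) (extend f) Z = _
  simp only [slash, h1, hd, hm]
  rw [extend_of_mem _ Z.2]
  simp

/-! ### Averages over finite orbits -/

section Average

variable {G V : Type*} [Group G] [AddCommGroup V] [Module ℂ V] (R : G →* Module.End ℂ V)

/-- The stabilizer of a vector. -/
def vecStab (v : V) : Subgroup G where
  carrier := {g | R g v = v}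
  one_mem' := by simp
  mul_mem' := by
    intro a b ha hb
    simp only [Set.mem_ofPred_eq, map_mul, Module.End.mul_apply] at *
    rw [hb, ha]
  inv_mem' := by
    intro a ha
    simp only [Set.mem_ofPred_eq] at *
    conv_lhs => rw [← ha]
    rw [← Module.End.mul_apply, ← map_mul]
    simp

lemma mem_vecStab {v : V} {g : G} : g ∈ vecStab R v ↔ R g v = v := Iff.rfl

/-- The average of a vector over its orbit. -/
def orbitAvg (v : V) : V :=
  ((vecStab R v).index : ℂ)⁻¹ • ∑ᶠ q : G ⧸ vecStab R v, R q.out v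

lemma apply_out_eq {v : V} {K : Subgroup G} (hK : K ≤ vecStab R v) (g : G) :
    R ((g : G ⧸ K)).out v = R g v := by
  obtain ⟨h, hh⟩ := QuotientGroup.mk_out_eq_mul K g
  rw [hh, map_mul, Module.End.mul_apply, (mem_vecStab R).mp (hK h.2)]

/-- The fibres of G/K → G/Stab(v) all have [Stab(v) : K] elements, and the summand is constant on
them. A Hecke sum can therefore be taken over any known group of finite index fixing v, without
finding the exact stabilizer. -/
lemma sum_quotient_eq {v : V} (K : Subgroup G) [K.FiniteIndex] (hK : K ≤ vecStab R v) :
    ∑ᶠ q : G ⧸ K, R q.out v = (K.index : ℂ) • orbitAvg R v := by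
  classical
  have : (vecStab R v).FiniteIndex := Subgroup.finiteIndex_of_le hK
  let : Fintype (G ⧸ K) := Subgroup.fintypeQuotientOfFiniteIndex
  let : Fintype (G ⧸ vecStab R v) := Subgroup.fintypeQuotientOfFiniteIndex
  let eqv := Subgroup.quotientEquivProdOfLE hK
  let : Fintype (vecStab R v ⧸ K.subgroupOf (vecStab R v)) := by
    have : Finite ((G ⧸ vecStab R v) × (vecStab R v ⧸ K.subgroupOf (vecStab R v))) :=
      Finite.of_equiv _ eqv
    have : Nonempty (G ⧸ vecStab R v) := ⟨((1 : G) : G ⧸ vecStab R v)⟩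
    have := Finite.prod_right (α := G ⧸ vecStab R v)
      (β := vecStab R v ⧸ K.subgroupOf (vecStab R v))
    exact Fintype.ofFinite _
  have hfst : ∀ q : G ⧸ K, R q.out v = R (eqv q).1.out v := by
    intro q
    induction q using QuotientGroup.induction_on with
    | H g =>
      have : (eqv (g : G ⧸ K)).1 = (g : G ⧸ vecStab R v) := rfl
      rw [this, apply_out_eq R hK, apply_out_eq R le_rfl]
  rw [orbitAvg, finsum_eq_sum_of_fintype, finsum_eq_sum_of_fintype]
  rw [Finset.sum_congr rfl (fun q _ => hfst q),
    Fintype.sum_equiv eqv (fun q => R (eqv q).1.out v) (fun x => R x.1.out v) (fun _ => rfl),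
    Fintype.sum_prod_type]
  simp only [Finset.sum_const, ← Finset.smul_sum]
  have h1 : K.index = (vecStab R v).index *
      (Finset.univ : Finset (vecStab R v ⧸ K.subgroupOf (vecStab R v))).card := by
    rw [Subgroup.index, Nat.card_congr eqv, Nat.card_prod, Finset.card_univ,
      ← Nat.card_eq_fintype_card (α := vecStab R v ⧸ _)]
    rfl
  rw [smul_smul, h1]
  have h2 : ((vecStab R v).index : ℂ) ≠ 0 := by
    exact_mod_cast Subgroup.FiniteIndex.index_ne_zero
  push_cast
  rw [mul_right_comm, mul_inv_cancel₀ h2, one_mul, Nat.cast_smul_eq_nsmul]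

lemma orbitAvg_eq_of_le {v : V} (K : Subgroup G) [K.FiniteIndex] (hK : K ≤ vecStab R v) :
    orbitAvg R v = (K.index : ℂ)⁻¹ • ∑ᶠ q : G ⧸ K, R q.out v := by
  rw [sum_quotient_eq R K hK, smul_smul, inv_mul_cancel₀, one_smul]
  exact_mod_cast Subgroup.FiniteIndex.index_ne_zero

/-- Vectors with finite orbit. -/
def HasFiniteOrbit (v : V) : Prop := (vecStab R v).FiniteIndex

lemma HasFiniteOrbit.of_le {v : V} {K : Subgroup G} [K.FiniteIndex] (hK : K ≤ vecStab R v) :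
    HasFiniteOrbit R v := Subgroup.finiteIndex_of_le hK

lemma HasFiniteOrbit.add {v w : V} (hv : HasFiniteOrbit R v) (hw : HasFiniteOrbit R w) :
    HasFiniteOrbit R (v + w) := by
  have : (vecStab R v).FiniteIndex := hv
  have : (vecStab R w).FiniteIndex := hw
  refine HasFiniteOrbit.of_le R (K := vecStab R v ⊓ vecStab R w) fun g hg => ?_
  rw [mem_vecStab, map_add, (mem_vecStab R).mp hg.1, (mem_vecStab R).mp hg.2]

lemma HasFiniteOrbit.smul {v : V} (c : ℂ) (hv : HasFiniteOrbit R v) :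
    HasFiniteOrbit R (c • v) := by
  have : (vecStab R v).FiniteIndex := hv
  refine HasFiniteOrbit.of_le R (K := vecStab R v) fun g hg => ?_
  rw [mem_vecStab, map_smul, (mem_vecStab R).mp hg]

lemma HasFiniteOrbit.of_fixed {v : V} (hv : ∀ g, R g v = v) : HasFiniteOrbit R v :=
  HasFiniteOrbit.of_le R (K := ⊤) fun g _ => hv g

lemma HasFiniteOrbit.sum {ι : Type*} (s : Finset ι) {v : ι → V}
    (hv : ∀ i ∈ s, HasFiniteOrbit R (v i)) : HasFiniteOrbit R (∑ i ∈ s, v i) := by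
  classical
  induction s using Finset.induction_on with
  | empty => exact HasFiniteOrbit.of_fixed R fun g => by simp
  | insert a s ha ih =>
    rw [Finset.sum_insert ha]
    exact (hv a (Finset.mem_insert_self _ _)).add R
      (ih fun i hi => hv i (Finset.mem_insert_of_mem hi))

/-- The averages are compared over the intersection of the two stabilizers, which still has finite
index. -/
lemma orbitAvg_add {v w : V} (hv : HasFiniteOrbit R v) (hw : HasFiniteOrbit R w) :
    orbitAvg R (v + w) = orbitAvg R v + orbitAvg R w := by
  have : (vecStab R v).FiniteIndex := hv
  have : (vecStab R w).FiniteIndex := hw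
  set K := vecStab R v ⊓ vecStab R w
  let : Fintype (G ⧸ K) := Subgroup.fintypeQuotientOfFiniteIndex
  rw [orbitAvg_eq_of_le R K (v := v) inf_le_left, orbitAvg_eq_of_le R K (v := w) inf_le_right,
    orbitAvg_eq_of_le R K (v := v + w), ← smul_add]
  · simp only [finsum_eq_sum_of_fintype, map_add, Finset.sum_add_distrib]
  · intro g hg
    rw [mem_vecStab, map_add, (mem_vecStab R).mp hg.1, (mem_vecStab R).mp hg.2]

lemma orbitAvg_smul {v : V} (c : ℂ) (hv : HasFiniteOrbit R v) :
    orbitAvg R (c • v) = c • orbitAvg R v := by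
  have : (vecStab R v).FiniteIndex := hv
  let : Fintype (G ⧸ vecStab R v) := Subgroup.fintypeQuotientOfFiniteIndex
  rw [orbitAvg_eq_of_le R (vecStab R v) (v := c • v), orbitAvg, smul_comm]
  · simp only [finsum_eq_sum_of_fintype, map_smul, ← Finset.smul_sum]
  · intro g hg
    rw [mem_vecStab, map_smul, (mem_vecStab R).mp hg]

lemma orbitAvg_of_fixed {v : V} (hv : ∀ g, R g v = v) : orbitAvg R v = v := by
  rw [orbitAvg_eq_of_le R ⊤ fun g _ => hv g]
  let : Fintype (G ⧸ (⊤ : Subgroup G)) := Subgroup.fintypeQuotientOfFiniteIndex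
  rw [finsum_eq_sum_of_fintype]
  simp only [hv, Subgroup.index_top, Finset.sum_const]
  rw [Finset.card_univ, ← Nat.card_eq_fintype_card]
  change _ • (⊤ : Subgroup G).index • v = v
  simp

lemma apply_orbitAvg {v : V} (hv : HasFiniteOrbit R v) (g : G) :
    R g (orbitAvg R v) = orbitAvg R v := by
  have : (vecStab R v).FiniteIndex := hv
  let : Fintype (G ⧸ vecStab R v) := Subgroup.fintypeQuotientOfFiniteIndex
  rw [orbitAvg, map_smul, finsum_eq_sum_of_fintype, map_sum]
  congr 1
  refine Fintype.sum_equiv (MulAction.toPerm g) _ _ fun q => ?_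
  induction q using QuotientGroup.induction_on with
  | H a =>
    rw [apply_out_eq R le_rfl, MulAction.toPerm_apply, ← Module.End.mul_apply, ← map_mul]
    exact (apply_out_eq R le_rfl (g * a)).symm

lemma HasFiniteOrbit.apply {v : V} (hv : HasFiniteOrbit R v) (g : G) :
    HasFiniteOrbit R (R g v) := by
  have : (vecStab R v).FiniteIndex := hv
  -- The normal core has finite index and is stable under conjugation by g, so it fixes R g v as
  -- well as v.
  refine HasFiniteOrbit.of_le R (K := (vecStab R v).normalCore) fun a ha => ?_
  have h1 : g⁻¹ * a * g⁻¹⁻¹ ∈ (vecStab R v).normalCore :=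
    Subgroup.Normal.conj_mem inferInstance a ha g⁻¹
  have h2 := (mem_vecStab R).mp (Subgroup.normalCore_le _ h1)
  rw [mem_vecStab, ← Module.End.mul_apply, ← map_mul]
  conv_rhs => rw [← h2]
  rw [← Module.End.mul_apply, ← map_mul]
  group

/-- Over a normal subgroup K fixing both vectors, right multiplication by g permutes the group G/K
and turns one sum into the other. -/
lemma orbitAvg_apply {v : V} (hv : HasFiniteOrbit R v) (g : G) :
    orbitAvg R (R g v) = orbitAvg R v := by
  have : (vecStab R v).FiniteIndex := hv
  have : (vecStab R (R g v)).FiniteIndex := hv.apply R g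
  set K := (vecStab R v ⊓ vecStab R (R g v)).normalCore
  have hK1 : K ≤ vecStab R v := (Subgroup.normalCore_le _).trans inf_le_left
  have hK2 : K ≤ vecStab R (R g v) := (Subgroup.normalCore_le _).trans inf_le_right
  let : Fintype (G ⧸ K) := Subgroup.fintypeQuotientOfFiniteIndex
  rw [orbitAvg_eq_of_le R K hK1, orbitAvg_eq_of_le R K hK2]
  congr 1
  simp only [finsum_eq_sum_of_fintype]
  refine Fintype.sum_equiv (Equiv.mulRight (g : G ⧸ K)) _ _ fun q => ?_
  induction q using QuotientGroup.induction_on with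
  | H a =>
    rw [apply_out_eq R hK2, ← Module.End.mul_apply, ← map_mul]
    exact (apply_out_eq R hK1 (a * g)).symm

lemma orbitAvg_sum {ι : Type*} (s : Finset ι) {v : ι → V}
    (hv : ∀ i ∈ s, HasFiniteOrbit R (v i)) :
    orbitAvg R (∑ i ∈ s, v i) = ∑ i ∈ s, orbitAvg R (v i) := by
  classical
  induction s using Finset.induction_on with
  | empty => simpa using orbitAvg_of_fixed R (v := 0) fun g => by simp
  | insert a s ha ih =>
    rw [Finset.sum_insert ha, Finset.sum_insert ha,
      orbitAvg_add R (hv a (Finset.mem_insert_self _ _))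
        (HasFiniteOrbit.sum R s fun i hi => hv i (Finset.mem_insert_of_mem hi)),
      ih fun i hi => hv i (Finset.mem_insert_of_mem hi)]

/-- L maps the average of v to an average of vectors R g' (L v), each of which has the same average
as L v. Here L will be the slash by a power of the element of Λ₊, and g' the conjugate of g by it.
-/
lemma orbitAvg_comp_orbitAvg (L : V →ₗ[ℂ] V) (hL : ∀ g, ∃ g', ∀ v, L (R g v) = R g' (L v))
    {v : V} (hv : HasFiniteOrbit R v) (hLv : HasFiniteOrbit R (L v)) :
    orbitAvg R (L (orbitAvg R v)) = orbitAvg R (L v) := by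
  have : (vecStab R v).FiniteIndex := hv
  let : Fintype (G ⧸ vecStab R v) := Subgroup.fintypeQuotientOfFiniteIndex
  choose φ hφ using hL
  have h1 : L (orbitAvg R v) = ((vecStab R v).index : ℂ)⁻¹ •
      ∑ q : G ⧸ vecStab R v, R (φ q.out) (L v) := by
    rw [orbitAvg, map_smul, finsum_eq_sum_of_fintype, map_sum]
    simp only [hφ]
  rw [h1, orbitAvg_smul R _ (HasFiniteOrbit.sum R _ fun q _ => hLv.apply R _),
    orbitAvg_sum R _ fun q _ => hLv.apply R _]
  simp only [orbitAvg_apply R hLv, Finset.sum_const]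
  rw [Finset.card_univ, ← Nat.card_eq_fintype_card, ← Nat.cast_smul_eq_nsmul ℂ, smul_smul]
  change (((vecStab R v).index : ℂ)⁻¹ * ((vecStab R v).index : ℂ)) • _ = _
  rw [inv_mul_cancel₀, one_smul]
  exact_mod_cast Subgroup.FiniteIndex.index_ne_zero

end Average

/-! ### Integral unitary matrices -/

/-- `4 × 4` matrices over the Gaussian integers. -/
abbrev IntMat := Matrix (Fin 2 ⊕ Fin 2) (Fin 2 ⊕ Fin 2) GaussianInt

/-- The signs of the two blocks in `J`. -/
def blockSign : Fin 2 ⊕ Fin 2 → GaussianInt := Sum.elim (fun _ => 1) (fun _ => -1)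

/-- For unitary M the matrix -J Mᴴ J is the inverse, so inverses are read off entrywise by
conjugating, swapping the two blocks and inserting signs. -/
lemma J_conj_apply (M : IntMat) (a b : Fin 2 ⊕ Fin 2) :
    (-(Matrix.J (Fin 2) GaussianInt * Mᴴ * Matrix.J (Fin 2) GaussianInt)) a b
      = blockSign a * blockSign b * star (M b.swap a.swap) := by
  rcases a with a | a <;> rcases b with b | b <;> fin_cases a <;> fin_cases b <;>
    simp [Matrix.J, Matrix.mul_apply, blockSign, Matrix.fromBlocks, Matrix.one_apply]

lemma neg_J_mul_J_mul {M : IntMat}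
    (h : Mᴴ * Matrix.J (Fin 2) GaussianInt * M = Matrix.J (Fin 2) GaussianInt) :
    -(Matrix.J (Fin 2) GaussianInt * Mᴴ * Matrix.J (Fin 2) GaussianInt) * M = 1 := by
  rw [Matrix.neg_mul]
  calc _ = -(Matrix.J (Fin 2) GaussianInt * (Mᴴ * Matrix.J (Fin 2) GaussianInt * M)) := by
        simp only [Matrix.mul_assoc]
    _ = 1 := by rw [h, Matrix.J_squared, neg_neg]

/-- An integral matrix preserving `J`, as an element of `GL₄(ℤ[i])`. -/
def unitaryUnit (M : IntMat)
    (h : Mᴴ * Matrix.J (Fin 2) GaussianInt * M = Matrix.J (Fin 2) GaussianInt) :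
    GL (Fin 2 ⊕ Fin 2) GaussianInt where
  val := M
  inv := -(Matrix.J (Fin 2) GaussianInt * Mᴴ * Matrix.J (Fin 2) GaussianInt)
  val_inv := mul_eq_one_comm.mp (neg_J_mul_J_mul h)
  inv_val := neg_J_mul_J_mul h

lemma mem_unitaryGroupInt {γ : GL (Fin 2 ⊕ Fin 2) GaussianInt} :
    γ ∈ unitaryGroupInt ↔
      γ.valᴴ * Matrix.J (Fin 2) GaussianInt * γ.val = Matrix.J (Fin 2) GaussianInt := Iff.rfl

lemma inv_val_eq {γ : GL (Fin 2 ⊕ Fin 2) GaussianInt} (h : γ ∈ unitaryGroupInt) :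
    (γ⁻¹).val = -(Matrix.J (Fin 2) GaussianInt * γ.valᴴ * Matrix.J (Fin 2) GaussianInt) := by
  have h1 := neg_J_mul_J_mul h
  have h2 : γ.val * (γ⁻¹).val = 1 := by rw [← Units.val_mul]; simp
  calc (γ⁻¹).val = (-(Matrix.J (Fin 2) GaussianInt * γ.valᴴ * Matrix.J (Fin 2) GaussianInt)
        * γ.val) * (γ⁻¹).val := by rw [h1, one_mul]
    _ = _ := by rw [Matrix.mul_assoc, h2, Matrix.mul_one]

lemma inv_apply {γ : GL (Fin 2 ⊕ Fin 2) GaussianInt} (h : γ ∈ unitaryGroupInt)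
    (a b : Fin 2 ⊕ Fin 2) :
    (γ⁻¹).val a b = blockSign a * blockSign b * star (γ.val b.swap a.swap) := by
  rw [inv_val_eq h, J_conj_apply]

lemma blockSign_ne_zero (a : Fin 2 ⊕ Fin 2) : blockSign a ≠ 0 := by
  rcases a with a | a <;> simp [blockSign]

/-! ### The integral parabolic group and its Heisenberg and Levi elements -/

/-- The integral parabolic group acting on the Fourier-Jacobi coefficients. -/
abbrev ParInt := ↥parabolicGroupInt

/-- The matrix of an element of the integral parabolic group. -/
def ParInt.mat (γ : ParInt) : IntMat := γ.1.val

lemma ParInt.mat_mul (γ δ : ParInt) : (γ * δ).mat = γ.mat * δ.mat := rfl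

lemma ParInt.mat_one : (1 : ParInt).mat = 1 := rfl

lemma ParInt.mat_injective : Function.Injective ParInt.mat := fun _ _ h =>
  Subtype.ext (Units.ext h)

lemma ParInt.mat_mul_inv (γ : ParInt) : γ.mat * (γ⁻¹).mat = 1 := by
  rw [← ParInt.mat_mul, mul_inv_cancel, ParInt.mat_one]

lemma ParInt.mat_inv_mul (γ : ParInt) : (γ⁻¹).mat * γ.mat = 1 := by
  rw [← ParInt.mat_mul, inv_mul_cancel, ParInt.mat_one]

lemma ParInt.unitary (γ : ParInt) :
    γ.matᴴ * Matrix.J (Fin 2) GaussianInt * γ.mat = Matrix.J (Fin 2) GaussianInt := γ.2.1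

lemma ParInt.last_row (γ : ParInt) {j : Fin 2 ⊕ Fin 2} (hj : j ≠ Sum.inr 1) :
    γ.mat (Sum.inr 1) j = 0 := γ.2.2 j hj

/-- The inverse has last row (0, 0, 0, *) too, and up to sign its last row consists of the
conjugates of the second column of γ. -/
lemma ParInt.second_col (γ : ParInt) {i : Fin 2 ⊕ Fin 2} (hi : i ≠ Sum.inl 1) :
    γ.mat i (Sum.inl 1) = 0 := by
  have h1 := (γ⁻¹).last_row (j := i.swap) (fun h => hi (by
    have := congrArg Sum.swap h
    simpa using this))
  have h2 := inv_apply γ.2.1 (Sum.inr 1) i.swap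
  have h3 : (γ⁻¹).mat (Sum.inr 1) i.swap = (γ.1⁻¹).val (Sum.inr 1) i.swap := rfl
  rw [← h3, h1, Sum.swap_swap] at h2
  have h4 := (mul_eq_zero.mp h2.symm).resolve_left
    (mul_ne_zero (blockSign_ne_zero _) (blockSign_ne_zero _))
  exact star_eq_zero.mp h4

/-- An integral matrix preserving `J` with last row `(0, 0, 0, *)`, as an element of the integral
parabolic group. -/
def ParInt.mk (M : IntMat)
    (h : Mᴴ * Matrix.J (Fin 2) GaussianInt * M = Matrix.J (Fin 2) GaussianInt)
    (h' : ∀ j, j ≠ Sum.inr 1 → M (Sum.inr 1) j = 0) : ParInt :=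
  ⟨unitaryUnit M h, h, h'⟩

lemma ParInt.mat_mk (M : IntMat) (h h') : (ParInt.mk M h h').mat = M := rfl

/-- The Heisenberg element with second row `(l, 1, μ, conj μ * l + r)`. -/
def heisenbergMat (l μ : GaussianInt) (r : ℤ) : IntMat :=
  Matrix.fromBlocks !![1, 0; l, 1] !![0, star μ; μ, star μ * l + r] 0 !![1, -star l; 0, 1]

/-- The Heisenberg element with second row `(l, 1, μ, conj μ * l + r)`. -/
def heisenberg (l μ : GaussianInt) (r : ℤ) : ParInt :=
  ParInt.mk (heisenbergMat l μ r)
    (by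
      refine Matrix.ext fun i j => ?_
      rcases i with i | i <;> rcases j with j | j <;> fin_cases i <;> fin_cases j <;>
        simp [heisenbergMat, Matrix.J, Matrix.mul_apply, Matrix.fromBlocks, Matrix.one_apply]; ring)
    (by
      intro j hj
      rcases j with j | j <;> fin_cases j <;> simp_all [heisenbergMat])

/-- The Levi element `(a, b; c, d)` of the coordinates one and three. -/
def leviMat (a b c d : ℤ) : IntMat :=
  Matrix.fromBlocks !![(a : GaussianInt), 0; 0, 1] !![(b : GaussianInt), 0; 0, 0]
    !![(c : GaussianInt), 0; 0, 0] !![(d : GaussianInt), 0; 0, 1]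

/-- The Levi element `(a, b; c, d)` of the coordinates one and three. -/
def levi (a b c d : ℤ) (h : a * d - b * c = 1) : ParInt :=
  ParInt.mk (leviMat a b c d)
    (by
      have h' : (a : GaussianInt) * d - b * c = 1 := by exact_mod_cast h
      refine Matrix.ext fun i j => ?_
      rcases i with i | i <;> rcases j with j | j <;> fin_cases i <;> fin_cases j <;>
        simp [leviMat, Matrix.J, Matrix.mul_apply, Matrix.fromBlocks, Matrix.one_apply] <;>
        first | ring1 | linear_combination h' | linear_combination -h')
    (by
      intro j hj
      rcases j with j | j <;> fin_cases j <;> simp_all [leviMat])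

/-! ### Reduction modulo a split prime -/

/-- The reduction modulo a Gaussian prime `ϖ` of prime norm `p` that is coprime to its
conjugate. -/
structure SplitPrime (p : ℕ) (ϖ : GaussianInt) where
  /-- The reduction map `ℤ[i] → ℤ[i] / ϖ = ℤ / p`. -/
  red : GaussianInt →+* ZMod p
  red_eq_zero : ∀ z, red z = 0 ↔ ϖ ∣ z
  mul_star : ϖ * star ϖ = p
  coprime : IsCoprime ϖ (star ϖ)

/-- The sum of ϖ and its conjugate is 2 Re ϖ and their product is p, so a Bézout relation between 2
Re ϖ and p in ℤ gives one between ϖ and its conjugate. If p divided Re ϖ it would divide Im ϖ, hence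
p² would divide p; oddness of p excludes the factor 2. -/
lemma coprime_star {p : ℕ} (hp : p.Prime) (hp2 : p ≠ 2) {ϖ : GaussianInt}
    (hϖ : ϖ * star ϖ = p) : IsCoprime ϖ (star ϖ) := by
  have hre : ϖ.re * ϖ.re + ϖ.im * ϖ.im = p := by
    have := congrArg Zsqrtd.re hϖ
    simpa using this
  have hpp : Prime (p : ℤ) := Nat.prime_iff_prime_int.mp hp
  have hnd : ¬ (p : ℤ) ∣ 2 * ϖ.re := by
    intro h
    rcases hpp.dvd_or_dvd h with h | h
    · have := Int.le_of_dvd (by norm_num) h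
      have h2 := hp.two_le
      omega
    · obtain ⟨c, hc⟩ := h
      have h0 : 0 < (p : ℤ) := by exact_mod_cast hp.pos
      have h2 : (p : ℤ) ∣ ϖ.im * ϖ.im := by
        refine ⟨1 - c * ϖ.re, ?_⟩
        linear_combination hre - ϖ.re * hc
      obtain ⟨d, hd⟩ := (hpp.dvd_or_dvd h2).elim id id
      rw [hc, hd] at hre
      have h3 : (p : ℤ) * (c * c + d * d) = 1 := by
        have : (p : ℤ) * ((p : ℤ) * (c * c + d * d)) = p * 1 := by linear_combination hre
        exact mul_left_cancel₀ h0.ne' this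
      have h4 : (p : ℤ) ∣ 1 := ⟨_, h3.symm⟩
      exact hpp.not_isUnit (isUnit_of_dvd_one h4)
  obtain ⟨u, v, huv⟩ := ((Prime.coprime_iff_not_dvd hpp).mpr hnd).symm
  have h1 : ((2 * ϖ.re : ℤ) : GaussianInt) = ϖ + star ϖ := by
    ext <;> simp
    ring
  have h2 : (u : GaussianInt) * (ϖ + star ϖ) + v * (ϖ * star ϖ) = 1 := by
    rw [← h1, hϖ]
    exact_mod_cast huv
  exact ⟨u + v * star ϖ, u, by linear_combination h2⟩

lemma exists_splitPrime {p : ℕ} (hp : p.Prime) (hp2 : p ≠ 2) {ϖ : GaussianInt}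
    (hϖ : ϖ * star ϖ = p) : Nonempty (SplitPrime p ϖ) := by
  have : Fact p.Prime := ⟨hp⟩
  have hre : ϖ.re * ϖ.re + ϖ.im * ϖ.im = p := by
    have := congrArg Zsqrtd.re hϖ
    simpa using this
  have hrek : (ϖ.re : ZMod p) * ϖ.re + ϖ.im * ϖ.im = 0 := by
    have := congrArg (Int.cast : ℤ → ZMod p) hre
    push_cast at this
    simpa using this
  have hpp : Prime (p : ℤ) := Nat.prime_iff_prime_int.mp hp
  have him : (ϖ.im : ZMod p) ≠ 0 := by
    intro h0
    have h1 : (ϖ.re : ZMod p) = 0 := by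
      rw [h0, mul_zero, add_zero] at hrek
      exact mul_self_eq_zero.mp hrek
    rw [ZMod.intCast_zmod_eq_zero_iff_dvd] at h0 h1
    obtain ⟨c, hc⟩ := h1
    obtain ⟨d, hd⟩ := h0
    rw [hc, hd] at hre
    have h3 : (p : ℤ) * (c * c + d * d) = 1 := by
      have : (p : ℤ) * ((p : ℤ) * (c * c + d * d)) = p * 1 := by linear_combination hre
      exact mul_left_cancel₀ hpp.ne_zero this
    exact hpp.not_isUnit (isUnit_of_dvd_one ⟨_, h3.symm⟩)
  -- The norm equation modulo p makes -Re ϖ / Im ϖ a square root of -1; sending i to this root kills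
  -- ϖ.
  have hr : (-(ϖ.re : ZMod p) / ϖ.im) * (-(ϖ.re : ZMod p) / ϖ.im) = ((-1 : ℤ) : ZMod p) := by
    field_simp
    push_cast
    linear_combination hrek
  let f : GaussianInt →+* ZMod p := Zsqrtd.lift ⟨_, hr⟩
  have hf : ∀ z : GaussianInt, f z = z.re + z.im * (-(ϖ.re : ZMod p) / ϖ.im) := fun z => rfl
  refine ⟨⟨f, fun z => ⟨fun hz => ?_, ?_⟩, hϖ, coprime_star hp hp2 hϖ⟩⟩
  · rw [hf] at hz
    have h1 : (z.re : ZMod p) * ϖ.im = z.im * ϖ.re := by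
      field_simp at hz
      linear_combination hz
    have h2 : (z.re : ZMod p) * ϖ.re + z.im * ϖ.im = 0 := by
      have : (ϖ.im : ZMod p) * ((z.re : ZMod p) * ϖ.re + z.im * ϖ.im) = 0 := by
        linear_combination ϖ.re * h1 + z.im * hrek
      exact (mul_eq_zero.mp this).resolve_left him
    have h3 : (p : ℤ) ∣ z.re * ϖ.re + z.im * ϖ.im := by
      rw [← ZMod.intCast_zmod_eq_zero_iff_dvd]
      push_cast
      exact h2
    have h4 : (p : ℤ) ∣ z.im * ϖ.re - z.re * ϖ.im := by
      rw [← ZMod.intCast_zmod_eq_zero_iff_dvd]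
      push_cast
      rw [h1, sub_self]
    obtain ⟨c, hc⟩ := h3
    obtain ⟨d, hd⟩ := h4
    -- The two divisibilities say that p divides both coordinates of z times the conjugate of ϖ;
    -- cancelling that conjugate leaves ϖ ∣ z.
    have h5 : z * star ϖ = (ϖ * ⟨c, d⟩) * star ϖ := by
      rw [mul_right_comm, hϖ]
      ext
      · simp
        linear_combination hc
      · simp
        linear_combination hd
    have h6 : star ϖ ≠ 0 := by
      intro h
      rw [h, mul_zero] at hϖ
      exact hp.ne_zero (by exact_mod_cast hϖ.symm)
    exact ⟨_, mul_right_cancel₀ h6 h5⟩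
  · rintro ⟨w, rfl⟩
    have : f ϖ = 0 := by
      rw [hf]
      field_simp
      ring
    rw [map_mul, this, zero_mul]

namespace SplitPrime

variable {p : ℕ} [Fact p.Prime] {ϖ : GaussianInt} (D : SplitPrime p ϖ)
include D

lemma red_self : D.red ϖ = 0 := (D.red_eq_zero _).mpr dvd_rfl

lemma red_natCast : D.red p = 0 := by rw [← D.mul_star, map_mul, D.red_self, zero_mul]

lemma red_star : D.red (star ϖ) ≠ 0 := by
  obtain ⟨u, v, h⟩ := D.coprime
  intro h0
  have := congrArg D.red h
  rw [map_add, map_mul, map_mul, D.red_self, h0, mul_zero, mul_zero, add_zero, map_one] at this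
  exact zero_ne_one this

/-- Reducing the conjugate of z modulo ϖ amounts to reducing z modulo the conjugate prime, so this
is the Chinese remainder theorem for two coprime primes. It makes an entry and its conjugate
independent modulo ϖ. -/
lemma exists_red_eq (a b : ZMod p) : ∃ z, D.red z = a ∧ D.red (star z) = b := by
  obtain ⟨u, v, h⟩ := D.coprime
  have h1 : D.red v * D.red (star ϖ) = 1 := by
    have := congrArg D.red h
    rwa [map_add, map_mul, map_mul, D.red_self, mul_zero, zero_add, map_one] at this
  obtain ⟨m, rfl⟩ : ∃ m : ℕ, (m : ZMod p) = a := ⟨a.val, by simp⟩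
  obtain ⟨n, rfl⟩ : ∃ n : ℕ, (n : ZMod p) = b := ⟨b.val, by simp⟩
  refine ⟨m * v * star ϖ + n * star v * ϖ, ?_, ?_⟩
  · simp only [map_add, map_mul, D.red_self, map_natCast]
    linear_combination (m : ZMod p) * h1
  · simp only [star_add, star_mul, star_star, star_natCast, map_add, map_mul, D.red_self,
      map_natCast]
    linear_combination (n : ZMod p) * h1

lemma dvd_of_red {z : GaussianInt} (h1 : D.red z = 0) (h2 : D.red (star z) = 0) :
    (p : GaussianInt) ∣ z := by
  rw [D.red_eq_zero] at h1 h2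
  have h3 : star ϖ ∣ z := by
    obtain ⟨w, hw⟩ := h2
    exact ⟨star w, by rw [← star_star z, hw, star_mul, mul_comm]⟩
  rw [← D.mul_star]
  exact D.coprime.mul_dvd h1 h3

omit D in
lemma natCast_ne_zero : (p : GaussianInt) ≠ 0 := by
  exact_mod_cast (Fact.out : p.Prime).ne_zero

end SplitPrime

/-! ### Stabilizers of cosets in the parabolic group -/

/-- The stabilizer of the coset `Γ₂ x` in the integral parabolic group. -/
def cosetStab (x : IntMat) : Subgroup ParInt where
  carrier := {δ | ∃ γ ∈ unitaryGroupInt, x * δ.mat = γ.val * x}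
  one_mem' := ⟨1, one_mem _, by simp [ParInt.mat_one]⟩
  mul_mem' := by
    rintro a b ⟨γ, hγ, ha⟩ ⟨γ', hγ', hb⟩
    refine ⟨γ * γ', mul_mem hγ hγ', ?_⟩
    rw [ParInt.mat_mul, ← Matrix.mul_assoc, ha, Matrix.mul_assoc, hb, Units.val_mul,
      Matrix.mul_assoc]
  inv_mem' := by
    rintro a ⟨γ, hγ, ha⟩
    refine ⟨γ⁻¹, inv_mem hγ, ?_⟩
    have h1 : (γ⁻¹).val * γ.val = 1 := by rw [← Units.val_mul]; simp
    calc x * (a⁻¹).mat = ((γ⁻¹).val * γ.val) * x * (a⁻¹).mat := by rw [h1, one_mul]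
      _ = (γ⁻¹).val * (x * a.mat) * (a⁻¹).mat := by rw [ha]; simp only [Matrix.mul_assoc]
      _ = _ := by
        rw [Matrix.mul_assoc, Matrix.mul_assoc, ParInt.mat_mul_inv, Matrix.mul_one]

lemma mem_cosetStab {x : IntMat} {δ : ParInt} :
    δ ∈ cosetStab x ↔ ∃ γ ∈ unitaryGroupInt, x * δ.mat = γ.val * x := Iff.rfl

lemma conjTranspose_diagonal_mul_J_mul {n : GaussianInt} {x : Fin 2 ⊕ Fin 2 → GaussianInt}
    (hx : ∀ i, star (x i) * x i.swap = n) :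
    (Matrix.diagonal x)ᴴ * Matrix.J (Fin 2) GaussianInt * Matrix.diagonal x
      = n • Matrix.J (Fin 2) GaussianInt := by
  refine Matrix.ext fun i j => ?_
  rcases i with i | i <;> rcases j with j | j <;>
    simp [Matrix.diagonal_conjTranspose, Matrix.J, Matrix.diagonal_mul, Matrix.mul_diagonal,
      Matrix.fromBlocks, Matrix.one_apply] <;> split_ifs with hij <;> try rfl
  · subst hij
    simpa using hx (Sum.inl i)
  · subst hij
    simpa using hx (Sum.inr i)

lemma mem_unitaryGroupInt_of_diagonal_mul {p : ℕ} (hp : (p : GaussianInt) ≠ 0)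
    {x : Fin 2 ⊕ Fin 2 → GaussianInt} (hx : ∀ i, star (x i) * x i.swap = p)
    {τ : GL (Fin 2 ⊕ Fin 2) GaussianInt} (hτ : τ ∈ unitaryGroupInt) {M : IntMat}
    (hM : Matrix.diagonal x * τ.val = M * Matrix.diagonal x) :
    Mᴴ * Matrix.J (Fin 2) GaussianInt * M = Matrix.J (Fin 2) GaussianInt := by
  have hJ := conjTranspose_diagonal_mul_J_mul hx
  have h1 : (Matrix.diagonal x)ᴴ * (Mᴴ * Matrix.J (Fin 2) GaussianInt * M) * Matrix.diagonal x
      = (p : GaussianInt) • Matrix.J (Fin 2) GaussianInt := by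
    calc _ = (M * Matrix.diagonal x)ᴴ * Matrix.J (Fin 2) GaussianInt * (M * Matrix.diagonal x) := by
          simp only [Matrix.conjTranspose_mul, Matrix.mul_assoc]
      _ = τ.valᴴ * ((Matrix.diagonal x)ᴴ * Matrix.J (Fin 2) GaussianInt * Matrix.diagonal x)
          * τ.val := by
          rw [← hM]; simp only [Matrix.conjTranspose_mul, Matrix.mul_assoc]
      _ = _ := by
          rw [hJ, Matrix.mul_smul, Matrix.smul_mul, mem_unitaryGroupInt.mp hτ]
  have hx0 : ∀ i, x i ≠ 0 := by
    intro i h0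
    have := hx i
    rw [h0, star_zero, zero_mul] at this
    exact hp this.symm
  rw [← hJ] at h1
  refine Matrix.ext fun i j => ?_
  have h2 := congrFun (congrFun h1 i) j
  rw [Matrix.mul_diagonal, Matrix.mul_diagonal, Matrix.diagonal_conjTranspose,
    Matrix.diagonal_mul, Matrix.diagonal_mul] at h2
  exact mul_left_cancel₀ (star_ne_zero.mpr (hx0 i)) (mul_right_cancel₀ (hx0 j) h2)

namespace SplitPrime

variable {p : ℕ} [Fact p.Prime] {ϖ : GaussianInt} (D : SplitPrime p ϖ)
include D

/-- Sorting the indices by whether x vanishes modulo ϖ makes the reduction of τ block triangular,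
and the inverse of a block triangular matrix is block triangular. -/
lemma inv_red_eq_zero {x : Fin 2 ⊕ Fin 2 → GaussianInt} {τ : GL (Fin 2 ⊕ Fin 2) GaussianInt}
    (h : ∀ i j, D.red (x i) ≠ 0 → D.red (x j) = 0 → D.red (τ.val i j) = 0)
    (i j : Fin 2 ⊕ Fin 2) (hi : D.red (x i) ≠ 0) (hj : D.red (x j) = 0) :
    D.red ((τ⁻¹).val i j) = 0 := by
  classical
  have h1 : τ.val.map D.red * (τ⁻¹).val.map D.red = 1 := by
    rw [← Matrix.map_mul, ← Units.val_mul]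
    simp
  let b : Fin 2 ⊕ Fin 2 → ℕ := fun i => if D.red (x i) = 0 then 0 else 1
  have hb : (τ.val.map D.red).BlockTriangular b := by
    intro i j hij
    simp only [b] at hij
    by_cases hj : D.red (x j) = 0
    · by_cases hi : D.red (x i) = 0
      · simp [hi, hj] at hij
      · exact h _ _ hi hj
    · by_cases hi : D.red (x i) = 0 <;> simp [hi, hj] at hij
  let _ : Invertible (τ.val.map D.red) := invertibleOfRightInverse _ _ h1
  have h2 := Matrix.blockTriangular_inv_of_blockTriangular hb
  rw [Matrix.inv_eq_right_inv h1] at h2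
  refine h2 (i := i) (j := j) ?_
  simp [b, hi, hj]

/-- The claim is that x τ x⁻¹ is integral. Its (i, j) entry is x i * τ i j * star (x j.swap) divided
by p, and divisibility by p is tested on the numerator and on its conjugate modulo ϖ. The numerator
is handled by the hypothesis on τ; the conjugate involves an entry of τ⁻¹, handled by
`inv_red_eq_zero`. -/
lemma exists_diagonal_mul_eq {x : Fin 2 ⊕ Fin 2 → GaussianInt}
    (hx : ∀ i, star (x i) * x i.swap = p)
    {τ : GL (Fin 2 ⊕ Fin 2) GaussianInt} (hτ : τ ∈ unitaryGroupInt)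
    (h : ∀ i j, D.red (x i) ≠ 0 → D.red (x j) = 0 → D.red (τ.val i j) = 0) :
    ∃ γ ∈ unitaryGroupInt, Matrix.diagonal x * τ.val = γ.val * Matrix.diagonal x := by
  have hinv := D.inv_red_eq_zero h
  have hdvd : ∀ i j, (p : GaussianInt) ∣ x i * τ.val i j * star (x j.swap) := by
    intro i j
    have hxs : ∀ i, D.red (star (x i)) * D.red (x i.swap) = 0 := fun i => by
      rw [← map_mul, hx, D.red_natCast]
    refine D.dvd_of_red ?_ ?_
    · rw [map_mul, map_mul]
      by_cases hi : D.red (x i) = 0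
      · rw [hi, zero_mul, zero_mul]
      by_cases hj : D.red (x j) = 0
      · rw [h i j hi hj, mul_zero, zero_mul]
      have := hxs j.swap
      rw [Sum.swap_swap] at this
      rw [(mul_eq_zero.mp this).resolve_right hj, mul_zero]
    · rw [star_mul, star_mul, star_star, map_mul, map_mul]
      by_cases hj : D.red (x j.swap) = 0
      · rw [hj, zero_mul]
      by_cases hi : D.red (x i.swap) = 0
      · have h1 := hinv j.swap i.swap hj hi
        rw [inv_apply hτ, map_mul, Sum.swap_swap, Sum.swap_swap] at h1
        have h2 : D.red (blockSign j.swap * blockSign i.swap) ≠ 0 := by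
          rcases i with i | i <;> rcases j with j | j <;> simp [blockSign]
        rw [(mul_eq_zero.mp h1).resolve_left h2, zero_mul, mul_zero]
      · rw [(mul_eq_zero.mp (hxs i)).resolve_right hi, mul_zero, mul_zero]
  choose M hM using hdvd
  have hp0 : (p : GaussianInt) ≠ 0 := SplitPrime.natCast_ne_zero
  have hM' : Matrix.diagonal x * τ.val = Matrix.of M * Matrix.diagonal x := by
    refine Matrix.ext fun i j => ?_
    rw [Matrix.diagonal_mul, Matrix.mul_diagonal, Matrix.of_apply]
    refine mul_left_cancel₀ hp0 ?_
    have h1 := hx j.swap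
    rw [Sum.swap_swap] at h1
    linear_combination x j * hM i j - x i * τ.val i j * h1
  have hu := mem_unitaryGroupInt_of_diagonal_mul hp0 hx hτ hM'
  exact ⟨unitaryUnit _ hu, hu, hM'⟩

/-- The right-hand condition says that δ modulo ϖ preserves the span of the e_j with x j ≡ 0, that
is, the kernel of the diagonal matrix modulo ϖ. Stabilizers of cosets are thus stabilizers of
subspaces of 𝔽_p⁴. -/
lemma mem_cosetStab_iff {x : Fin 2 ⊕ Fin 2 → GaussianInt}
    (hx : ∀ i, star (x i) * x i.swap = p) (δ : ParInt) :
    δ ∈ cosetStab (Matrix.diagonal x) ↔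
      ∀ i j, D.red (x i) ≠ 0 → D.red (x j) = 0 → D.red (δ.mat i j) = 0 := by
  constructor
  · rintro ⟨γ, -, h⟩ i j hi hj
    have := congrFun (congrFun h i) j
    rw [Matrix.diagonal_mul, Matrix.mul_diagonal] at this
    have h2 := congrArg D.red this
    rw [map_mul, map_mul, hj, mul_zero] at h2
    exact (mul_eq_zero.mp h2).resolve_left hi
  · intro h
    exact D.exists_diagonal_mul_eq hx δ.2.1 h

end SplitPrime

/-! ### Parabolic elements modulo ϖ and explicit stabilizers -/

/-- Diagonal integral matrices. -/
def diagInt (a b c d : GaussianInt) : IntMat := Matrix.diagonal (Sum.elim ![a, b] ![c, d])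

/-- The function φ labels the left cosets of K' in K; in the applications the label is the image
under a of the subspace fixed by K', in affine or projective coordinates. -/
lemma relIndex_eq_card {G S : Type*} [Group G] {K' K : Subgroup G} (φ : G → S)
    (hs : ∀ s, ∃ a ∈ K, φ a = s) (h : ∀ a ∈ K, ∀ c ∈ K, φ (a * c) = φ a ↔ c ∈ K') :
    K'.relIndex K = Nat.card S := by
  have hrel : ∀ a b : K, (a⁻¹ * b ∈ K'.subgroupOf K) ↔ φ a = φ b := by
    intro a b
    have := h a a.2 ((a : G)⁻¹ * b) (mul_mem (inv_mem a.2) b.2)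
    rw [mul_inv_cancel_left] at this
    rw [Subgroup.mem_subgroupOf, eq_comm, this]
    rfl
  let f : K ⧸ K'.subgroupOf K → S := Quotient.lift (fun a : K => φ a) fun a b hab => by
    rw [← hrel]
    exact QuotientGroup.leftRel_apply.mp hab
  refine Nat.card_congr (Equiv.ofBijective f ⟨?_, ?_⟩)
  · intro q r
    induction q using QuotientGroup.induction_on with
    | H a =>
      induction r using QuotientGroup.induction_on with
      | H b =>
        intro hab
        exact QuotientGroup.eq.mpr ((hrel a b).mpr hab)
  · intro s
    obtain ⟨a, ha, rfl⟩ := hs s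
    exact ⟨((⟨a, ha⟩ : K) : K ⧸ _), rfl⟩

namespace SplitPrime

variable {p : ℕ} [Fact p.Prime] {ϖ : GaussianInt} (D : SplitPrime p ϖ)

/-- The reduced entries of an element of the parabolic group. -/
def ent (δ : ParInt) (i j : Fin 2 ⊕ Fin 2) : ZMod p := D.red (δ.mat i j)

lemma ent_mul (a b : ParInt) (i j : Fin 2 ⊕ Fin 2) :
    D.ent (a * b) i j = D.ent a i (Sum.inl 0) * D.ent b (Sum.inl 0) j
      + D.ent a i (Sum.inl 1) * D.ent b (Sum.inl 1) j
      + D.ent a i (Sum.inr 0) * D.ent b (Sum.inr 0) j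
      + D.ent a i (Sum.inr 1) * D.ent b (Sum.inr 1) j := by
  simp [ent, ParInt.mat_mul, Matrix.mul_apply, Fintype.sum_sum_type, Fin.sum_univ_two, add_assoc]

@[simp] lemma ent_row0 (a : ParInt) : D.ent a (Sum.inr 1) (Sum.inl 0) = 0 := by
  rw [ent, a.last_row (by simp), map_zero]

@[simp] lemma ent_row1 (a : ParInt) : D.ent a (Sum.inr 1) (Sum.inl 1) = 0 := by
  rw [ent, a.last_row (by simp), map_zero]

@[simp] lemma ent_row2 (a : ParInt) : D.ent a (Sum.inr 1) (Sum.inr 0) = 0 := by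
  rw [ent, a.last_row (by simp), map_zero]

@[simp] lemma ent_col0 (a : ParInt) : D.ent a (Sum.inl 0) (Sum.inl 1) = 0 := by
  rw [ent, a.second_col (by simp), map_zero]

@[simp] lemma ent_col2 (a : ParInt) : D.ent a (Sum.inr 0) (Sum.inl 1) = 0 := by
  rw [ent, a.second_col (by simp), map_zero]

lemma ent_one (i j : Fin 2 ⊕ Fin 2) : D.ent 1 i j = if i = j then 1 else 0 := by
  rw [ent, ParInt.mat_one, Matrix.one_apply]
  split_ifs <;> simp

lemma ent_22 (a : ParInt) : D.ent a (Sum.inl 1) (Sum.inl 1) ≠ 0 := by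
  have := D.ent_mul a⁻¹ a (Sum.inl 1) (Sum.inl 1)
  rw [inv_mul_cancel, ent_one] at this
  intro h
  simp [h] at this

lemma ent_44 (a : ParInt) : D.ent a (Sum.inr 1) (Sum.inr 1) ≠ 0 := by
  have := D.ent_mul a a⁻¹ (Sum.inr 1) (Sum.inr 1)
  rw [mul_inv_cancel, ent_one] at this
  intro h
  simp [h] at this

/-- The zeros in the last row and second column make the block on coordinates one and three
multiplicative, so its determinant is inverted by that of the inverse element. -/
lemma ent_det (a : ParInt) : D.ent a (Sum.inl 0) (Sum.inl 0) * D.ent a (Sum.inr 0) (Sum.inr 0)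
    - D.ent a (Sum.inl 0) (Sum.inr 0) * D.ent a (Sum.inr 0) (Sum.inl 0) ≠ 0 := by
  have h11 := D.ent_mul a a⁻¹ (Sum.inl 0) (Sum.inl 0)
  have h13 := D.ent_mul a a⁻¹ (Sum.inl 0) (Sum.inr 0)
  have h31 := D.ent_mul a a⁻¹ (Sum.inr 0) (Sum.inl 0)
  have h33 := D.ent_mul a a⁻¹ (Sum.inr 0) (Sum.inr 0)
  simp only [mul_inv_cancel, ent_one, ent_row0, ent_row2, ent_col0, ent_col2, if_true,
    reduceCtorEq, if_false, zero_mul, mul_zero, add_zero] at h11 h13 h31 h33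
  intro h
  refine one_ne_zero (α := ZMod p) ?_
  linear_combination h11 + (D.ent a (Sum.inl 0) (Sum.inl 0) * D.ent a⁻¹ (Sum.inl 0) (Sum.inl 0)
    + D.ent a (Sum.inl 0) (Sum.inr 0) * D.ent a⁻¹ (Sum.inr 0) (Sum.inl 0)) * h33
    - (D.ent a (Sum.inl 0) (Sum.inl 0) * D.ent a⁻¹ (Sum.inl 0) (Sum.inr 0)
    + D.ent a (Sum.inl 0) (Sum.inr 0) * D.ent a⁻¹ (Sum.inr 0) (Sum.inr 0)) * h31
    + (D.ent a⁻¹ (Sum.inl 0) (Sum.inl 0) *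
      D.ent a⁻¹ (Sum.inr 0) (Sum.inr 0) - D.ent a⁻¹ (Sum.inl 0) (Sum.inr 0) *
      D.ent a⁻¹ (Sum.inr 0) (Sum.inl 0)) * h

end SplitPrime

lemma star_mul_swap_eq {p : ℕ} {a b c d : GaussianInt} (h1 : star a * c = p) (h2 : star b * d = p)
    (i : Fin 2 ⊕ Fin 2) :
    star ((Sum.elim ![a, b] ![c, d] : Fin 2 ⊕ Fin 2 → GaussianInt) i)
      * (Sum.elim ![a, b] ![c, d] : Fin 2 ⊕ Fin 2 → GaussianInt) i.swap = p := by
  have h3 : star c * a = p := by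
    simpa [mul_comm] using congrArg star h1
  have h4 : star d * b = p := by
    simpa [mul_comm] using congrArg star h2
  rcases i with i | i <;> fin_cases i <;> simpa

namespace SplitPrime

variable {p : ℕ} [Fact p.Prime] {ϖ : GaussianInt} (D : SplitPrime p ϖ)

include D

omit [Fact p.Prime] in
lemma star_mul_self : star ϖ * ϖ = p := by rw [mul_comm, D.mul_star]

lemma mem_cosetStab_diagInt {a b c d : GaussianInt} (h1 : star a * c = p) (h2 : star b * d = p)
    (δ : ParInt) : δ ∈ cosetStab (diagInt a b c d) ↔
      ∀ i j, D.red ((Sum.elim ![a, b] ![c, d] : Fin 2 ⊕ Fin 2 → GaussianInt) i) ≠ 0 →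
        D.red ((Sum.elim ![a, b] ![c, d] : Fin 2 ⊕ Fin 2 → GaussianInt) j) = 0 →
        D.ent δ i j = 0 :=
  D.mem_cosetStab_iff (star_mul_swap_eq h1 h2) δ

lemma mem_cosetStab_lambdaMinus (δ : ParInt) :
    δ ∈ cosetStab (diagInt (star ϖ) p (star ϖ) 1) := by
  rw [D.mem_cosetStab_diagInt (by rw [star_star, D.mul_star]) (by simp)]
  simp [Sum.forall, Fin.forall_fin_two, D.red_natCast, D.red_star]

lemma mem_cosetStab_tOne (δ : ParInt) : δ ∈ cosetStab (diagInt 1 (star ϖ) p (star ϖ)) ↔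
    D.ent δ (Sum.inl 0) (Sum.inr 0) = 0 ∧ D.ent δ (Sum.inl 1) (Sum.inr 0) = 0 := by
  rw [D.mem_cosetStab_diagInt (by simp) (by rw [star_star, D.mul_star])]
  simp [Sum.forall, Fin.forall_fin_two, D.red_natCast, D.red_star]

lemma mem_cosetStab_lambdaPlus (δ : ParInt) : δ ∈ cosetStab (diagInt (star ϖ) 1 (star ϖ) p) ↔
    D.ent δ (Sum.inl 0) (Sum.inr 1) = 0 ∧ D.ent δ (Sum.inl 1) (Sum.inr 1) = 0 ∧
      D.ent δ (Sum.inr 0) (Sum.inr 1) = 0 := by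
  rw [D.mem_cosetStab_diagInt (by rw [star_star, D.mul_star]) (by simp)]
  simp [Sum.forall, Fin.forall_fin_two, D.red_natCast, D.red_star, and_assoc]

lemma mem_cosetStab_one_p_p_one (δ : ParInt) : δ ∈ cosetStab (diagInt 1 p p 1) ↔
    D.ent δ (Sum.inl 0) (Sum.inr 0) = 0 := by
  rw [D.mem_cosetStab_diagInt (by simp) (by simp)]
  simp [Sum.forall, Fin.forall_fin_two, D.red_natCast]

lemma mem_cosetStab_tTwo (δ : ParInt) : δ ∈ cosetStab (diagInt 1 1 p p) ↔
    (D.ent δ (Sum.inl 0) (Sum.inr 0) = 0 ∧ D.ent δ (Sum.inl 0) (Sum.inr 1) = 0) ∧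
      D.ent δ (Sum.inl 1) (Sum.inr 0) = 0 ∧ D.ent δ (Sum.inl 1) (Sum.inr 1) = 0 := by
  rw [D.mem_cosetStab_diagInt (by simp) (by simp)]
  simp [Sum.forall, Fin.forall_fin_two, D.red_natCast]

lemma mem_cosetStab_tMixed (δ : ParInt) : δ ∈ cosetStab (diagInt ϖ (star ϖ) ϖ (star ϖ)) ↔
    D.ent δ (Sum.inl 1) (Sum.inl 0) = 0 ∧ D.ent δ (Sum.inl 1) (Sum.inr 0) = 0 := by
  rw [D.mem_cosetStab_diagInt D.star_mul_self (by rw [star_star, D.mul_star])]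
  simp [Sum.forall, Fin.forall_fin_two, D.red_self, D.red_star]

lemma mem_cosetStab_tMixed_star (δ : ParInt) :
    δ ∈ cosetStab (diagInt (star ϖ) ϖ (star ϖ) ϖ) ↔
    D.ent δ (Sum.inl 0) (Sum.inr 1) = 0 ∧ D.ent δ (Sum.inr 0) (Sum.inr 1) = 0 := by
  rw [D.mem_cosetStab_diagInt (by rw [star_star, D.mul_star]) D.star_mul_self]
  simp [Sum.forall, Fin.forall_fin_two, D.red_self, D.red_star]

lemma exists_heisenberg (a b c α β : ZMod p) : ∃ n : ParInt, ∀ i j, D.ent n i j =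
    (Matrix.fromBlocks !![1, 0; a, 1] !![0, α; b, c] 0 !![1, β; 0, 1] :
      Matrix (Fin 2 ⊕ Fin 2) (Fin 2 ⊕ Fin 2) (ZMod p)) i j := by
  -- The matrix contains l, -star l, μ and star μ, which are independent modulo ϖ; the integer r
  -- then corrects the corner entry star μ * l + r to c.
  obtain ⟨l, hl, hl'⟩ := D.exists_red_eq a (-β)
  obtain ⟨μ, hμ, hμ'⟩ := D.exists_red_eq b α
  obtain ⟨r, hr⟩ : ∃ r : ℕ, (r : ZMod p) = c - α * a := ⟨(c - α * a).val, by simp⟩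
  refine ⟨heisenberg l μ r, fun i j => ?_⟩
  rw [ent, heisenberg, ParInt.mat_mk]
  rcases i with i | i <;> rcases j with j | j <;> fin_cases i <;> fin_cases j <;>
    simp [heisenbergMat, hl, hl', hμ, hμ', hr]

/-- Only the line through (v₁, v₃) has to be reached, which the scalar s allows: a Weyl element
serves the line v₃ = 0 and unipotent elements serve all others. -/
lemma exists_levi (v₁ v₃ : ZMod p) (h : v₁ ≠ 0 ∨ v₃ ≠ 0) : ∃ (m : ParInt) (s a c : ZMod p),
    s ≠ 0 ∧ a * (s * v₃) - s * v₁ * c = 1 ∧ ∀ i j, D.ent m i j =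
    (Matrix.fromBlocks !![a, 0; 0, 1] !![s * v₁, 0; 0, 0] !![c, 0; 0, 0] !![s * v₃, 0; 0, 1] :
      Matrix (Fin 2 ⊕ Fin 2) (Fin 2 ⊕ Fin 2) (ZMod p)) i j := by
  by_cases h3 : v₃ = 0
  · have h1 : v₁ ≠ 0 := h.resolve_right (not_not.mpr h3)
    refine ⟨levi 0 1 (-1) 0 (by norm_num), v₁⁻¹, 0, -1, inv_ne_zero h1, by simp [h1],
      fun i j => ?_⟩
    rw [ent, levi, ParInt.mat_mk]
    rcases i with i | i <;> rcases j with j | j <;> fin_cases i <;> fin_cases j <;>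
      simp [leviMat, h1, h3]
  · obtain ⟨r, hr⟩ : ∃ r : ℕ, (r : ZMod p) = v₃⁻¹ * v₁ := ⟨(v₃⁻¹ * v₁).val, by simp⟩
    refine ⟨levi 1 r 0 1 (by norm_num), v₃⁻¹, 1, 0, inv_ne_zero h3, by simp [h3],
      fun i j => ?_⟩
    rw [ent, levi, ParInt.mat_mk]
    rcases i with i | i <;> rcases j with j | j <;> fin_cases i <;> fin_cases j <;>
      simp [leviMat, h3, hr]

/-- This is transitivity of Γ_{1,1} on lines of {x₄ = 0} other than ⟨e₂⟩, with a vector outside that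
hyperplane prescribed at the same time. -/
lemma exists_frame (v₁ v₂ v₃ u₁ u₂ u₃ : ZMod p) (h : v₁ ≠ 0 ∨ v₃ ≠ 0) :
    ∃ (ε : ParInt) (s : ZMod p), s ≠ 0 ∧ D.ent ε (Sum.inl 0) (Sum.inr 0) = s * v₁ ∧
      D.ent ε (Sum.inl 1) (Sum.inr 0) = s * v₂ ∧ D.ent ε (Sum.inr 0) (Sum.inr 0) = s * v₃ ∧
      D.ent ε (Sum.inl 0) (Sum.inr 1) = u₁ ∧ D.ent ε (Sum.inl 1) (Sum.inr 1) = u₂ ∧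
      D.ent ε (Sum.inr 0) (Sum.inr 1) = u₃ ∧ D.ent ε (Sum.inr 1) (Sum.inr 1) = 1 := by
  obtain ⟨m, s, a, c, hs, hdet, hm⟩ := D.exists_levi v₁ v₃ h
  -- The last two parameters are the inverse of the determinant-one Levi block applied to (u₁, u₃),
  -- so that multiplication by m restores u₁ and u₃.
  obtain ⟨n, hn⟩ := D.exists_heisenberg 0 (s * v₂) u₂ (s * v₃ * u₁ - s * v₁ * u₃)
    (-c * u₁ + a * u₃)
  refine ⟨m * n, s, hs, ?_, ?_, ?_, ?_, ?_, ?_, ?_⟩ <;> rw [ent_mul] <;> simp [hm, hn]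
  · linear_combination u₁ * hdet
  · linear_combination u₃ * hdet

/-! ### Indices of the stabilizers -/

/-- The kernel is ⟨e₂, e₃⟩. Its orbit consists of the planes with ⟨e₂⟩ ⊂ plane ⊂ {x₄ = 0}, which are
the points of a projective line; `none` labels the point at infinity. -/
lemma index_one_p_p_one : (cosetStab (diagInt 1 p p 1)).index = p + 1 := by
  classical
  rw [← Subgroup.relIndex_top_right, relIndex_eq_card (S := Option (ZMod p))
    (fun δ => if D.ent δ (Sum.inr 0) (Sum.inr 0) = 0 then none else
      some (D.ent δ (Sum.inl 0) (Sum.inr 0) / D.ent δ (Sum.inr 0) (Sum.inr 0)))]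
  · simp
  · rintro (_ | s)
    · obtain ⟨m, s, a, c, hs, hdet, hm⟩ := D.exists_levi 1 0 (by simp)
      exact ⟨m, trivial, by simp [hm]⟩
    · obtain ⟨m, t, a, c, ht, hdet, hm⟩ := D.exists_levi s 1 (by simp)
      exact ⟨m, trivial, by simp [hm, ht, mul_div_cancel_left₀]⟩
  · intro a _ c _
    rw [D.mem_cosetStab_one_p_p_one]
    have hdet := D.ent_det a
    have hdc := D.ent_det c
    simp only [ent_mul, ent_row2, ent_col0, ent_col2, zero_mul, mul_zero, add_zero]
    constructor
    · intro h
      have key : (D.ent a (Sum.inl 0) (Sum.inl 0) * D.ent a (Sum.inr 0) (Sum.inr 0)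
          - D.ent a (Sum.inl 0) (Sum.inr 0) * D.ent a (Sum.inr 0) (Sum.inl 0))
          * D.ent c (Sum.inl 0) (Sum.inr 0) = 0 := by
        split_ifs at h with h1 h2 h2
        · rw [h2, zero_mul, add_zero] at h1
          rw [h2]
          linear_combination -D.ent a (Sum.inl 0) (Sum.inr 0) * h1
        · rw [Option.some.injEq, div_eq_div_iff h1 h2] at h
          linear_combination h
      exact (mul_eq_zero.mp key).resolve_left hdet
    · intro h
      rw [h] at hdc ⊢
      have hc : D.ent c (Sum.inr 0) (Sum.inr 0) ≠ 0 := by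
        intro h0
        simp [h0] at hdc
      simp only [mul_zero, zero_add]
      by_cases h1 : D.ent a (Sum.inr 0) (Sum.inr 0) = 0
      · simp [h1]
      · simp [h1, hc, mul_div_mul_right]

/-- The kernel is ⟨e₃⟩. A line of {x₄ = 0} other than ⟨e₂⟩ spans a plane with e₂, giving p + 1
choices, and such a plane contains p of these lines. -/
lemma index_tOne : (cosetStab (diagInt 1 (star ϖ) p (star ϖ))).index = p * (p + 1) := by
  have hle : cosetStab (diagInt 1 (star ϖ) p (star ϖ)) ≤ cosetStab (diagInt 1 p p 1) := by
    intro δ hδ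
    rw [D.mem_cosetStab_tOne] at hδ
    rw [D.mem_cosetStab_one_p_p_one]
    exact hδ.1
  rw [← Subgroup.relIndex_mul_index hle, D.index_one_p_p_one,
    relIndex_eq_card (S := ZMod p)
    (fun δ => D.ent δ (Sum.inl 1) (Sum.inr 0) / D.ent δ (Sum.inr 0) (Sum.inr 0))]
  · simp
  · intro s
    obtain ⟨n, hn⟩ := D.exists_heisenberg 0 s 0 0 0
    refine ⟨n, ?_, by simp [hn]⟩
    rw [D.mem_cosetStab_one_p_p_one]
    simp [hn]
  · intro a ha c hc
    rw [D.mem_cosetStab_one_p_p_one] at ha hc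
    rw [D.mem_cosetStab_tOne]
    have hda := D.ent_det a
    have hdc := D.ent_det c
    have h2 := D.ent_22 a
    simp only [ent_mul, ha, hc, ent_row2, ent_col2, zero_mul, mul_zero, add_zero, zero_add,
      sub_zero, true_and] at hda hdc ⊢
    rw [div_eq_div_iff (mul_ne_zero (right_ne_zero_of_mul hda) (right_ne_zero_of_mul hdc))
      (right_ne_zero_of_mul hda)]
    constructor
    · intro h
      have key : (D.ent a (Sum.inl 1) (Sum.inl 1) * D.ent a (Sum.inr 0) (Sum.inr 0))
          * D.ent c (Sum.inl 1) (Sum.inr 0) = 0 := by linear_combination h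
      exact (mul_eq_zero.mp key).resolve_left (mul_ne_zero h2 (right_ne_zero_of_mul hda))
    · intro h
      rw [h]
      ring

/-- The kernel is ⟨e₃, e₄⟩. A generic plane meets {x₄ = 0} in one of the p(p+1) lines other than
⟨e₂⟩, and p² planes outside the hyperplane pass through each such line. -/
lemma index_tTwo : (cosetStab (diagInt 1 1 p p)).index = p ^ 2 * (p * (p + 1)) := by
  have hle : cosetStab (diagInt 1 1 p p) ≤ cosetStab (diagInt 1 (star ϖ) p (star ϖ)) := by
    intro δ hδ
    rw [D.mem_cosetStab_tTwo] at hδ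
    rw [D.mem_cosetStab_tOne]
    exact ⟨hδ.1.1, hδ.2.1⟩
  rw [← Subgroup.relIndex_mul_index hle, D.index_tOne,
    relIndex_eq_card (S := ZMod p × ZMod p)
    (fun δ => (D.ent δ (Sum.inl 0) (Sum.inr 1) / D.ent δ (Sum.inr 1) (Sum.inr 1),
      D.ent δ (Sum.inl 1) (Sum.inr 1) / D.ent δ (Sum.inr 1) (Sum.inr 1)))]
  · simp [sq]
  · rintro ⟨s, t⟩
    obtain ⟨n, hn⟩ := D.exists_heisenberg 0 0 t s 0
    refine ⟨n, ?_, by simp [hn]⟩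
    rw [D.mem_cosetStab_tOne]
    simp [hn]
  · intro a ha c hc
    rw [D.mem_cosetStab_tOne] at ha hc
    rw [D.mem_cosetStab_tTwo]
    have hda := D.ent_det a
    have h2 := D.ent_22 a
    have h4 := D.ent_44 a
    have h4' := D.ent_44 c
    simp only [ent_mul, ha.1, ha.2, hc.1, hc.2, ent_row2, ent_row0, ent_row1, ent_col0, zero_mul,
      add_zero, zero_add, sub_zero, true_and, Prod.mk.injEq] at hda ⊢
    rw [div_eq_div_iff (mul_ne_zero h4 h4') h4, div_eq_div_iff (mul_ne_zero h4 h4') h4]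
    constructor
    · rintro ⟨e1, e2⟩
      have k1 : (D.ent a (Sum.inl 0) (Sum.inl 0) * D.ent a (Sum.inr 1) (Sum.inr 1))
          * D.ent c (Sum.inl 0) (Sum.inr 1) = 0 := by linear_combination e1
      have k2 := (mul_eq_zero.mp k1).resolve_left (mul_ne_zero (left_ne_zero_of_mul hda) h4)
      rw [k2] at e2
      have k3 : (D.ent a (Sum.inl 1) (Sum.inl 1) * D.ent a (Sum.inr 1) (Sum.inr 1))
          * D.ent c (Sum.inl 1) (Sum.inr 1) = 0 := by linear_combination e2
      exact ⟨k2, (mul_eq_zero.mp k3).resolve_left (mul_ne_zero h2 h4)⟩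
    · rintro ⟨e1, e2⟩
      rw [e1, e2]
      constructor <;> ring

/-- The orbit consists of the complements of ⟨e₂⟩ in {x₄ = 0}. The defining conditions lie on the
second row, while left cosets are seen by columns, so the label is computed from the inverse
element. -/
lemma index_tMixed : (cosetStab (diagInt ϖ (star ϖ) ϖ (star ϖ))).index = p ^ 2 := by
  rw [← Subgroup.relIndex_top_right, relIndex_eq_card (S := ZMod p × ZMod p)
    (fun δ => (D.ent δ⁻¹ (Sum.inl 1) (Sum.inl 0) / D.ent δ⁻¹ (Sum.inl 1) (Sum.inl 1),
      D.ent δ⁻¹ (Sum.inl 1) (Sum.inr 0) / D.ent δ⁻¹ (Sum.inl 1) (Sum.inl 1)))]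
  · simp [sq]
  · rintro ⟨s, t⟩
    obtain ⟨n, hn⟩ := D.exists_heisenberg s t 0 0 0
    exact ⟨n⁻¹, trivial, by simp [hn]⟩
  · intro a _ c _
    rw [← inv_mem_iff (x := c), D.mem_cosetStab_tMixed, mul_inv_rev]
    generalize a⁻¹ = a
    generalize c⁻¹ = c
    have hda := D.ent_det a
    have h2 := D.ent_22 a
    have h2' := D.ent_22 c
    simp only [ent_mul, ent_row0, ent_row1, ent_row2, ent_col0, ent_col2,
      mul_zero, add_zero, zero_add, Prod.mk.injEq]
    rw [div_eq_div_iff (mul_ne_zero h2' h2) h2, div_eq_div_iff (mul_ne_zero h2' h2) h2]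
    constructor
    · rintro ⟨e1, e2⟩
      constructor
      · refine (mul_eq_zero.mp (?_ : D.ent a (Sum.inl 1) (Sum.inl 1) * _ * _ = 0)).resolve_left
          (mul_ne_zero h2 hda)
        linear_combination D.ent a (Sum.inr 0) (Sum.inr 0) * e1
          - D.ent a (Sum.inr 0) (Sum.inl 0) * e2
      · refine (mul_eq_zero.mp (?_ : D.ent a (Sum.inl 1) (Sum.inl 1) * _ * _ = 0)).resolve_left
          (mul_ne_zero h2 hda)
        linear_combination D.ent a (Sum.inl 0) (Sum.inl 0) * e2
          - D.ent a (Sum.inl 0) (Sum.inr 0) * e1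
    · rintro ⟨e1, e2⟩
      rw [e1, e2]
      constructor <;> ring

/-- The kernel is ⟨e₂, e₄⟩: the orbit consists of the planes through e₂ not contained in {x₄ = 0},
labelled by the fourth column modulo e₂. -/
lemma index_tMixed_star : (cosetStab (diagInt (star ϖ) ϖ (star ϖ) ϖ)).index = p ^ 2 := by
  rw [← Subgroup.relIndex_top_right, relIndex_eq_card (S := ZMod p × ZMod p)
    (fun δ => (D.ent δ (Sum.inl 0) (Sum.inr 1) / D.ent δ (Sum.inr 1) (Sum.inr 1),
      D.ent δ (Sum.inr 0) (Sum.inr 1) / D.ent δ (Sum.inr 1) (Sum.inr 1)))]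
  · simp [sq]
  · rintro ⟨s, t⟩
    obtain ⟨n, hn⟩ := D.exists_heisenberg 0 0 0 s t
    exact ⟨n, trivial, by simp [hn]⟩
  · intro a _ c _
    rw [D.mem_cosetStab_tMixed_star]
    have hda := D.ent_det a
    have h4 := D.ent_44 a
    have h4' := D.ent_44 c
    simp only [ent_mul, ent_row0, ent_row1, ent_row2, ent_col0, ent_col2, zero_mul,
      add_zero, zero_add, Prod.mk.injEq]
    rw [div_eq_div_iff (mul_ne_zero h4 h4') h4, div_eq_div_iff (mul_ne_zero h4 h4') h4]
    constructor
    · rintro ⟨e1, e2⟩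
      constructor
      · refine (mul_eq_zero.mp (?_ : D.ent a (Sum.inr 1) (Sum.inr 1) * _ * _ = 0)).resolve_left
          (mul_ne_zero h4 hda)
        linear_combination D.ent a (Sum.inr 0) (Sum.inr 0) * e1
          - D.ent a (Sum.inl 0) (Sum.inr 0) * e2
      · refine (mul_eq_zero.mp (?_ : D.ent a (Sum.inr 1) (Sum.inr 1) * _ * _ = 0)).resolve_left
          (mul_ne_zero h4 hda)
        linear_combination D.ent a (Sum.inl 0) (Sum.inl 0) * e2
          - D.ent a (Sum.inr 0) (Sum.inl 0) * e1
    · rintro ⟨e1, e2⟩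
      rw [e1, e2]
      constructor <;> ring

/-- The orbit of ⟨e₄⟩ is the set of lines outside {x₄ = 0}, an affine space of dimension three. -/
lemma index_lambdaPlus : (cosetStab (diagInt (star ϖ) 1 (star ϖ) p)).index = p ^ 3 := by
  have hle : cosetStab (diagInt (star ϖ) 1 (star ϖ) p) ≤
      cosetStab (diagInt (star ϖ) ϖ (star ϖ) ϖ) := by
    intro δ hδ
    rw [D.mem_cosetStab_lambdaPlus] at hδ
    rw [D.mem_cosetStab_tMixed_star]
    exact ⟨hδ.1, hδ.2.2⟩
  rw [← Subgroup.relIndex_mul_index hle, D.index_tMixed_star,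
    relIndex_eq_card (S := ZMod p)
    (fun δ => D.ent δ (Sum.inl 1) (Sum.inr 1) / D.ent δ (Sum.inr 1) (Sum.inr 1))]
  · simp
    ring
  · intro s
    obtain ⟨n, hn⟩ := D.exists_heisenberg 0 0 s 0 0
    refine ⟨n, ?_, by simp [hn]⟩
    rw [D.mem_cosetStab_tMixed_star]
    simp [hn]
  · intro a ha c hc
    rw [D.mem_cosetStab_tMixed_star] at ha hc
    rw [D.mem_cosetStab_lambdaPlus]
    have h2 := D.ent_22 a
    have h4 := D.ent_44 a
    have h4' := D.ent_44 c
    simp only [ent_mul, hc.1, hc.2, ent_row0, ent_row1, ent_row2, zero_mul,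
      mul_zero, add_zero, zero_add, true_and, and_true]
    rw [div_eq_div_iff (mul_ne_zero h4 h4') h4]
    constructor
    · intro h
      have key : (D.ent a (Sum.inl 1) (Sum.inl 1) * D.ent a (Sum.inr 1) (Sum.inr 1))
          * D.ent c (Sum.inl 1) (Sum.inr 1) = 0 := by linear_combination h
      exact (mul_eq_zero.mp key).resolve_left (mul_ne_zero h2 h4)
    · intro h
      rw [h]
      ring

end SplitPrime

/-! ### Double cosets of the full modular group -/

/-- Two integral matrices generate the same double coset of `Γ₂`. -/
def DoubleEquiv (x y : IntMat) : Prop :=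
  ∃ γ₁ ∈ unitaryGroupInt, ∃ γ₂ ∈ unitaryGroupInt, y = γ₁.val * x * γ₂.val

lemma DoubleEquiv.symm {x y : IntMat} (h : DoubleEquiv x y) : DoubleEquiv y x := by
  obtain ⟨γ₁, h₁, γ₂, h₂, rfl⟩ := h
  refine ⟨γ₁⁻¹, inv_mem h₁, γ₂⁻¹, inv_mem h₂, ?_⟩
  have e1 : (γ₁⁻¹).val * γ₁.val = 1 := by rw [← Units.val_mul]; simp
  have e2 : γ₂.val * (γ₂⁻¹).val = 1 := by rw [← Units.val_mul]; simp
  calc x = ((γ₁⁻¹).val * γ₁.val) * x * (γ₂.val * (γ₂⁻¹).val) := by rw [e1, e2]; simp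
    _ = _ := by simp only [Matrix.mul_assoc]

lemma DoubleEquiv.trans {x y z : IntMat} (h : DoubleEquiv x y) (h' : DoubleEquiv y z) :
    DoubleEquiv x z := by
  obtain ⟨γ₁, h₁, γ₂, h₂, rfl⟩ := h
  obtain ⟨γ₃, h₃, γ₄, h₄, rfl⟩ := h'
  refine ⟨γ₃ * γ₁, mul_mem h₃ h₁, γ₂ * γ₄, mul_mem h₂ h₄, ?_⟩
  simp only [Units.val_mul, Matrix.mul_assoc]

lemma DoubleEquiv.of_mul_eq {x y A B : IntMat}
    (hA : Aᴴ * Matrix.J (Fin 2) GaussianInt * A = Matrix.J (Fin 2) GaussianInt)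
    (hB : Bᴴ * Matrix.J (Fin 2) GaussianInt * B = Matrix.J (Fin 2) GaussianInt)
    (h : y = A * x * B) : DoubleEquiv x y :=
  ⟨unitaryUnit A hA, hA, unitaryUnit B hB, hB, h⟩

/-- The Weyl element exchanging the coordinates one and two, and three and four. -/
def weylSwap : IntMat := Matrix.fromBlocks !![0, 1; 1, 0] 0 0 !![0, 1; 1, 0]

lemma weylSwap_unitary : weylSwapᴴ * Matrix.J (Fin 2) GaussianInt * weylSwap
    = Matrix.J (Fin 2) GaussianInt := by
  refine Matrix.ext fun i j => ?_
  rcases i with i | i <;> rcases j with j | j <;> fin_cases i <;> fin_cases j <;>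
    simp [weylSwap, Matrix.J, Matrix.mul_apply, Matrix.fromBlocks]

/-- The Weyl element exchanging the coordinates two and four up to sign. -/
def weylFlip (e : GaussianInt) : IntMat :=
  Matrix.fromBlocks !![1, 0; 0, 0] !![0, 0; 0, -e] !![0, 0; 0, e] !![1, 0; 0, 0]

lemma weylFlip_unitary {e : GaussianInt} (he : star e * e = 1) :
    (weylFlip e)ᴴ * Matrix.J (Fin 2) GaussianInt * weylFlip e = Matrix.J (Fin 2) GaussianInt := by
  refine Matrix.ext fun i j => ?_
  rcases i with i | i <;> rcases j with j | j <;> fin_cases i <;> fin_cases j <;>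
    simp [weylFlip, Matrix.J, Matrix.mul_apply, Matrix.fromBlocks, he]

lemma doubleEquiv_swap (a b c d : GaussianInt) :
    DoubleEquiv (diagInt a b c d) (diagInt b a d c) := by
  refine DoubleEquiv.of_mul_eq weylSwap_unitary weylSwap_unitary ?_
  refine Matrix.ext fun i j => ?_
  rcases i with i | i <;> rcases j with j | j <;> fin_cases i <;> fin_cases j <;>
    simp [weylSwap, diagInt, Matrix.mul_apply, Matrix.fromBlocks]

lemma doubleEquiv_flip (a b c d : GaussianInt) :
    DoubleEquiv (diagInt a b c d) (diagInt a d c b) := by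
  refine DoubleEquiv.of_mul_eq (weylFlip_unitary (e := 1) (by simp))
    (weylFlip_unitary (e := -1) (by simp)) ?_
  refine Matrix.ext fun i j => ?_
  rcases i with i | i <;> rcases j with j | j <;> fin_cases i <;> fin_cases j <;>
    simp [weylFlip, diagInt, Matrix.mul_apply, Matrix.fromBlocks]

/-- The element `diag(U, U⁻ᴴ)` for `U = (a, b; c, d)` of determinant one. -/
def siegelLevi (a b c d : GaussianInt) : IntMat :=
  Matrix.fromBlocks !![a, b; c, d] 0 0 !![star d, -star c; -star b, star a]

lemma siegelLevi_unitary {a b c d : GaussianInt} (h : a * d - b * c = 1) :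
    (siegelLevi a b c d)ᴴ * Matrix.J (Fin 2) GaussianInt * siegelLevi a b c d
      = Matrix.J (Fin 2) GaussianInt := by
  have h' : star a * star d - star b * star c = 1 := by
    have := congrArg star h
    simpa [mul_comm] using this
  refine Matrix.ext fun i j => ?_
  rcases i with i | i <;> rcases j with j | j <;> fin_cases i <;> fin_cases j <;>
    simp [siegelLevi, Matrix.J, Matrix.mul_apply, Matrix.fromBlocks] <;>
    first
      | ring1
      | linear_combination h
      | linear_combination -h
      | linear_combination h'
      | linear_combination -h'

/-- By a Bézout relation diag(ϖ, ϖ') has elementary divisors 1 and p. The two transforming matrices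
have determinant one and are embedded into the unitary group by `siegelLevi`. -/
lemma doubleEquiv_of_coprime {p : ℕ} {ϖ : GaussianInt} (hϖ : ϖ * star ϖ = p)
    (hc : IsCoprime ϖ (star ϖ)) :
    DoubleEquiv (diagInt ϖ (star ϖ) ϖ (star ϖ)) (diagInt 1 p p 1) := by
  obtain ⟨a, b, h⟩ := hc
  have h' : star a * star ϖ + star b * ϖ = 1 := by
    have := congrArg star h
    simpa [mul_comm] using this
  refine DoubleEquiv.of_mul_eq (A := siegelLevi a b (-star ϖ) ϖ)
    (B := siegelLevi 1 (-(b * star ϖ)) 1 (a * ϖ)) (siegelLevi_unitary (by linear_combination h))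
    (siegelLevi_unitary (by linear_combination h)) ?_
  refine Matrix.ext fun i j => ?_
  rcases i with i | i <;> rcases j with j | j <;> fin_cases i <;> fin_cases j <;>
    simp [siegelLevi, diagInt, Matrix.mul_apply, Matrix.fromBlocks, ← hϖ] <;>
    first
      | ring1
      | linear_combination h
      | linear_combination -h
      | linear_combination h'
      | linear_combination -h'
      | linear_combination (ϖ * star ϖ) * h
      | linear_combination -(ϖ * star ϖ) * h
      | linear_combination (ϖ * star ϖ) * h'
      | linear_combination -(ϖ * star ϖ) * h'

namespace SplitPrime

variable {p : ℕ} [Fact p.Prime] {ϖ : GaussianInt} (D : SplitPrime p ϖ)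
include D

/-- A coset in the double coset of x is determined by its kernel modulo ϖ: if ε maps the kernel of x
into that of h, then h and x ε⁻¹ lie in the same left coset. -/
lemma exists_eq_mul_mul {x : Fin 2 ⊕ Fin 2 → GaussianInt}
    (hx : ∀ i, star (x i) * x i.swap = p) {h : IntMat} (hh : DoubleEquiv (Matrix.diagonal x) h)
    (ε : ParInt)
    (hε : ∀ j, D.red (x j) = 0 → (h.map D.red) *ᵥ (fun l => D.ent ε l j) = 0) :
    ∃ γ ∈ unitaryGroupInt, h = γ.val * Matrix.diagonal x * (ε⁻¹).mat := by
  obtain ⟨γ₁, h₁, γ₂, h₂, rfl⟩ := hh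
  have e1 : (γ₁⁻¹).val * γ₁.val = 1 := by rw [← Units.val_mul]; simp
  obtain ⟨γ, hγ, hγx⟩ := D.exists_diagonal_mul_eq hx (mul_mem h₂ ε.2.1) (fun i j hi hj => by
    have h3 := hε j hj
    have h4 : (Matrix.diagonal x * (γ₂.val * ε.mat)).map D.red
        = (γ₁⁻¹).val.map D.red * ((γ₁.val * Matrix.diagonal x * γ₂.val).map D.red
          * ε.mat.map D.red) := by
      rw [← Matrix.map_mul, ← Matrix.map_mul]
      congr 1
      calc _ = ((γ₁⁻¹).val * γ₁.val) * (Matrix.diagonal x * (γ₂.val * ε.mat)) := by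
            rw [e1, Matrix.one_mul]
        _ = _ := by simp only [Matrix.mul_assoc]
    have h5 : ((γ₁.val * Matrix.diagonal x * γ₂.val).map D.red * ε.mat.map D.red)
        = (Matrix.of fun i j => ((γ₁.val * Matrix.diagonal x * γ₂.val).map D.red *ᵥ
          (fun l => D.ent ε l j)) i) := rfl
    have h6 := congrFun (congrFun h4 i) j
    rw [Matrix.mul_apply, h5] at h6
    simp only [Matrix.of_apply, h3, Pi.zero_apply, mul_zero, Finset.sum_const_zero,
      Matrix.map_apply, Matrix.diagonal_mul, map_mul] at h6
    exact (mul_eq_zero.mp h6).resolve_left hi)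
  refine ⟨γ₁ * γ, mul_mem h₁ hγ, ?_⟩
  rw [Units.val_mul, Matrix.mul_assoc γ₁.val γ.val, ← hγx]
  have e2 : ε.1.val * (ε⁻¹).mat = 1 := ParInt.mat_mul_inv ε
  simp only [Units.val_mul, Matrix.mul_assoc, e2, Matrix.mul_one]

/-- If x and y lie in one orbit, some parabolic ε carries the kernel of y modulo ϖ into that of x.
-/
lemma exists_ent_eq_zero {x y : Fin 2 ⊕ Fin 2 → GaussianInt} {δ δ' : ParInt} {γ : IntMat}
    (h : Matrix.diagonal x * δ.mat = γ * Matrix.diagonal y * δ'.mat) :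
    ∃ ε : ParInt, ∀ a b, D.red (y b) = 0 → D.red (x a) * D.ent ε a b = 0 := by
  refine ⟨δ * δ'⁻¹, fun a b hb => ?_⟩
  have h1 : Matrix.diagonal x * (δ * δ'⁻¹).mat = γ * Matrix.diagonal y := by
    rw [ParInt.mat_mul, ← Matrix.mul_assoc, h, Matrix.mul_assoc, ParInt.mat_mul_inv,
      Matrix.mul_one]
  have h2 := congrFun (congrFun h1 a) b
  rw [Matrix.diagonal_mul, Matrix.mul_diagonal] at h2
  rw [ent, ← map_mul, h2, map_mul, hb, mul_zero]

end SplitPrime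

/-! ### Splitting the Γ₂-double cosets of T(ϖ') and T(p) under Γ_{1,1} -/

/-- The diagonals of the `Γ_{1,1}`-double cosets that make up `T(π)`, for `π = conj ϖ`. -/
def tOneDiag (p : ℕ) (ϖ : GaussianInt) : Fin 3 → Fin 2 ⊕ Fin 2 → GaussianInt :=
  ![Sum.elim ![star ϖ, p] ![star ϖ, 1], Sum.elim ![1, star ϖ] ![p, star ϖ],
    Sum.elim ![star ϖ, 1] ![star ϖ, p]]

/-- The diagonals of the `Γ_{1,1}`-double cosets that make up `T(p)`. -/
def tTwoDiag (p : ℕ) (ϖ : GaussianInt) : Fin 4 → Fin 2 ⊕ Fin 2 → GaussianInt :=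
  ![Sum.elim ![1, p] ![p, 1], Sum.elim ![ϖ, star ϖ] ![ϖ, star ϖ],
    Sum.elim ![star ϖ, ϖ] ![star ϖ, ϖ], Sum.elim ![1, 1] ![p, p]]

namespace SplitPrime

variable {p : ℕ} [Fact p.Prime] {ϖ : GaussianInt} (D : SplitPrime p ϖ)
include D

omit [Fact p.Prime] in
lemma tOneDiag_similar (i : Fin 3) (a : Fin 2 ⊕ Fin 2) :
    star (tOneDiag p ϖ i a) * tOneDiag p ϖ i a.swap = p := by
  fin_cases i
  · exact star_mul_swap_eq (by rw [star_star, D.mul_star]) (by simp) a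
  · exact star_mul_swap_eq (by simp) (by rw [star_star, D.mul_star]) a
  · exact star_mul_swap_eq (by rw [star_star, D.mul_star]) (by simp) a

omit [Fact p.Prime] in
lemma tTwoDiag_similar (i : Fin 4) (a : Fin 2 ⊕ Fin 2) :
    star (tTwoDiag p ϖ i a) * tTwoDiag p ϖ i a.swap = p := by
  fin_cases i
  · exact star_mul_swap_eq (by simp) (by simp) a
  · exact star_mul_swap_eq D.star_mul_self (by rw [star_star, D.mul_star]) a
  · exact star_mul_swap_eq (by rw [star_star, D.mul_star]) D.star_mul_self a
  · exact star_mul_swap_eq (by simp) (by simp) a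

omit D [Fact p.Prime] in
lemma doubleEquiv_tOneDiag (i : Fin 3) :
    DoubleEquiv (diagInt 1 (star ϖ) p (star ϖ)) (Matrix.diagonal (tOneDiag p ϖ i)) := by
  have h1 : DoubleEquiv (diagInt 1 (star ϖ) p (star ϖ)) (diagInt (star ϖ) 1 (star ϖ) p) :=
    doubleEquiv_swap _ _ _ _
  fin_cases i
  · exact h1.trans (doubleEquiv_flip _ _ _ _)
  · exact (doubleEquiv_swap _ _ _ _).trans (doubleEquiv_swap _ _ _ _)
  · exact h1

omit [Fact p.Prime] in
lemma doubleEquiv_tTwoDiag (i : Fin 4) :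
    DoubleEquiv (diagInt 1 1 p p) (Matrix.diagonal (tTwoDiag p ϖ i)) := by
  have h1 : DoubleEquiv (diagInt 1 1 p p) (diagInt 1 p p 1) := doubleEquiv_flip _ _ _ _
  have h2 := h1.trans (doubleEquiv_of_coprime D.mul_star D.coprime).symm
  fin_cases i
  · exact h1
  · exact h2
  · exact h2.trans (doubleEquiv_swap _ _ _ _)
  · exact doubleEquiv_swap _ _ _ _

/-- The kernels are ⟨e₂⟩, ⟨e₃⟩ and ⟨e₄⟩, in different positions relative to the flag ⟨e₂⟩ ⊂ {x₄ =
0}. A parabolic ε relating two of them would have a vanishing diagonal entry or a singular Levi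
block. -/
lemma tOneDiag_disjoint {i j : Fin 3} {δ δ' : ParInt} {γ : IntMat}
    (h : Matrix.diagonal (tOneDiag p ϖ i) * δ.mat
      = γ * Matrix.diagonal (tOneDiag p ϖ j) * δ'.mat) : i = j := by
  obtain ⟨ε, hε⟩ := D.exists_ent_eq_zero h
  have hdet := D.ent_det ε
  have h22 := D.ent_22 ε
  have h44 := D.ent_44 ε
  fin_cases i <;> fin_cases j <;> first | rfl | exfalso
  all_goals
    simp [tOneDiag, Sum.forall, Fin.forall_fin_two, D.red_natCast, D.red_star, h22, h44]
      at hε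
  all_goals
    simp [hε] at hdet

lemma tTwoDiag_disjoint {i j : Fin 4} {δ δ' : ParInt} {γ : IntMat}
    (h : Matrix.diagonal (tTwoDiag p ϖ i) * δ.mat
      = γ * Matrix.diagonal (tTwoDiag p ϖ j) * δ'.mat) : i = j := by
  obtain ⟨ε, hε⟩ := D.exists_ent_eq_zero h
  have hdet := D.ent_det ε
  have h22 := D.ent_22 ε
  have h44 := D.ent_44 ε
  fin_cases i <;> fin_cases j <;> first | rfl | exfalso
  all_goals
    simp [tTwoDiag, Sum.forall, Fin.forall_fin_two, D.red_self, D.red_natCast, D.red_star, h22,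
      h44] at hε
  all_goals
    simp [hε] at hdet

lemma mulVec_inv_col {x : Fin 2 ⊕ Fin 2 → GaussianInt} {j : Fin 2 ⊕ Fin 2} (hj : D.red (x j) = 0)
    (γ₁ : IntMat) (γ₂ : GL (Fin 2 ⊕ Fin 2) GaussianInt) :
    ((γ₁ * Matrix.diagonal x * γ₂.val).map D.red) *ᵥ (fun l => D.red ((γ₂⁻¹).val l j)) = 0 := by
  have e2 : γ₂.val * (γ₂⁻¹).val = 1 := by rw [← Units.val_mul]; simp
  have h1 : (γ₁ * Matrix.diagonal x * γ₂.val).map D.red * (γ₂⁻¹).val.map D.red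
      = (γ₁ * Matrix.diagonal x).map D.red := by
    rw [← Matrix.map_mul, Matrix.mul_assoc (γ₁ * Matrix.diagonal x), e2, Matrix.mul_one]
  funext i
  have h2 := congrFun (congrFun h1 i) j
  rw [Matrix.map_apply, Matrix.mul_diagonal, map_mul, hj, mul_zero] at h2
  exact h2

lemma smul_inv_col_eq_zero {γ : GL (Fin 2 ⊕ Fin 2) GaussianInt} {i j : Fin 2 ⊕ Fin 2}
    (hij : i ≠ j) {a b : ZMod p}
    (h : ∀ l, a * D.red ((γ⁻¹).val l i) + b * D.red ((γ⁻¹).val l j) = 0) : a = 0 ∧ b = 0 := by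
  have e : ∀ m n, ∑ l, D.red (γ.val m l) * D.red ((γ⁻¹).val l n) = if m = n then 1 else 0 := by
    intro m n
    have e2 : γ.val * (γ⁻¹).val = 1 := by rw [← Units.val_mul]; simp
    have := congrArg D.red (congrFun (congrFun e2 m) n)
    rw [Matrix.mul_apply, map_sum, Matrix.one_apply] at this
    simp only [map_mul] at this
    rw [this]
    split_ifs <;> simp
  have key : ∀ m, a * (∑ l, D.red (γ.val m l) * D.red ((γ⁻¹).val l i))
      + b * (∑ l, D.red (γ.val m l) * D.red ((γ⁻¹).val l j)) = 0 := by
    intro m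
    rw [Finset.mul_sum, Finset.mul_sum, ← Finset.sum_add_distrib]
    refine Finset.sum_eq_zero fun l _ => ?_
    linear_combination D.red (γ.val m l) * h l
  constructor
  · have := key i
    rw [e, e, if_pos rfl, if_neg hij] at this
    simpa using this
  · have := key j
    rw [e, e, if_pos rfl, if_neg hij.symm] at this
    simpa using this

omit D in
lemma mulVec_comb {M : Matrix (Fin 2 ⊕ Fin 2) (Fin 2 ⊕ Fin 2) (ZMod p)}
    {f g w : Fin 2 ⊕ Fin 2 → ZMod p} (hf : M *ᵥ f = 0) (hg : M *ᵥ g = 0) (a b : ZMod p)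
    (h : ∀ l, w l = a * f l + b * g l) : M *ᵥ w = 0 := by
  have : w = a • f + b • g := funext h
  rw [this, Matrix.mulVec_add, Matrix.mulVec_smul, Matrix.mulVec_smul, hf, hg]
  simp

/-- The kernel of h modulo ϖ contains the nonzero vector f. Either f lies outside {x₄ = 0}, or
inside but off ⟨e₂⟩, or on ⟨e₂⟩; in each case a parabolic element moves a standard basis vector onto
its line. -/
lemma tOne_cover {h : IntMat} (hh : DoubleEquiv (diagInt 1 (star ϖ) p (star ϖ)) h) :
    ∃ i, ∃ δ : ParInt, ∃ γ ∈ unitaryGroupInt,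
      h = γ.val * Matrix.diagonal (tOneDiag p ϖ i) * δ.mat := by
  have hall : ∀ i, DoubleEquiv (Matrix.diagonal (tOneDiag p ϖ i)) h := fun i =>
    (doubleEquiv_tOneDiag i).symm.trans hh
  have fin : ∀ (i : Fin 3) (ε : ParInt),
      (∀ j, D.red (tOneDiag p ϖ i j) = 0 → (h.map D.red) *ᵥ (fun l => D.ent ε l j) = 0) →
      ∃ i, ∃ δ : ParInt, ∃ γ ∈ unitaryGroupInt,
        h = γ.val * Matrix.diagonal (tOneDiag p ϖ i) * δ.mat := fun i ε hε => by
    obtain ⟨γ, hγ, e⟩ := D.exists_eq_mul_mul (D.tOneDiag_similar i) (hall i) ε hε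
    exact ⟨i, ε⁻¹, γ, hγ, e⟩
  obtain ⟨γ₁, h₁, γ₂, h₂, e⟩ := hh
  have hk : (h.map D.red) *ᵥ (fun l => D.red ((γ₂⁻¹).val l (Sum.inr 0))) = 0 := by
    rw [e]
    exact D.mulVec_inv_col (by simp [D.red_natCast]) γ₁.val γ₂
  have hne : ∀ a b, (∀ l, a * D.red ((γ₂⁻¹).val l (Sum.inr 0))
    + b * D.red ((γ₂⁻¹).val l (Sum.inr 1)) = 0) → a = 0 ∧ b = 0 :=
    fun a b h => D.smul_inv_col_eq_zero (by simp) h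
  set f : Fin 2 ⊕ Fin 2 → ZMod p := fun l => D.red ((γ₂⁻¹).val l (Sum.inr 0)) with hf
  by_cases h4 : f (Sum.inr 1) = 0
  · by_cases h13 : f (Sum.inl 0) ≠ 0 ∨ f (Sum.inr 0) ≠ 0
    · obtain ⟨ε, s, hs, e1, e2, e3, -⟩ :=
        D.exists_frame (f (Sum.inl 0)) (f (Sum.inl 1)) (f (Sum.inr 0)) 0 0 0 h13
      refine fin 1 ε ?_
      simp only [tOneDiag, Sum.forall, Fin.forall_fin_two]
      simp [D.red_natCast, D.red_star]
      refine mulVec_comb hk hk s 0 ?_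
      simp [Sum.forall, Fin.forall_fin_two, e1, e2, e3, h4]
    · push Not at h13
      have h2 : f (Sum.inl 1) ≠ 0 := by
        intro h2
        refine one_ne_zero (hne 1 0 ?_).1
        intro l
        rw [one_mul, zero_mul, add_zero]
        rcases l with l | l <;> fin_cases l
        exacts [h13.1, h2, h13.2, h4]
      refine fin 0 1 ?_
      simp only [tOneDiag, Sum.forall, Fin.forall_fin_two]
      simp [D.red_natCast, D.red_star]
      refine mulVec_comb hk hk (f (Sum.inl 1))⁻¹ 0 ?_
      simp [Sum.forall, Fin.forall_fin_two, ent_one, h2, h4, h13]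
  -- Only the fourth column matters here: it is f scaled to last coordinate 1. The vector (1, 0, 0)
  -- is a dummy for the third column.
  · obtain ⟨ε, s, hs, -, -, -, e1, e2, e3, e4⟩ :=
      D.exists_frame 1 0 0 ((f (Sum.inr 1))⁻¹ * f (Sum.inl 0)) ((f (Sum.inr 1))⁻¹ * f (Sum.inl 1))
        ((f (Sum.inr 1))⁻¹ * f (Sum.inr 0)) (by simp)
    refine fin 2 ε ?_
    simp only [tOneDiag, Sum.forall, Fin.forall_fin_two]
    simp [D.red_natCast, D.red_star]
    refine mulVec_comb hk hk (f (Sum.inr 1))⁻¹ 0 ?_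
    simp [Sum.forall, Fin.forall_fin_two, e1, e2, e3, e4, h4]

/-- The kernel of h modulo ϖ contains the plane spanned by f and g. The four cases are whether this
plane lies in {x₄ = 0} and, accordingly, whether it contains e₂. -/
lemma tTwo_cover {h : IntMat} (hh : DoubleEquiv (diagInt 1 1 p p) h) :
    ∃ i, ∃ δ : ParInt, ∃ γ ∈ unitaryGroupInt,
      h = γ.val * Matrix.diagonal (tTwoDiag p ϖ i) * δ.mat := by
  have hall : ∀ i, DoubleEquiv (Matrix.diagonal (tTwoDiag p ϖ i)) h := fun i =>
    (D.doubleEquiv_tTwoDiag i).symm.trans hh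
  have fin : ∀ (i : Fin 4) (ε : ParInt),
      (∀ j, D.red (tTwoDiag p ϖ i j) = 0 → (h.map D.red) *ᵥ (fun l => D.ent ε l j) = 0) →
      ∃ i, ∃ δ : ParInt, ∃ γ ∈ unitaryGroupInt,
        h = γ.val * Matrix.diagonal (tTwoDiag p ϖ i) * δ.mat := fun i ε hε => by
    obtain ⟨γ, hγ, e⟩ := D.exists_eq_mul_mul (D.tTwoDiag_similar i) (hall i) ε hε
    exact ⟨i, ε⁻¹, γ, hγ, e⟩
  obtain ⟨γ₁, h₁, γ₂, h₂, e⟩ := hh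
  have hf : (h.map D.red) *ᵥ (fun l => D.red ((γ₂⁻¹).val l (Sum.inr 0))) = 0 := by
    rw [e]
    exact D.mulVec_inv_col (by simp [D.red_natCast]) γ₁.val γ₂
  have hg : (h.map D.red) *ᵥ (fun l => D.red ((γ₂⁻¹).val l (Sum.inr 1))) = 0 := by
    rw [e]
    exact D.mulVec_inv_col (by simp [D.red_natCast]) γ₁.val γ₂
  have hne : ∀ a b, (∀ l, a * D.red ((γ₂⁻¹).val l (Sum.inr 0))
    + b * D.red ((γ₂⁻¹).val l (Sum.inr 1)) = 0) → a = 0 ∧ b = 0 :=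
    fun a b h => D.smul_inv_col_eq_zero (by simp) h
  set f : Fin 2 ⊕ Fin 2 → ZMod p := fun l => D.red ((γ₂⁻¹).val l (Sum.inr 0)) with hfdef
  set g : Fin 2 ⊕ Fin 2 → ZMod p := fun l => D.red ((γ₂⁻¹).val l (Sum.inr 1)) with hgdef
  have hne' : ∀ a b, a * f (Sum.inl 0) + b * g (Sum.inl 0) = 0 →
      a * f (Sum.inl 1) + b * g (Sum.inl 1) = 0 → a * f (Sum.inr 0) + b * g (Sum.inr 0) = 0 →
      a * f (Sum.inr 1) + b * g (Sum.inr 1) = 0 → a = 0 ∧ b = 0 := by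
    intro a b e1 e2 e3 e4
    refine hne a b fun l => ?_
    rcases l with l | l <;> fin_cases l
    exacts [e1, e2, e3, e4]
  by_cases h4 : f (Sum.inr 1) ≠ 0 ∨ g (Sum.inr 1) ≠ 0
  · obtain ⟨a, b, hab⟩ : ∃ a b, a * f (Sum.inr 1) + b * g (Sum.inr 1) = 1 := by
      rcases h4 with h4 | h4
      · exact ⟨(f (Sum.inr 1))⁻¹, 0, by simp [h4]⟩
      · exact ⟨0, (g (Sum.inr 1))⁻¹, by simp [h4]⟩
    -- The vector g₄ f - f₄ g spans the intersection of the plane with {x₄ = 0}; the case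
    -- distinction is whether it is a multiple of e₂.
    by_cases hv : g (Sum.inr 1) * f (Sum.inl 0) - f (Sum.inr 1) * g (Sum.inl 0) ≠ 0 ∨
        g (Sum.inr 1) * f (Sum.inr 0) - f (Sum.inr 1) * g (Sum.inr 0) ≠ 0
    · obtain ⟨ε, s, hs, v1, v2, v3, u1, u2, u3, u4⟩ := D.exists_frame _
        (g (Sum.inr 1) * f (Sum.inl 1) - f (Sum.inr 1) * g (Sum.inl 1)) _
        (a * f (Sum.inl 0) + b * g (Sum.inl 0)) (a * f (Sum.inl 1) + b * g (Sum.inl 1))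
        (a * f (Sum.inr 0) + b * g (Sum.inr 0)) hv
      refine fin 3 ε ?_
      simp only [tTwoDiag, Sum.forall, Fin.forall_fin_two]
      simp [D.red_natCast]
      constructor
      · refine mulVec_comb hf hg (s * g (Sum.inr 1)) (-(s * f (Sum.inr 1))) ?_
        simp only [Sum.forall, Fin.forall_fin_two, v1, v2, v3, ent_row2]
        refine ⟨⟨?_, ?_⟩, ?_, ?_⟩ <;> ring
      · refine mulVec_comb hf hg a b ?_
        simp [Sum.forall, Fin.forall_fin_two, u1, u2, u3, u4, hab]
    · push Not at hv
      have hv2 : g (Sum.inr 1) * f (Sum.inl 1) - f (Sum.inr 1) * g (Sum.inl 1) ≠ 0 := by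
        intro hv2
        have := hne' (g (Sum.inr 1)) (-f (Sum.inr 1)) (by linear_combination hv.1)
          (by linear_combination hv2) (by linear_combination hv.2) (by ring)
        rw [neg_eq_zero] at this
        exact h4.elim (fun h => h this.2) (fun h => h this.1)
      obtain ⟨ε, s, hs, -, -, -, u1, u2, u3, u4⟩ := D.exists_frame 1 0 0
        (a * f (Sum.inl 0) + b * g (Sum.inl 0)) (a * f (Sum.inl 1) + b * g (Sum.inl 1))
        (a * f (Sum.inr 0) + b * g (Sum.inr 0)) (by simp)
      refine fin 2 ε ?_
      simp only [tTwoDiag, Sum.forall, Fin.forall_fin_two]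
      simp [D.red_self, D.red_star]
      constructor
      · obtain ⟨κ, hκ⟩ : ∃ κ, κ * (g (Sum.inr 1) * f (Sum.inl 1) - f (Sum.inr 1) * g (Sum.inl 1))
            = D.ent ε (Sum.inl 1) (Sum.inl 1) := ⟨_, div_mul_cancel₀ _ hv2⟩
        refine mulVec_comb hf hg (κ * g (Sum.inr 1)) (-(κ * f (Sum.inr 1))) ?_
        simp only [Sum.forall, Fin.forall_fin_two, ent_row1, ent_col0, ent_col2]
        refine ⟨⟨?_, ?_⟩, ?_, ?_⟩
        · linear_combination -κ * hv.1
        · linear_combination -hκ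
        · linear_combination -κ * hv.2
        · ring
      · refine mulVec_comb hf hg a b ?_
        simp [Sum.forall, Fin.forall_fin_two, u1, u2, u3, u4, hab]
  · push Not at h4
    -- This is the determinant of the projection of the plane to coordinates one and three. Inside
    -- {x₄ = 0} it vanishes exactly when the plane contains e₂.
    by_cases hD : f (Sum.inl 0) * g (Sum.inr 0) - f (Sum.inr 0) * g (Sum.inl 0) = 0
    · have hex : ∃ a b : ZMod p, a * f (Sum.inl 0) + b * g (Sum.inl 0) = 0 ∧
          a * f (Sum.inr 0) + b * g (Sum.inr 0) = 0 ∧ (a ≠ 0 ∨ b ≠ 0) := by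
        by_cases h3 : g (Sum.inr 0) = 0 ∧ f (Sum.inr 0) = 0
        · by_cases h1 : g (Sum.inl 0) = 0
          · exact ⟨0, 1, by simp [h1], by simp [h3], by simp⟩
          · exact ⟨g (Sum.inl 0), -f (Sum.inl 0), by ring, by simp [h3], Or.inl h1⟩
        · refine ⟨g (Sum.inr 0), -f (Sum.inr 0), by linear_combination hD, by ring, ?_⟩
          rw [neg_ne_zero]
          by_contra hcon
          push Not at hcon
          exact h3 hcon
      obtain ⟨a, b, h1, h3, hab⟩ := hex
      have h2 : a * f (Sum.inl 1) + b * g (Sum.inl 1) ≠ 0 := by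
        intro h2
        have := hne' a b h1 h2 h3 (by simp [h4])
        exact hab.elim (fun h => h this.1) (fun h => h this.2)
      have hvex : ∃ c d : ZMod p, c * f (Sum.inl 0) + d * g (Sum.inl 0) ≠ 0 ∨
          c * f (Sum.inr 0) + d * g (Sum.inr 0) ≠ 0 := by
        by_contra hcon
        push Not at hcon
        have hf0 := hcon 1 0
        have hg0 := hcon 0 1
        simp only [one_mul, zero_mul, add_zero, zero_add] at hf0 hg0
        have := hne' (g (Sum.inl 1)) (-f (Sum.inl 1)) (by simp [hf0, hg0]) (by ring)
          (by simp [hf0, hg0]) (by simp [h4])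
        rw [neg_eq_zero] at this
        exact h2 (by rw [this.1, this.2]; ring)
      obtain ⟨c, d, hcd⟩ := hvex
      obtain ⟨ε, s, hs, v1, v2, v3, -⟩ := D.exists_frame _
        (c * f (Sum.inl 1) + d * g (Sum.inl 1)) _ 0 0 0 hcd
      refine fin 0 ε ?_
      simp only [tTwoDiag, Sum.forall, Fin.forall_fin_two]
      simp [D.red_natCast]
      constructor
      · obtain ⟨κ, hκ⟩ : ∃ κ, κ * (a * f (Sum.inl 1) + b * g (Sum.inl 1))
            = D.ent ε (Sum.inl 1) (Sum.inl 1) := ⟨_, div_mul_cancel₀ _ h2⟩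
        refine mulVec_comb hf hg (κ * a) (κ * b) ?_
        simp only [Sum.forall, Fin.forall_fin_two, ent_row1, ent_col0, ent_col2, h4.1, h4.2]
        refine ⟨⟨?_, ?_⟩, ?_, ?_⟩
        · linear_combination -κ * h1
        · linear_combination -hκ
        · linear_combination -κ * h3
        · ring
      · refine mulVec_comb hf hg (s * c) (s * d) ?_
        simp only [Sum.forall, Fin.forall_fin_two, v1, v2, v3, ent_row2, h4.1, h4.2]
        refine ⟨⟨?_, ?_⟩, ?_, ?_⟩ <;> ring
    · obtain ⟨κ, hκ⟩ : ∃ κ, κ * (f (Sum.inl 0) * g (Sum.inr 0) - f (Sum.inr 0) * g (Sum.inl 0))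
          = 1 := ⟨_, inv_mul_cancel₀ hD⟩
      -- The plane is a graph over coordinates one and three; Cramer's rule gives the second
      -- coordinates of its basis vectors over (1, 0) and (0, 1).
      obtain ⟨n, hn⟩ := D.exists_heisenberg
        (κ * (g (Sum.inr 0) * f (Sum.inl 1) - f (Sum.inr 0) * g (Sum.inl 1)))
        (κ * (f (Sum.inl 0) * g (Sum.inl 1) - g (Sum.inl 0) * f (Sum.inl 1))) 0 0 0
      refine fin 1 n ?_
      simp only [tTwoDiag, Sum.forall, Fin.forall_fin_two]
      simp [D.red_self, D.red_star]
      constructor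
      · refine mulVec_comb hf hg (κ * g (Sum.inr 0)) (-(κ * f (Sum.inr 0))) ?_
        simp only [Sum.forall, Fin.forall_fin_two, hn, h4.1, h4.2]
        refine ⟨⟨?_, ?_⟩, ?_, ?_⟩ <;> simp
        · linear_combination -hκ
        · ring
        · ring
      · refine mulVec_comb hf hg (-(κ * g (Sum.inl 0))) (κ * f (Sum.inl 0)) ?_
        simp only [Sum.forall, Fin.forall_fin_two, hn, h4.1, h4.2]
        refine ⟨⟨?_, ?_⟩, ?_, ?_⟩ <;> simp
        · ring
        · ring
        · linear_combination -hκ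

end SplitPrime

/-! ### Integral matrices as complex matrices -/

/-- The complex matrix of an integral matrix. -/
def toMat4 : IntMat →+* Mat4 := GaussianInt.toComplex.mapMatrix

lemma toMat4_apply (M : IntMat) (i j : Fin 2 ⊕ Fin 2) : toMat4 M i j = (M i j : ℂ) := rfl

lemma toMat4_injective : Function.Injective toMat4 := fun M N h => by
  refine Matrix.ext fun i j => ?_
  have := congrFun (congrFun h i) j
  rw [toMat4_apply, toMat4_apply] at this
  exact GaussianInt.toComplex_inj.mp this

lemma toMat4_conjTranspose (M : IntMat) : toMat4 Mᴴ = (toMat4 M)ᴴ := by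
  refine Matrix.ext fun i j => ?_
  rw [toMat4_apply, Matrix.conjTranspose_apply, Matrix.conjTranspose_apply, toMat4_apply,
    GaussianInt.toComplex_star]
  rfl

lemma toMat4_J : toMat4 (Matrix.J (Fin 2) GaussianInt) = Matrix.J (Fin 2) ℂ := by
  refine Matrix.ext fun i j => ?_
  rw [toMat4_apply]
  rcases i with i | i <;> rcases j with j | j <;> simp [Matrix.J, Matrix.one_apply]

lemma toMat4_diagonal (x : Fin 2 ⊕ Fin 2 → GaussianInt) :
    toMat4 (Matrix.diagonal x) = Matrix.diagonal fun i => (x i : ℂ) := by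
  refine Matrix.ext fun i j => ?_
  rw [toMat4_apply, Matrix.diagonal_apply, Matrix.diagonal_apply]
  split_ifs <;> simp

lemma toMat4_diagInt (a b c d : GaussianInt) : toMat4 (diagInt a b c d) = diag4 a b c d := by
  rw [diagInt, toMat4_diagonal, diag4]
  congr 1
  funext i
  rcases i with i | i <;> fin_cases i <;> rfl

lemma isSimilitude_of_int {M : IntMat} {n : ℕ} (hn : 0 < n)
    (h : Mᴴ * Matrix.J (Fin 2) GaussianInt * M = (n : GaussianInt) • Matrix.J (Fin 2) GaussianInt) :
    IsSimilitude (toMat4 M) := by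
  refine ⟨n, by exact_mod_cast hn, ?_⟩
  rw [← toMat4_conjTranspose, ← toMat4_J, ← map_mul, ← map_mul, h]
  refine Matrix.ext fun i j => ?_
  simp [toMat4_apply]

lemma isSimilitude_unitary {γ : GL (Fin 2 ⊕ Fin 2) GaussianInt} (h : γ ∈ unitaryGroupInt) :
    IsSimilitude (toMat4 γ.val) :=
  isSimilitude_of_int (n := 1) one_pos (by rw [mem_unitaryGroupInt.mp h]; simp)

lemma isSimilitude_diagonal {p : ℕ} (hp : 0 < p) {x : Fin 2 ⊕ Fin 2 → GaussianInt}
    (hx : ∀ i, star (x i) * x i.swap = p) : IsSimilitude (toMat4 (Matrix.diagonal x)) :=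
  isSimilitude_of_int hp (conjTranspose_diagonal_mul_J_mul hx)

lemma ParInt.isSimilitude (γ : ParInt) : IsSimilitude (toMat4 γ.mat) := isSimilitude_unitary γ.2.1

/-- The parabolic group acting on functions on the upper Hermitian plane from the left. -/
def parRep (k : ℤ) : ParInt →* Module.End ℂ PlaneFun where
  toFun γ := slashMap k (toMat4 (γ⁻¹).mat)
  map_one' := by
    ext f Z
    have h1 : toMat4 ((1 : ParInt)⁻¹).mat = (1 : ℂ) • 1 := by simp [ParInt.mat_one]
    rw [h1, slashMap_scalar k one_ne_zero]
    simp
  map_mul' γ δ := by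
    refine LinearMap.ext fun f => ?_
    rw [mul_inv_rev, ParInt.mat_mul, map_mul, slashMap_mul k (δ⁻¹).isSimilitude
      (γ⁻¹).isSimilitude]
    rfl

lemma parRep_apply (k : ℤ) (γ : ParInt) (f : PlaneFun) :
    parRep k γ f = slashMap k (toMat4 (γ⁻¹).mat) f := rfl

/-- `f` is invariant under the slash operator of an integral group. -/
def IsInvariant (k : ℤ) (Γ : Subgroup (GL (Fin 2 ⊕ Fin 2) GaussianInt)) (f : PlaneFun) : Prop :=
  ∀ γ ∈ Γ, slashMap k (toMat4 γ.val) f = f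

lemma IsInvariant.mono {k : ℤ} {Γ Γ' : Subgroup (GL (Fin 2 ⊕ Fin 2) GaussianInt)} {f : PlaneFun}
    (h : IsInvariant k Γ f) (hle : Γ' ≤ Γ) : IsInvariant k Γ' f := fun γ hγ => h γ (hle hγ)

lemma parabolic_le_unitary : parabolicGroupInt ≤ unitaryGroupInt := fun _ h => h.1

lemma slashMap_mul_of_invariant {k : ℤ} {Γ : Subgroup (GL (Fin 2 ⊕ Fin 2) GaussianInt)}
    (hΓ : Γ ≤ unitaryGroupInt) {f : PlaneFun} (hf : IsInvariant k Γ f)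
    {γ : GL (Fin 2 ⊕ Fin 2) GaussianInt} (hγ : γ ∈ Γ) {g : Mat4} (hg : IsSimilitude g) :
    slashMap k (toMat4 γ.val * g) f = slashMap k g f := by
  rw [slashMap_mul k (isSimilitude_unitary (hΓ hγ)) hg, hf γ hγ]

/-- An element fixing the coset Γx fixes f|x, since f is Γ-invariant. The inclusion may be strict,
which is why averages are allowed over smaller groups. -/
lemma le_vecStab {k : ℤ} {Γ : Subgroup (GL (Fin 2 ⊕ Fin 2) GaussianInt)}
    (hΓ : Γ ≤ unitaryGroupInt) {f : PlaneFun} (hf : IsInvariant k Γ f) {x : IntMat}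
    (hx : IsSimilitude (toMat4 x)) {K : Subgroup ParInt}
    (hK : ∀ δ, δ ∈ K → ∃ γ ∈ Γ, x * δ.mat = γ.val * x) :
    K ≤ vecStab (parRep k) (slashMap k (toMat4 x) f) := by
  intro δ hδ
  obtain ⟨γ, hγ, h⟩ := hK _ (inv_mem hδ)
  rw [mem_vecStab, parRep_apply, ← slashMap_mul k hx (δ⁻¹).isSimilitude,
    ← map_mul, h, map_mul, slashMap_mul_of_invariant hΓ hf hγ hx]

/-! ### Hecke operators as sums of orbit averages -/

/-- The complex points of an integral group. -/
abbrev complexGroup (Γ : Subgroup (GL (Fin 2 ⊕ Fin 2) GaussianInt)) :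
    Subgroup (GL (Fin 2 ⊕ Fin 2) ℂ) :=
  Γ.map (Matrix.GeneralLinearGroup.map GaussianInt.toComplex)

lemma mk_toMat4_eq_iff {Γ : Subgroup (GL (Fin 2 ⊕ Fin 2) GaussianInt)} {x y : IntMat} :
    (Quotient.mk _ (toMat4 x) : MulAction.orbitRel.Quotient (complexGroup Γ) Mat4)
      = Quotient.mk _ (toMat4 y) ↔ ∃ γ ∈ Γ, x = γ.val * y := by
  rw [Quotient.eq]
  constructor
  · rintro ⟨⟨_, γ, hγ, rfl⟩, h⟩
    refine ⟨γ, hγ, toMat4_injective ?_⟩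
    rw [map_mul]
    exact h.symm
  · rintro ⟨γ, hγ, rfl⟩
    refine ⟨⟨_, γ, hγ, rfl⟩, ?_⟩
    simp only [map_mul]
    rfl

lemma exists_out_eq {Γ : Subgroup (GL (Fin 2 ⊕ Fin 2) GaussianInt)} (x : IntMat) :
    ∃ γ ∈ Γ, Quotient.out (Quotient.mk _ (toMat4 x) :
      MulAction.orbitRel.Quotient (complexGroup Γ) Mat4) = toMat4 (γ.val * x) := by
  obtain ⟨⟨_, γ, hγ, rfl⟩, h⟩ := Quotient.mk_out (s := MulAction.orbitRel (complexGroup Γ) Mat4)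
    (toMat4 x)
  refine ⟨γ, hγ, ?_⟩
  rw [map_mul]
  exact h.symm

lemma mem_leftCosets_iff {Γ : Subgroup (GL (Fin 2 ⊕ Fin 2) GaussianInt)} {g : IntMat}
    {c : MulAction.orbitRel.Quotient (complexGroup Γ) Mat4} :
    c ∈ leftCosets (complexGroup Γ) (toMat4 g) ↔
      ∃ γ ∈ Γ, c = Quotient.mk _ (toMat4 (g * γ.val)) := by
  constructor
  · rintro ⟨_, ⟨γ₁, h₁, rfl⟩, _, ⟨γ₂, h₂, rfl⟩, rfl⟩
    refine ⟨γ₂, h₂, ?_⟩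
    have : ((Matrix.GeneralLinearGroup.map GaussianInt.toComplex γ₁).val * toMat4 g *
        (Matrix.GeneralLinearGroup.map GaussianInt.toComplex γ₂).val)
        = toMat4 (γ₁.val * (g * γ₂.val)) := by
      rw [← mul_assoc, map_mul, map_mul]
      rfl
    rw [this]
    exact mk_toMat4_eq_iff.mpr ⟨γ₁, h₁, rfl⟩
  · rintro ⟨γ, hγ, rfl⟩
    refine ⟨1, one_mem _, _, ⟨γ, hγ, rfl⟩, ?_⟩
    rw [map_mul, Units.val_one, one_mul]
    rfl

/-- The left cosets in ΓgΓ form a right Γ_{1,1}-set, and the orbit of Γx i is K i \ Γ_{1,1}.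
Inverses of representatives convert this into the left cosets Γ_{1,1} / K i. -/
lemma bijOn_leftCosets {Γ : Subgroup (GL (Fin 2 ⊕ Fin 2) GaussianInt)}
    (hΓ' : parabolicGroupInt ≤ Γ) {ι : Type*} (x : ι → IntMat) (g : IntMat)
    (K : ι → Subgroup ParInt) (hK : ∀ i δ, δ ∈ K i ↔ ∃ γ ∈ Γ, x i * δ.mat = γ.val * x i)
    (hmem : ∀ i, ∃ γ₁ ∈ Γ, ∃ γ₂ ∈ Γ, x i = γ₁.val * g * γ₂.val)
    (hcov : ∀ γ ∈ Γ, ∃ i, ∃ δ : ParInt, ∃ γ' ∈ Γ, g * γ.val = γ'.val * x i * δ.mat)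
    (hdis : ∀ i j, ∀ δ δ' : ParInt, ∀ γ ∈ Γ, x i * δ.mat = γ.val * x j * δ'.mat → i = j) :
    Set.BijOn (fun q : Σ i, ParInt ⧸ K i => (Quotient.mk _ (toMat4 (x q.1 * (q.2.out⁻¹).mat)) :
      MulAction.orbitRel.Quotient (complexGroup Γ) Mat4)) Set.univ
      (leftCosets (complexGroup Γ) (toMat4 g)) := by
  refine ⟨?_, ?_, ?_⟩
  · rintro ⟨i, q⟩ -
    rw [mem_leftCosets_iff]
    obtain ⟨γ₁, h₁, γ₂, h₂, e⟩ := hmem i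
    refine ⟨γ₂ * (q.out⁻¹).1, mul_mem h₂ (hΓ' (q.out⁻¹).2), ?_⟩
    refine mk_toMat4_eq_iff.mpr ⟨γ₁, h₁, ?_⟩
    change x i * (q.out⁻¹).mat = _
    rw [e, Units.val_mul]
    simp only [Matrix.mul_assoc]
    rfl
  · rintro ⟨i, q⟩ - ⟨j, r⟩ - h
    obtain ⟨γ, hγ, e⟩ := mk_toMat4_eq_iff.mp h
    change x i * (q.out⁻¹).mat = γ.val * (x j * (r.out⁻¹).mat) at e
    rw [← Matrix.mul_assoc] at e
    obtain rfl := hdis _ _ _ _ _ hγ e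
    congr 1
    rw [← QuotientGroup.out_eq' q, ← QuotientGroup.out_eq' r, QuotientGroup.eq, hK]
    refine ⟨γ, hγ, ?_⟩
    rw [ParInt.mat_mul, ← Matrix.mul_assoc, e, Matrix.mul_assoc, ParInt.mat_inv_mul,
      Matrix.mul_one]
  · intro c hc
    obtain ⟨γ, hγ, rfl⟩ := mem_leftCosets_iff.mp hc
    obtain ⟨i, δ, γ', hγ', e⟩ := hcov γ hγ
    refine ⟨⟨i, ((δ⁻¹ : ParInt) : ParInt ⧸ K i)⟩, trivial, ?_⟩
    obtain ⟨κ, hκ⟩ := QuotientGroup.mk_out_eq_mul (K i) δ⁻¹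
    obtain ⟨γ'', hγ'', e2⟩ := (hK i _).mp (inv_mem κ.2)
    refine mk_toMat4_eq_iff.mpr ⟨γ'' * γ'⁻¹, mul_mem hγ'' (inv_mem hγ'), ?_⟩
    change x i * ((((δ⁻¹ : ParInt) : ParInt ⧸ K i)).out⁻¹).mat = _
    have e3 : (γ'⁻¹).val * γ'.val = 1 := by rw [← Units.val_mul]; simp
    rw [hκ, mul_inv_rev, inv_inv, ParInt.mat_mul, ← Matrix.mul_assoc, e2, e, Units.val_mul]
    calc _ = γ''.val * ((γ'⁻¹).val * γ'.val) * x i * δ.mat := by rw [e3, Matrix.mul_one]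
      _ = _ := by simp only [Matrix.mul_assoc]

/-- Invariance of F makes the chosen coset representatives irrelevant, so the Hecke sum may be
grouped by Γ_{1,1}-orbits, each contributing its size times an average. It is used with Γ = Γ₂ and
with Γ = Γ_{1,1}. -/
lemma hecke_eq_sum (k : ℤ) {Γ : Subgroup (GL (Fin 2 ⊕ Fin 2) GaussianInt)}
    (hΓ : Γ ≤ unitaryGroupInt) (hΓ' : parabolicGroupInt ≤ Γ) {F : Mat2 → ℂ}
    (hF : IsInvariant k Γ (restrict F)) {ι : Type*} [Fintype ι] (x : ι → IntMat)
    (hx : ∀ i, IsSimilitude (toMat4 (x i))) (g : IntMat) (K : ι → Subgroup ParInt)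
    (hKfin : ∀ i, (K i).FiniteIndex)
    (hK : ∀ i δ, δ ∈ K i ↔ ∃ γ ∈ Γ, x i * δ.mat = γ.val * x i)
    (hmem : ∀ i, ∃ γ₁ ∈ Γ, ∃ γ₂ ∈ Γ, x i = γ₁.val * g * γ₂.val)
    (hcov : ∀ γ ∈ Γ, ∃ i, ∃ δ : ParInt, ∃ γ' ∈ Γ, g * γ.val = γ'.val * x i * δ.mat)
    (hdis : ∀ i j, ∀ δ δ' : ParInt, ∀ γ ∈ Γ, x i * δ.mat = γ.val * x j * δ'.mat → i = j) (Z : H2) :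
    hecke k (complexGroup Γ) (toMat4 g) F Z =
      (∑ i, ((K i).index : ℂ) • orbitAvg (parRep k) (slashMap k (toMat4 (x i)) (restrict F))) Z := by
  classical
  have hfin := hKfin
  let _ : ∀ i, Fintype (ParInt ⧸ K i) := fun i => Subgroup.fintypeQuotientOfFiniteIndex
  let B : (Σ i, ParInt ⧸ K i) → MulAction.orbitRel.Quotient (complexGroup Γ) Mat4 :=
    fun q => Quotient.mk _ (toMat4 (x q.1 * (q.2.out⁻¹).mat))
  have hB : Set.BijOn B Set.univ (leftCosets (complexGroup Γ) (toMat4 g)) :=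
    bijOn_leftCosets hΓ' x g K hK hmem hcov hdis
  have hval : ∀ q ∈ Set.univ, (fun q : Σ i, ParInt ⧸ K i => (parRep k q.2.out
      (slashMap k (toMat4 (x q.1)) (restrict F))) Z) q = slash k (Quotient.out (B q)) F Z := by
    rintro ⟨i, q⟩ -
    obtain ⟨γ, hγ, e⟩ := exists_out_eq (Γ := Γ) (x i * (q.out⁻¹).mat)
    have hs : IsSimilitude (toMat4 (x i * (q.out⁻¹).mat)) := by
      rw [map_mul]; exact (hx i).mul (q.out⁻¹).isSimilitude
    simp only [B]
    rw [e, map_mul, ← slashMap_restrict k ((isSimilitude_unitary (hΓ hγ)).mul hs),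
      slashMap_mul_of_invariant hΓ hF hγ hs, map_mul,
      slashMap_mul k (hx i) (q.out⁻¹).isSimilitude]
    rfl
  have hsum : hecke k (complexGroup Γ) (toMat4 g) F Z =
      ∑ᶠ c ∈ leftCosets (complexGroup Γ) (toMat4 g), slash k (Quotient.out c) F Z := rfl
  rw [hsum, ← finsum_mem_eq_of_bijOn B hB hval, finsum_mem_univ, finsum_eq_sum_of_fintype,
    Fintype.sum_sigma, Finset.sum_apply]
  refine Finset.sum_congr rfl fun i _ => ?_
  rw [← sum_quotient_eq (parRep k) (K i) (le_vecStab hΓ hF (hx i) fun δ hδ => (hK i δ).mp hδ),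
    finsum_eq_sum_of_fintype, Finset.sum_apply]

/-! ### Powers of the element of `Λ₊` -/

lemma diagInt_mul (a b c d a' b' c' d' : GaussianInt) :
    diagInt a b c d * diagInt a' b' c' d' = diagInt (a * a') (b * b') (c * c') (d * d') := by
  rw [diagInt, diagInt, diagInt, Matrix.diagonal_mul_diagonal]
  congr 1
  funext i
  rcases i with i | i <;> fin_cases i <;> rfl

lemma smul_diagInt (s a b c d : GaussianInt) :
    s • diagInt a b c d = diagInt (s * a) (s * b) (s * c) (s * d) := by
  rw [diagInt, diagInt, ← Matrix.diagonal_smul]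
  congr 1
  funext i
  rcases i with i | i <;> fin_cases i <;> rfl

lemma one_eq_diagInt : (1 : IntMat) = diagInt 1 1 1 1 := by
  rw [diagInt, ← Matrix.diagonal_one]
  congr 1
  funext i
  rcases i with i | i <;> fin_cases i <;> rfl

lemma isSimilitude_diagInt {n : ℕ} (hn : 0 < n) {a b c d : GaussianInt} (h1 : star a * c = n)
    (h2 : star b * d = n) : IsSimilitude (toMat4 (diagInt a b c d)) :=
  isSimilitude_diagonal hn fun i => star_mul_swap_eq h1 h2 i

/-- `diag(ϖ', 1, ϖ', p)ʲ`, where `ϖ'` is the conjugate of `ϖ`. -/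
def plusPow (p : ℕ) (ϖ : GaussianInt) (j : ℕ) : IntMat :=
  diagInt (star ϖ ^ j) 1 (star ϖ ^ j) (p ^ j)

lemma plusPow_zero (p : ℕ) (ϖ : GaussianInt) : plusPow p ϖ 0 = 1 := by
  simp [plusPow, one_eq_diagInt]

lemma plusPow_one (p : ℕ) (ϖ : GaussianInt) :
    plusPow p ϖ 1 = diagInt (star ϖ) 1 (star ϖ) p := by
  simp [plusPow]

lemma plusPow_succ (p : ℕ) (ϖ : GaussianInt) (j : ℕ) :
    plusPow p ϖ (j + 1) = plusPow p ϖ 1 * plusPow p ϖ j := by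
  rw [plusPow, plusPow, plusPow, diagInt_mul]
  congr 1 <;> ring

namespace SplitPrime

variable {p : ℕ} [Fact p.Prime] {ϖ : GaussianInt} (D : SplitPrime p ϖ)
include D

lemma self_ne_zero : ϖ ≠ 0 := fun h => by
  have := D.mul_star
  rw [h, zero_mul] at this
  exact natCast_ne_zero (p := p) this.symm

omit [Fact p.Prime] in
lemma plusPow_similar (j : ℕ) : star (star ϖ ^ j) * star ϖ ^ j = ((p ^ j : ℕ) : GaussianInt) := by
  rw [star_pow, star_star, ← mul_pow, D.mul_star, Nat.cast_pow]

lemma isSimilitude_plusPow (j : ℕ) : IsSimilitude (toMat4 (plusPow p ϖ j)) :=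
  isSimilitude_diagInt (pow_pos (Fact.out : p.Prime).pos j) (D.plusPow_similar j) (by simp)

lemma plusPow_mul_left_cancel {j : ℕ} {M N : IntMat}
    (h : plusPow p ϖ j * M = plusPow p ϖ j * N) : M = N := by
  refine Matrix.ext fun a b => ?_
  have h1 := congrFun (congrFun h a) b
  rw [plusPow, diagInt, Matrix.diagonal_mul, Matrix.diagonal_mul] at h1
  have hp0 : (p : GaussianInt) ≠ 0 := natCast_ne_zero
  have hs : star ϖ ≠ 0 := star_ne_zero.mpr D.self_ne_zero
  refine mul_left_cancel₀ ?_ h1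
  rcases a with a | a <;> fin_cases a <;> simp [hp0, D.self_ne_zero]

lemma plusPow_mul_right_cancel {j : ℕ} {M N : IntMat}
    (h : M * plusPow p ϖ j = N * plusPow p ϖ j) : M = N := by
  refine Matrix.ext fun a b => ?_
  have h1 := congrFun (congrFun h a) b
  rw [plusPow, diagInt, Matrix.mul_diagonal, Matrix.mul_diagonal] at h1
  have hp0 : (p : GaussianInt) ≠ 0 := natCast_ne_zero
  refine mul_right_cancel₀ ?_ h1
  rcases b with b | b <;> fin_cases b <;> simp [hp0, D.self_ne_zero]

lemma exists_shift (γ : ParInt) :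
    ∃ δ : ParInt, γ.mat * plusPow p ϖ 1 = plusPow p ϖ 1 * δ.mat := by
  -- The entries are the ratios d_j / d_i for d = diag(ϖ', 1, ϖ', p). Non-integral ratios occur only
  -- where γ vanishes, and are replaced by 1.
  let s : IntMat := Matrix.fromBlocks !![1, 1; star ϖ, 1] !![1, ϖ; star ϖ, p]
    !![1, 1; 1, 1] !![1, ϖ; 1, 1]
  let M : IntMat := Matrix.of fun i j => γ.mat i j * s i j
  have hM : γ.mat * plusPow p ϖ 1 = plusPow p ϖ 1 * M := by
    refine Matrix.ext fun i j => ?_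
    rw [plusPow_one, diagInt, Matrix.mul_diagonal, Matrix.diagonal_mul]
    have h1 := γ.second_col (i := Sum.inl 0) (by simp)
    have h2 := γ.second_col (i := Sum.inr 0) (by simp)
    have h3 := γ.second_col (i := Sum.inr 1) (by simp)
    have h4 := γ.last_row (j := Sum.inl 0) (by simp)
    have h5 := γ.last_row (j := Sum.inr 0) (by simp)
    have e := D.mul_star
    rcases i with i | i <;> rcases j with j | j <;> fin_cases i <;> fin_cases j <;>
      simp [M, s, h1, h2, h3, h4, h5] <;> first | (rw [← e]; ring1) | ring1
  have hx : ∀ i, star ((Sum.elim ![star ϖ, 1] ![star ϖ, (p : GaussianInt)] :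
      Fin 2 ⊕ Fin 2 → GaussianInt) i) * (Sum.elim ![star ϖ, 1] ![star ϖ, (p : GaussianInt)] :
      Fin 2 ⊕ Fin 2 → GaussianInt) i.swap = p :=
    star_mul_swap_eq (by rw [star_star, D.mul_star]) (by simp)
  have hJ := conjTranspose_diagonal_mul_J_mul hx
  rw [← diagInt, ← plusPow_one] at hJ
  have h1 : (p : GaussianInt) • (Mᴴ * Matrix.J (Fin 2) GaussianInt * M)
      = (p : GaussianInt) • Matrix.J (Fin 2) GaussianInt := by
    calc _ = Mᴴ * ((p : GaussianInt) • Matrix.J (Fin 2) GaussianInt) * M := by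
          rw [Matrix.mul_smul, Matrix.smul_mul]
      _ = (plusPow p ϖ 1 * M)ᴴ * Matrix.J (Fin 2) GaussianInt * (plusPow p ϖ 1 * M) := by
          rw [← hJ]; simp only [Matrix.conjTranspose_mul, Matrix.mul_assoc]
      _ = (plusPow p ϖ 1)ᴴ * (γ.matᴴ * Matrix.J (Fin 2) GaussianInt * γ.mat)
          * plusPow p ϖ 1 := by
          rw [← hM]; simp only [Matrix.conjTranspose_mul, Matrix.mul_assoc]
      _ = _ := by rw [γ.unitary, hJ]
  refine ⟨ParInt.mk M (smul_right_injective _ natCast_ne_zero h1) fun j hj => ?_, hM⟩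
  simp [M, γ.last_row hj]

omit D
/-- Conjugation by the element of `Λ₊`. -/
def shift (D : SplitPrime p ϖ) : ParInt →* ParInt where
  toFun γ := (D.exists_shift γ).choose
  map_one' := by
    refine ParInt.mat_injective (D.plusPow_mul_left_cancel (j := 1) ?_)
    rw [← (D.exists_shift 1).choose_spec, ParInt.mat_one, one_mul, mul_one]
  map_mul' γ δ := by
    refine ParInt.mat_injective (D.plusPow_mul_left_cancel (j := 1) ?_)
    rw [← (D.exists_shift (γ * δ)).choose_spec, ParInt.mat_mul, ParInt.mat_mul,
      ← Matrix.mul_assoc, ← (D.exists_shift γ).choose_spec, Matrix.mul_assoc, Matrix.mul_assoc]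
    exact congrArg _ (D.exists_shift δ).choose_spec

/-- Conjugation by a power of the element of `Λ₊`. -/
def shiftPow (D : SplitPrime p ϖ) : ℕ → ParInt →* ParInt
  | 0 => MonoidHom.id ParInt
  | j + 1 => D.shift.comp (D.shiftPow j)

include D

lemma mat_mul_plusPow (j : ℕ) (γ : ParInt) :
    γ.mat * plusPow p ϖ j = plusPow p ϖ j * (D.shiftPow j γ).mat := by
  induction j with
  | zero => simp [plusPow_zero, shiftPow]
  | succ j ih =>
    have hc : plusPow p ϖ 1 * plusPow p ϖ j = plusPow p ϖ j * plusPow p ϖ 1 := by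
      rw [plusPow, plusPow, diagInt_mul, diagInt_mul]
      congr 1 <;> ring
    rw [plusPow_succ, hc, ← Matrix.mul_assoc, ih, Matrix.mul_assoc, Matrix.mul_assoc]
    congr 1
    exact (D.exists_shift _).choose_spec

lemma shiftPow_injective (j : ℕ) : Function.Injective (D.shiftPow j) := by
  intro γ δ h
  refine ParInt.mat_injective (D.plusPow_mul_right_cancel (j := j) ?_)
  rw [D.mat_mul_plusPow, D.mat_mul_plusPow, h]

/-- An element γ with dʲ δ = γ dʲ automatically has last row (0, 0, 0, *), so δ is the conjugate of
a parabolic element. -/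
lemma range_shiftPow (j : ℕ) : (D.shiftPow j).range = cosetStab (plusPow p ϖ j) := by
  refine le_antisymm ?_ fun δ hδ => ?_
  · rintro _ ⟨γ, rfl⟩
    exact ⟨γ.1, γ.2.1, (D.mat_mul_plusPow j γ).symm⟩
  · obtain ⟨γ, hγ, h⟩ := hδ
    have hpar : γ ∈ parabolicGroupInt := by
      refine ⟨hγ, fun i hi => ?_⟩
      have h1 := congrFun (congrFun h (Sum.inr 1)) i
      have hp0 : (p : GaussianInt) ≠ 0 := natCast_ne_zero
      rw [plusPow, diagInt, Matrix.diagonal_mul, Matrix.mul_diagonal, δ.last_row hi,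
        mul_zero] at h1
      refine (mul_eq_zero.mp h1.symm).resolve_right ?_
      rcases i with i | i <;> fin_cases i <;> simp [hp0, D.self_ne_zero]
    refine ⟨⟨γ, hpar⟩, ParInt.mat_injective (D.plusPow_mul_left_cancel (j := j) ?_)⟩
    rw [← D.mat_mul_plusPow, h]
    rfl

/-- Conjugation is injective with image of index p³, so each step multiplies indices by p³. This
gives both the index of the coset stabilizer of dʲ and the finiteness of orbits after slashing by
dʲ. -/
lemma index_map_shiftPow (j : ℕ) (K : Subgroup ParInt) :
    (K.map (D.shiftPow j)).index = K.index * p ^ (3 * j) := by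
  have h1 : D.shiftPow 1 = D.shift := rfl
  induction j generalizing K with
  | zero => simp [shiftPow, Subgroup.map_id]
  | succ j ih =>
    rw [shiftPow, ← Subgroup.map_map, Subgroup.index_map_of_injective _ (h1 ▸ D.shiftPow_injective 1), ih,
      ← h1, D.range_shiftPow, plusPow_one, D.index_lambdaPlus]
    ring

lemma index_plusPow (j : ℕ) : (cosetStab (plusPow p ϖ j)).index = p ^ (3 * j) := by
  rw [← D.range_shiftPow, MonoidHom.range_eq_map, D.index_map_shiftPow, Subgroup.index_top,
    one_mul]

lemma parRep_plusPow (k : ℤ) (j : ℕ) (γ : ParInt) (f : PlaneFun) :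
    slashMap k (toMat4 (plusPow p ϖ j)) (parRep k γ f)
      = parRep k (D.shiftPow j γ) (slashMap k (toMat4 (plusPow p ϖ j)) f) := by
  have hs := D.isSimilitude_plusPow j
  rw [parRep_apply, parRep_apply, ← slashMap_mul k (γ⁻¹).isSimilitude hs, ← map_inv,
    ← slashMap_mul k hs (D.shiftPow j γ⁻¹).isSimilitude, ← map_mul, ← map_mul,
    D.mat_mul_plusPow]

lemma hasFiniteOrbit_plusPow (k : ℤ) (j : ℕ) {f : PlaneFun} (hf : HasFiniteOrbit (parRep k) f) :
    HasFiniteOrbit (parRep k) (slashMap k (toMat4 (plusPow p ϖ j)) f) := by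
  have hfin : (vecStab (parRep k) f).FiniteIndex := hf
  have : ((vecStab (parRep k) f).map (D.shiftPow j)).FiniteIndex := by
    refine ⟨?_⟩
    rw [D.index_map_shiftPow]
    exact mul_ne_zero hfin.index_ne_zero (pow_ne_zero _ (Fact.out : p.Prime).ne_zero)
  refine HasFiniteOrbit.of_le (parRep k) (K := (vecStab (parRep k) f).map (D.shiftPow j)) ?_
  rintro _ ⟨γ, hγ, rfl⟩
  rw [mem_vecStab, ← D.parRep_plusPow, (mem_vecStab _).mp hγ]

/-- Slash an eigenvalue relation by dʲ and average: the inner averages are absorbed because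
conjugation by dʲ maps Γ_{1,1} into itself. -/
lemma orbitAvg_plusPow_sum (k : ℤ) (j : ℕ) {ι : Type*} [Fintype ι] (n : ι → ℂ) (v : ι → PlaneFun)
    (hv : ∀ i, HasFiniteOrbit (parRep k) (v i)) {a : ℂ} {f : PlaneFun}
    (hf : HasFiniteOrbit (parRep k) f) (h : a • f = ∑ i, n i • orbitAvg (parRep k) (v i)) :
    a • orbitAvg (parRep k) (slashMap k (toMat4 (plusPow p ϖ j)) f)
      = ∑ i, n i • orbitAvg (parRep k) (slashMap k (toMat4 (plusPow p ϖ j)) (v i)) := by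
  have hL := fun γ => (⟨D.shiftPow j γ, D.parRep_plusPow k j γ⟩ :
    ∃ γ', ∀ v, slashMap k (toMat4 (plusPow p ϖ j)) (parRep k γ v)
      = parRep k γ' (slashMap k (toMat4 (plusPow p ϖ j)) v))
  have havg : ∀ i, HasFiniteOrbit (parRep k) (orbitAvg (parRep k) (v i)) := fun i =>
    HasFiniteOrbit.of_fixed _ (apply_orbitAvg _ (hv i))
  rw [← orbitAvg_smul _ a (D.hasFiniteOrbit_plusPow k j hf), ← map_smul, h, map_sum,
    orbitAvg_sum _ _ fun i _ => by
      rw [map_smul]; exact (D.hasFiniteOrbit_plusPow k j (havg i)).smul _ _]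
  refine Finset.sum_congr rfl fun i _ => ?_
  rw [map_smul, orbitAvg_smul _ _ (D.hasFiniteOrbit_plusPow k j (havg i)),
    orbitAvg_comp_orbitAvg _ _ hL (hv i) (D.hasFiniteOrbit_plusPow k j (hv i))]

end SplitPrime

/-! ### Hecke operators of the two groups on functions on the upper Hermitian plane -/

/-- The double coset of `x` with respect to the integral parabolic group, acting on functions. -/
def heckePar (k : ℤ) (x : IntMat) (f : PlaneFun) : PlaneFun :=
  ((cosetStab x).index : ℂ) • orbitAvg (parRep k) (slashMap k (toMat4 x) f)

lemma hasFiniteOrbit_slashMap {k : ℤ} {f : PlaneFun} (hf : IsInvariant k unitaryGroupInt f)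
    {x : IntMat} (hx : IsSimilitude (toMat4 x)) (hfin : (cosetStab x).index ≠ 0) :
    HasFiniteOrbit (parRep k) (slashMap k (toMat4 x) f) := by
  have : (cosetStab x).FiniteIndex := ⟨hfin⟩
  exact HasFiniteOrbit.of_le _ (K := cosetStab x) (le_vecStab le_rfl hf hx fun δ hδ => hδ)

/-- For a diagonal matrix the Γ₂- and Γ_{1,1}-cosets have the same stabilizer, so one index serves
the operators of both groups. -/
lemma mem_cosetStab_iff_parabolic {y : Fin 2 ⊕ Fin 2 → GaussianInt} (hy : ∀ i, y i ≠ 0)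
    {δ : ParInt} : δ ∈ cosetStab (Matrix.diagonal y) ↔
      ∃ γ ∈ parabolicGroupInt, Matrix.diagonal y * δ.mat = γ.val * Matrix.diagonal y := by
  refine ⟨?_, fun ⟨γ, hγ, h⟩ => ⟨γ, hγ.1, h⟩⟩
  rintro ⟨γ, hγ, h⟩
  refine ⟨γ, ⟨hγ, fun j hj => ?_⟩, h⟩
  have h1 := congrFun (congrFun h (Sum.inr 1)) j
  rw [Matrix.diagonal_mul, Matrix.mul_diagonal, δ.last_row hj, mul_zero] at h1
  exact (mul_eq_zero.mp h1.symm).resolve_right (hy j)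

lemma hecke_parabolic {k : ℤ} {F : Mat2 → ℂ} (hF : IsInvariant k parabolicGroupInt (restrict F))
    {y : Fin 2 ⊕ Fin 2 → GaussianInt} (hy : ∀ i, y i ≠ 0)
    (hs : IsSimilitude (toMat4 (Matrix.diagonal y)))
    (hfin : (cosetStab (Matrix.diagonal y)).index ≠ 0) (Z : H2) :
    hecke k Gamma11 (toMat4 (Matrix.diagonal y)) F Z
      = heckePar k (Matrix.diagonal y) (restrict F) Z := by
  have h := hecke_eq_sum k (Γ := parabolicGroupInt) parabolic_le_unitary le_rfl hF
    (ι := Unit) (fun _ => Matrix.diagonal y) (fun _ => hs) (Matrix.diagonal y)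
    (fun _ => cosetStab (Matrix.diagonal y)) (fun _ => ⟨hfin⟩)
    (fun _ δ => mem_cosetStab_iff_parabolic hy)
    (fun _ => ⟨1, one_mem _, 1, one_mem _, by simp⟩)
    (fun γ hγ => ⟨(), ⟨γ, hγ⟩, 1, one_mem _, by simp [ParInt.mat]⟩) (fun _ _ _ _ _ _ _ => rfl) Z
  rw [Fintype.sum_unique] at h
  exact h

/-- The scalar by which `diag(s, s, s, s)` acts in weight `k`. -/
def scalarFactor (k : ℤ) (s : GaussianInt) : ℂ :=
  ((s : ℂ) * star (s : ℂ)) ^ (2 * k - 4) * ((s : ℂ) ^ 2) ^ (-k)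

lemma slashMap_smul_int (k : ℤ) {s : GaussianInt} (hs : s ≠ 0) {M : IntMat}
    (hM : IsSimilitude (toMat4 M)) (f : PlaneFun) :
    slashMap k (toMat4 (s • M)) f
      = scalarFactor k s • slashMap k (toMat4 M) f := by
  have hs' : (s : ℂ) ≠ 0 := by
    rw [Ne, GaussianInt.toComplex_eq_zero]; exact hs
  have : toMat4 (s • M) = ((s : ℂ) • 1) * toMat4 M := by
    refine Matrix.ext fun i j => ?_
    rw [Matrix.smul_mul, Matrix.one_mul, Matrix.smul_apply, toMat4_apply, toMat4_apply]
    simp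
  rw [this, slashMap_mul k (isSimilitude_scalar hs') hM, slashMap_scalar k hs', map_smul, scalarFactor]

lemma isSimilitude_one : IsSimilitude (toMat4 1) := by
  have := ParInt.isSimilitude 1
  rwa [ParInt.mat_one] at this

lemma slashMap_one (k : ℤ) (f : PlaneFun) : slashMap k (toMat4 1) f = f := by
  have : toMat4 1 = (1 : ℂ) • 1 := by simp
  rw [this, slashMap_scalar k one_ne_zero]
  simp

lemma hecke_scalar {k : ℤ} {Γ : Subgroup (GL (Fin 2 ⊕ Fin 2) GaussianInt)}
    (hΓ : Γ ≤ unitaryGroupInt) (hΓ' : parabolicGroupInt ≤ Γ) {F : Mat2 → ℂ}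
    (hF : IsInvariant k Γ (restrict F)) {s : GaussianInt} (hs : s ≠ 0) (Z : H2) :
    hecke k (complexGroup Γ) (toMat4 (s • 1)) F Z = scalarFactor k s * F Z := by
  have hsim : IsSimilitude (toMat4 (s • 1)) := by
    have : toMat4 (s • 1) = (s : ℂ) • 1 := by
      refine Matrix.ext fun i j => ?_
      rw [toMat4_apply]
      simp [Matrix.one_apply]
      split_ifs <;> simp
    rw [this]
    exact isSimilitude_scalar (by rw [Ne, GaussianInt.toComplex_eq_zero]; exact hs)
  have h := hecke_eq_sum k hΓ hΓ' hF
    (ι := Unit) (fun _ => s • 1) (fun _ => hsim) (s • 1)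
    (fun _ => ⊤) (fun _ => inferInstance)
    (fun _ δ => ⟨fun _ => ⟨δ.1, hΓ' δ.2, by simp [ParInt.mat]⟩, fun _ => trivial⟩)
    (fun _ => ⟨1, one_mem _, 1, one_mem _, by simp⟩)
    (fun γ hγ => ⟨(), 1, γ, hγ, by simp [ParInt.mat_one]⟩) (fun _ _ _ _ _ _ _ => rfl) Z
  rw [Fintype.sum_unique, Subgroup.index_top, slashMap_smul_int k hs isSimilitude_one,
    slashMap_one, Nat.cast_one, one_smul, orbitAvg_of_fixed] at h
  · exact h
  · intro γ
    rw [map_smul]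
    congr 1
    exact hF _ (hΓ' (γ⁻¹).2)

/-! ### Cusp forms -/

lemma IsCuspForm.isInvariant {k : ℤ} {F : Mat2 → ℂ} (hF : IsCuspForm k F) :
    IsInvariant k unitaryGroupInt (restrict F) := by
  intro γ hγ
  ext Z
  have hs := isSimilitude_unitary hγ
  have h1 : simFactor (toMat4 γ.val) = 1 := by
    refine simFactor_eq ?_
    rw [← toMat4_conjTranspose, ← toMat4_J, ← map_mul, ← map_mul, mem_unitaryGroupInt.mp hγ,
      one_smul]
  have h2 := hF.modular (Matrix.GeneralLinearGroup.map GaussianInt.toComplex γ) ⟨γ, hγ, rfl⟩ Z Z.2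
  change F (moebius (toMat4 γ.val) Z) = (denom (toMat4 γ.val) Z).det ^ k * F Z at h2
  rw [slashMap_restrict k hs]
  simp only [slash]
  rw [h1, h2, one_zpow, one_mul, ← mul_assoc, ← zpow_add₀ (isUnit_denom hs Z.2).ne_zero]
  simp [restrict]

lemma diag4_mem_similitudes {n : ℕ} (hn : 0 < n) {a b c d : GaussianInt}
    (h1 : star a * c = n) (h2 : star b * d = n) : diag4 a b c d ∈ similitudes := by
  refine ⟨fun i j => ?_, ?_⟩
  · have hI : Complex.I ∈ IntermediateField.adjoin ℚ {Complex.I} :=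
      IntermediateField.subset_adjoin _ _ rfl
    have hz : ∀ z : GaussianInt, (z : ℂ) ∈ IntermediateField.adjoin ℚ {Complex.I} := fun z => by
      rw [GaussianInt.toComplex_def]
      exact add_mem (intCast_mem _ _) (mul_mem (intCast_mem _ _) hI)
    rw [← toMat4_diagInt, toMat4_apply]
    exact hz _
  · rw [← toMat4_diagInt]
    exact isSimilitude_diagInt hn h1 h2

lemma IsHeckeEigenform.hecke_eq {k : ℤ} {F : Mat2 → ℂ} (hF : IsHeckeEigenform k F) {n : ℕ}
    (hn : 0 < n) {a b c d : GaussianInt} (h1 : star a * c = n) (h2 : star b * d = n) (Z : H2) :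
    hecke k Gamma2 (toMat4 (diagInt a b c d)) F Z
      = heckeEigenvalue k F (diag4 a b c d) * F Z := by
  rw [toMat4_diagInt]
  exact Classical.epsilon_spec (hF.eigen _ (diag4_mem_similitudes hn h1 h2)) Z Z.2

/-- The double coset of a scalar matrix is a single left coset, and F is nonzero somewhere, so the
chosen eigenvalue must be the explicit scalar. -/
lemma IsHeckeEigenform.heckeEigenvalue_deltaMat {k : ℤ} {F : Mat2 → ℂ}
    (hF : IsHeckeEigenform k F) {p : ℕ} (hp : 0 < p) {s : GaussianInt} (hs : star s * s = p) :
    heckeEigenvalue k F (deltaMat s) = scalarFactor k s := by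
  obtain ⟨Z, hZ, hne⟩ := hF.ne_zero
  have hs0 : s ≠ 0 := fun h => by
    rw [h, mul_zero] at hs
    exact hp.ne' (by exact_mod_cast hs.symm)
  have h1 := hF.hecke_eq hp hs hs ⟨Z, hZ⟩
  have h2 := hecke_scalar le_rfl parabolic_le_unitary hF.cusp.isInvariant hs0 ⟨Z, hZ⟩
  rw [one_eq_diagInt, smul_diagInt, mul_one] at h2
  exact mul_right_cancel₀ hne (h1.symm.trans h2)

namespace SplitPrime

variable {p : ℕ} [Fact p.Prime] {ϖ : GaussianInt} (D : SplitPrime p ϖ)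
include D

lemma index_lambdaMinus : (cosetStab (diagInt (star ϖ) p (star ϖ) 1)).index = 1 := by
  rw [Subgroup.index_eq_one, eq_top_iff]
  exact fun δ _ => D.mem_cosetStab_lambdaMinus δ

lemma index_tOneDiag (i : Fin 3) :
    (cosetStab (Matrix.diagonal (tOneDiag p ϖ i))).index = ![1, p * (p + 1), p ^ 3] i := by
  fin_cases i
  · exact D.index_lambdaMinus
  · exact D.index_tOne
  · exact D.index_lambdaPlus

lemma index_tTwoDiag (i : Fin 4) : (cosetStab (Matrix.diagonal (tTwoDiag p ϖ i))).index
    = ![p + 1, p ^ 2, p ^ 2, p ^ 2 * (p * (p + 1))] i := by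
  fin_cases i
  · exact D.index_one_p_p_one
  · exact D.index_tMixed
  · exact D.index_tMixed_star
  · exact D.index_tTwo

lemma index_tOneDiag_ne_zero (i : Fin 3) :
    (cosetStab (Matrix.diagonal (tOneDiag p ϖ i))).index ≠ 0 := by
  have hp := (Fact.out : p.Prime).ne_zero
  rw [D.index_tOneDiag]
  fin_cases i <;> simp [hp]

lemma index_tTwoDiag_ne_zero (i : Fin 4) :
    (cosetStab (Matrix.diagonal (tTwoDiag p ϖ i))).index ≠ 0 := by
  have hp := (Fact.out : p.Prime).ne_zero
  rw [D.index_tTwoDiag]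
  fin_cases i <;> simp [hp]

lemma hecke_tOne {k : ℤ} {F : Mat2 → ℂ} (hF : IsInvariant k unitaryGroupInt (restrict F))
    (Z : H2) : hecke k Gamma2 (toMat4 (diagInt 1 (star ϖ) p (star ϖ))) F Z
      = (∑ i, ((![1, p * (p + 1), p ^ 3] i : ℕ) : ℂ) • orbitAvg (parRep k)
          (slashMap k (toMat4 (Matrix.diagonal (tOneDiag p ϖ i))) (restrict F))) Z := by
  have hp := (Fact.out : p.Prime).pos
  simp_rw [← D.index_tOneDiag]
  refine hecke_eq_sum k le_rfl parabolic_le_unitary hF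
    (fun i => Matrix.diagonal (tOneDiag p ϖ i))
    (fun i => isSimilitude_diagonal hp (D.tOneDiag_similar i)) _ _
    (fun i => ⟨D.index_tOneDiag_ne_zero i⟩) (fun i δ => mem_cosetStab)
    (fun i => doubleEquiv_tOneDiag i) (fun γ hγ => ?_) (fun i j δ δ' γ _ h => ?_) Z
  · exact D.tOne_cover ⟨1, one_mem _, γ, hγ, by simp⟩
  · exact D.tOneDiag_disjoint h

lemma hecke_tTwo {k : ℤ} {F : Mat2 → ℂ} (hF : IsInvariant k unitaryGroupInt (restrict F))
    (Z : H2) : hecke k Gamma2 (toMat4 (diagInt 1 1 p p)) F Z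
      = (∑ i, ((![p + 1, p ^ 2, p ^ 2, p ^ 2 * (p * (p + 1))] i : ℕ) : ℂ) • orbitAvg (parRep k)
          (slashMap k (toMat4 (Matrix.diagonal (tTwoDiag p ϖ i))) (restrict F))) Z := by
  have hp := (Fact.out : p.Prime).pos
  simp_rw [← D.index_tTwoDiag]
  refine hecke_eq_sum k le_rfl parabolic_le_unitary hF
    (fun i => Matrix.diagonal (tTwoDiag p ϖ i))
    (fun i => isSimilitude_diagonal hp (D.tTwoDiag_similar i)) _ _
    (fun i => ⟨D.index_tTwoDiag_ne_zero i⟩) (fun i δ => mem_cosetStab)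
    (fun i => D.doubleEquiv_tTwoDiag i) (fun γ hγ => ?_) (fun i j δ δ' γ _ h => ?_) Z
  · exact D.tTwo_cover ⟨1, one_mem _, γ, hγ, by simp⟩
  · exact D.tTwoDiag_disjoint h

end SplitPrime

/-! ### The rationality identities for the operators on functions -/

section Recursion

variable {R : Type*} [CommRing R] {p l₁ l₂ l₃ c c' : R} {a dm t A₁ A₂ A₃ A₄ e t' q : ℕ → R}
  (h₁ : ∀ j, l₁ * a j = dm j + p * (p + 1) * t j + p ^ 3 * a (j + 1))
  (h₂ : ∀ j, l₂ * a j = (p + 1) * A₁ j + p ^ 2 * A₂ j + p ^ 2 * A₃ j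
    + p ^ 2 * (p * (p + 1)) * A₄ j)
  (h₃ : ∀ j, l₃ * a j = e j + p * (p + 1) * t' j + p ^ 3 * q j)
  (r₁ : ∀ j, dm (j + 1) = c * A₃ j) (r₂ : ∀ j, t (j + 1) = c * A₄ j)
  (r₃ : ∀ j, A₁ (j + 1) = c * t' j) (r₄ : ∀ j, A₂ (j + 1) = c * q j)
  (r₅ : ∀ j, e (j + 1) = c' * c * a j)
include h₁ h₂ r₁ r₂

/-- The first relation at j + 1 involves only c A₃ and c A₄ besides the sequence a; the factor p c
in front of the second relation is the one that cancels both. -/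
lemma recursion_two (j : ℕ) : p ^ (3 * (j + 2)) * a (j + 2) - l₁ * (p ^ (3 * (j + 1)) * a (j + 1))
    + p * c * l₂ * (p ^ (3 * j) * a j)
    = p ^ (3 * j) * (p * (p + 1) * (c * A₁ j) + p ^ 3 * (c * A₂ j)) := by
  have e1 := h₁ (j + 1)
  rw [r₁, r₂] at e1
  linear_combination -p ^ (3 * (j + 1)) * e1 + p ^ (3 * j) * (p * c) * h₂ j

include h₃ r₃ r₄

/-- After one more shift the remaining A₁ and A₂ become c t' and c q, which the third relation
eliminates, leaving only e. -/
lemma recursion_three (j : ℕ) : p ^ (3 * (j + 3)) * a (j + 3)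
    - l₁ * (p ^ (3 * (j + 2)) * a (j + 2)) + p * c * l₂ * (p ^ (3 * (j + 1)) * a (j + 1))
    - p ^ 3 * c ^ 2 * l₃ * (p ^ (3 * j) * a j)
    = -p ^ (3 * j) * (p ^ 3 * c ^ 2 * e j) := by
  have e1 := recursion_two h₁ h₂ r₁ r₂ (j + 1)
  rw [r₃, r₄] at e1
  linear_combination e1 - p ^ (3 * j) * (p ^ 3 * c ^ 2) * h₃ j

include r₅

/-- A last shift turns e into c' c times the sequence itself, which closes the recursion. -/
lemma recursion_four (j : ℕ) : p ^ (3 * (j + 4)) * a (j + 4)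
    - l₁ * (p ^ (3 * (j + 3)) * a (j + 3)) + p * c * l₂ * (p ^ (3 * (j + 2)) * a (j + 2))
    - p ^ 3 * c ^ 2 * l₃ * (p ^ (3 * (j + 1)) * a (j + 1))
    + p ^ 6 * c ^ 3 * c' * (p ^ (3 * j) * a j) = 0 := by
  have e1 := recursion_three h₁ h₂ h₃ r₁ r₂ r₃ r₄ (j + 1)
  rw [r₅] at e1
  linear_combination e1

end Recursion

/-- The average of `f | x` over the integral parabolic group. -/
def slashAvg (k : ℤ) (f : PlaneFun) (x : IntMat) : PlaneFun :=
  orbitAvg (parRep k) (slashMap k (toMat4 x) f)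

namespace SplitPrime

variable {p : ℕ} [Fact p.Prime] {ϖ : GaussianInt} (D : SplitPrime p ϖ)
include D

lemma slashAvg_smul_mul_plusPow {k : ℤ} {f : PlaneFun} {s : GaussianInt} (hs : s ≠ 0) {x : IntMat}
    (hx : IsSimilitude (toMat4 x)) (hf : HasFiniteOrbit (parRep k) (slashMap k (toMat4 x) f))
    (j : ℕ) : slashAvg k f (s • x * plusPow p ϖ j)
      = scalarFactor k s • slashAvg k f (x * plusPow p ϖ j) := by
  have hd := D.isSimilitude_plusPow j
  have hxd : IsSimilitude (toMat4 (x * plusPow p ϖ j)) := by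
    rw [map_mul]; exact hx.mul hd
  rw [slashAvg, Matrix.smul_mul, slashMap_smul_int k hs hxd, orbitAvg_smul, slashAvg]
  rw [map_mul, slashMap_mul k hx hd]
  exact D.hasFiniteOrbit_plusPow k j hf

lemma smul_slashAvg_plusPow {k : ℤ} {f : PlaneFun} (hf : IsInvariant k unitaryGroupInt f)
    {ι : Type*} [Fintype ι] (n : ι → ℂ) (x : ι → IntMat)
    (hx : ∀ i, IsSimilitude (toMat4 (x i))) (hfin : ∀ i, (cosetStab (x i)).index ≠ 0) {a : ℂ}
    (h : a • f = ∑ i, n i • orbitAvg (parRep k) (slashMap k (toMat4 (x i)) f)) (j : ℕ) :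
    a • slashAvg k f (plusPow p ϖ j) = ∑ i, n i • slashAvg k f (x i * plusPow p ϖ j) := by
  have hd := D.isSimilitude_plusPow j
  have hff : HasFiniteOrbit (parRep k) f :=
    HasFiniteOrbit.of_fixed _ fun γ => hf _ (parabolic_le_unitary (γ⁻¹).2)
  rw [slashAvg, D.orbitAvg_plusPow_sum k j n _
    (fun i => hasFiniteOrbit_slashMap hf (hx i) (hfin i)) hff h]
  refine Finset.sum_congr rfl fun i _ => ?_
  rw [slashAvg, map_mul, slashMap_mul k (hx i) hd]

/-! ### Products of the diagonal representatives with the element of Λ₊ -/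

omit [Fact p.Prime] D in
lemma diagonal_mul_plusPow_succ {x y : IntMat} {s : GaussianInt}
    (h : x * plusPow p ϖ 1 = s • y) (j : ℕ) :
    x * plusPow p ϖ (j + 1) = s • y * plusPow p ϖ j := by
  rw [plusPow_succ, ← Matrix.mul_assoc, h]

omit [Fact p.Prime] in
lemma tOneDiag_zero_mul : Matrix.diagonal (tOneDiag p ϖ 0) * plusPow p ϖ 1
    = star ϖ • Matrix.diagonal (tTwoDiag p ϖ 2) := by
  change diagInt (star ϖ) p (star ϖ) 1 * _ = star ϖ • diagInt (star ϖ) ϖ (star ϖ) ϖ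
  rw [plusPow_one, diagInt_mul, smul_diagInt, ← D.mul_star]
  congr 1 <;> ring

omit [Fact p.Prime] D in
lemma tOneDiag_one_mul : Matrix.diagonal (tOneDiag p ϖ 1) * plusPow p ϖ 1
    = star ϖ • Matrix.diagonal (tTwoDiag p ϖ 3) := by
  change diagInt 1 (star ϖ) p (star ϖ) * _ = star ϖ • diagInt 1 1 p p
  rw [plusPow_one, diagInt_mul, smul_diagInt]
  congr 1 <;> ring

omit [Fact p.Prime] in
lemma tTwoDiag_zero_mul : Matrix.diagonal (tTwoDiag p ϖ 0) * plusPow p ϖ 1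
    = star ϖ • Matrix.diagonal (tOneDiag p (star ϖ) 1) := by
  change diagInt 1 p p 1 * _ = star ϖ • diagInt 1 (star (star ϖ)) p (star (star ϖ))
  rw [plusPow_one, diagInt_mul, smul_diagInt, star_star, ← D.mul_star]
  congr 1 <;> ring

omit [Fact p.Prime] in
lemma tTwoDiag_one_mul : Matrix.diagonal (tTwoDiag p ϖ 1) * plusPow p ϖ 1
    = star ϖ • Matrix.diagonal (tOneDiag p (star ϖ) 2) := by
  change diagInt ϖ (star ϖ) ϖ (star ϖ) * _
    = star ϖ • diagInt (star (star ϖ)) 1 (star (star ϖ)) p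
  rw [plusPow_one, diagInt_mul, smul_diagInt, star_star, ← D.mul_star]
  congr 1 <;> ring

omit [Fact p.Prime] in
lemma tOneDiag_star_zero_mul : Matrix.diagonal (tOneDiag p (star ϖ) 0) * plusPow p ϖ 1
    = ϖ • star ϖ • 1 := by
  change diagInt (star (star ϖ)) p (star (star ϖ)) 1 * _ = _
  rw [plusPow_one, diagInt_mul, one_eq_diagInt, smul_diagInt, smul_diagInt, star_star,
    ← D.mul_star]
  congr 1 <;> ring

/-- The double cosets of the parabolic group in the rationality identities. -/
lemma hecke_identities (D' : SplitPrime p (star ϖ)) {k : ℤ} {F : Mat2 → ℂ}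
    (hF : IsHeckeEigenform k F) (Λ : ℕ → PlaneFun) (l₁ l₂ l₃ c c' : ℂ)
    (hΛ : ∀ j, Λ j = heckePar k (plusPow p ϖ j) (restrict F))
    (hl₁ : l₁ = heckeEigenvalue k F (tOne p (star ϖ))) (hl₂ : l₂ = heckeEigenvalue k F (tTwo p))
    (hl₃ : l₃ = heckeEigenvalue k F (tOne p ϖ)) (hc : c = heckeEigenvalue k F (deltaMat (star ϖ)))
    (hc' : c' = heckeEigenvalue k F (deltaMat ϖ)) :
    Λ 0 = restrict F ∧
    Λ 1 - l₁ • Λ 0 = -heckePar k (diagInt (star ϖ) p (star ϖ) 1) (restrict F)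
      - heckePar k (diagInt 1 (star ϖ) p (star ϖ)) (restrict F) ∧
    Λ 2 - l₁ • Λ 1 + (p * c * l₂) • Λ 0
      = heckePar k (diagInt 1 (star ϖ) p (star ϖ))
          (heckePar k (diagInt (star ϖ) p (star ϖ) 1) (restrict F))
        + (p : ℂ) • heckePar k (diagInt ϖ (star ϖ) ϖ (star ϖ))
          (heckePar k (diagInt (star ϖ) (star ϖ) (star ϖ) (star ϖ)) (restrict F)) ∧
    Λ 3 - l₁ • Λ 2 + (p * c * l₂) • Λ 1 - (p ^ 3 * c ^ 2 * l₃) • Λ 0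
      = -((p : ℂ) • heckePar k (diagInt ϖ (star ϖ) ϖ (star ϖ))
          (heckePar k (diagInt (star ϖ) (star ϖ) (star ϖ) (star ϖ))
            (heckePar k (diagInt (star ϖ) p (star ϖ) 1) (restrict F)))) ∧
    ∀ n, Λ (n + 4) - l₁ • Λ (n + 3) + (p * c * l₂) • Λ (n + 2) - (p ^ 3 * c ^ 2 * l₃) • Λ (n + 1)
      + (p ^ 6 * c ^ 3 * c') • Λ n = 0 := by
  have hp := (Fact.out : p.Prime).pos
  set f := restrict F with hf
  have hinv := hF.cusp.isInvariant
  have hs0 : star ϖ ≠ 0 := star_ne_zero.mpr D.self_ne_zero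
  have hcs : c = scalarFactor k (star ϖ) :=
    hc.trans (hF.heckeEigenvalue_deltaMat hp (by rw [star_star, D.mul_star]))
  have hcs' : c' = scalarFactor k ϖ := hc'.trans (hF.heckeEigenvalue_deltaMat hp D.star_mul_self)
  have s1 := fun i => isSimilitude_diagonal hp (D.tOneDiag_similar i)
  have s2 := fun i => isSimilitude_diagonal hp (D.tTwoDiag_similar i)
  have s3 := fun i => isSimilitude_diagonal hp (D'.tOneDiag_similar i)
  have hE1 := fun j => D.smul_slashAvg_plusPow hinv _ _ s1 D.index_tOneDiag_ne_zero
    (a := l₁) (funext fun Z => by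
      rw [← D.hecke_tOne hinv, hF.hecke_eq hp (by simp) (by rw [star_star, D.mul_star]), hl₁]
      rfl) j
  have hE2 := fun j => D.smul_slashAvg_plusPow hinv _ _ s2 D.index_tTwoDiag_ne_zero
    (a := l₂) (funext fun Z => by
      rw [← D.hecke_tTwo hinv, hF.hecke_eq hp (by simp) (by simp), hl₂]
      rfl) j
  -- The decomposition of T(ϖ) uses reduction modulo the conjugate prime, while the powers of d are
  -- still those attached to ϖ.
  have hE3 := fun j => D.smul_slashAvg_plusPow hinv _ _ s3 D'.index_tOneDiag_ne_zero
    (a := l₃) (funext fun Z => by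
      rw [← D'.hecke_tOne hinv, hF.hecke_eq hp (by simp)
        (by rw [star_star, star_star, D.star_mul_self]), star_star, hl₃]
      rfl) j
  have h1 : ∀ j Z, l₁ * slashAvg k f (plusPow p ϖ j) Z
      = slashAvg k f (Matrix.diagonal (tOneDiag p ϖ 0) * plusPow p ϖ j) Z
        + p * (p + 1) * slashAvg k f (Matrix.diagonal (tOneDiag p ϖ 1) * plusPow p ϖ j) Z
        + p ^ 3 * slashAvg k f (plusPow p ϖ (j + 1)) Z := fun j Z => by
    have := congrFun (hE1 j) Z
    rw [Fin.sum_univ_three] at this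
    have e : plusPow p ϖ (j + 1) = Matrix.diagonal (tOneDiag p ϖ 2) * plusPow p ϖ j := by
      rw [plusPow_succ, plusPow_one]
      rfl
    rw [e]
    simpa using this
  have h2 : ∀ j Z, l₂ * slashAvg k f (plusPow p ϖ j) Z
      = (p + 1) * slashAvg k f (Matrix.diagonal (tTwoDiag p ϖ 0) * plusPow p ϖ j) Z
        + p ^ 2 * slashAvg k f (Matrix.diagonal (tTwoDiag p ϖ 1) * plusPow p ϖ j) Z
        + p ^ 2 * slashAvg k f (Matrix.diagonal (tTwoDiag p ϖ 2) * plusPow p ϖ j) Z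
        + p ^ 2 * (p * (p + 1))
          * slashAvg k f (Matrix.diagonal (tTwoDiag p ϖ 3) * plusPow p ϖ j) Z := fun j Z => by
    have := congrFun (hE2 j) Z
    rw [Fin.sum_univ_four] at this
    simpa using this
  have h3 : ∀ j Z, l₃ * slashAvg k f (plusPow p ϖ j) Z
      = slashAvg k f (Matrix.diagonal (tOneDiag p (star ϖ) 0) * plusPow p ϖ j) Z
        + p * (p + 1) * slashAvg k f (Matrix.diagonal (tOneDiag p (star ϖ) 1) * plusPow p ϖ j) Z
        + p ^ 3 * slashAvg k f (Matrix.diagonal (tOneDiag p (star ϖ) 2) * plusPow p ϖ j) Z :=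
      fun j Z => by
    have := congrFun (hE3 j) Z
    rw [Fin.sum_univ_three] at this
    simpa using this
  have o2 := fun i => hasFiniteOrbit_slashMap hinv (s2 i) (D.index_tTwoDiag_ne_zero i)
  have o3 := fun i => hasFiniteOrbit_slashMap hinv (s3 i) (D'.index_tOneDiag_ne_zero i)
  have r1 : ∀ j Z, slashAvg k f (Matrix.diagonal (tOneDiag p ϖ 0) * plusPow p ϖ (j + 1)) Z
      = c * slashAvg k f (Matrix.diagonal (tTwoDiag p ϖ 2) * plusPow p ϖ j) Z := fun j Z => by
    rw [diagonal_mul_plusPow_succ D.tOneDiag_zero_mul,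
      D.slashAvg_smul_mul_plusPow hs0 (s2 2) (o2 2), hcs]
    rfl
  have r2 : ∀ j Z, slashAvg k f (Matrix.diagonal (tOneDiag p ϖ 1) * plusPow p ϖ (j + 1)) Z
      = c * slashAvg k f (Matrix.diagonal (tTwoDiag p ϖ 3) * plusPow p ϖ j) Z := fun j Z => by
    rw [diagonal_mul_plusPow_succ tOneDiag_one_mul,
      D.slashAvg_smul_mul_plusPow hs0 (s2 3) (o2 3), hcs]
    rfl
  have r3 : ∀ j Z, slashAvg k f (Matrix.diagonal (tTwoDiag p ϖ 0) * plusPow p ϖ (j + 1)) Z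
      = c * slashAvg k f (Matrix.diagonal (tOneDiag p (star ϖ) 1) * plusPow p ϖ j) Z :=
      fun j Z => by
    rw [diagonal_mul_plusPow_succ D.tTwoDiag_zero_mul,
      D.slashAvg_smul_mul_plusPow hs0 (s3 1) (o3 1), hcs]
    rfl
  have r4 : ∀ j Z, slashAvg k f (Matrix.diagonal (tTwoDiag p ϖ 1) * plusPow p ϖ (j + 1)) Z
      = c * slashAvg k f (Matrix.diagonal (tOneDiag p (star ϖ) 2) * plusPow p ϖ j) Z :=
      fun j Z => by
    rw [diagonal_mul_plusPow_succ D.tTwoDiag_one_mul,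
      D.slashAvg_smul_mul_plusPow hs0 (s3 2) (o3 2), hcs]
    rfl
  have hpar : IsInvariant k parabolicGroupInt f := hinv.mono parabolic_le_unitary
  have hfixed : ∀ γ, parRep k γ f = f := fun γ => hpar _ (γ⁻¹).2
  have ss1 : IsSimilitude (toMat4 (star ϖ • 1)) := by
    rw [one_eq_diagInt, smul_diagInt, mul_one]
    exact isSimilitude_diagInt hp (by rw [star_star, D.mul_star]) (by rw [star_star, D.mul_star])
  have hsc : slashMap k (toMat4 (star ϖ • 1)) f = c • f := by
    rw [slashMap_smul_int k hs0 isSimilitude_one, slashMap_one, hcs]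
  have r5 : ∀ j Z, slashAvg k f (Matrix.diagonal (tOneDiag p (star ϖ) 0) * plusPow p ϖ (j + 1)) Z
      = c' * c * slashAvg k f (plusPow p ϖ j) Z := fun j Z => by
    rw [diagonal_mul_plusPow_succ D.tOneDiag_star_zero_mul,
      D.slashAvg_smul_mul_plusPow D.self_ne_zero ss1, D.slashAvg_smul_mul_plusPow hs0
        isSimilitude_one, hcs, hcs', one_mul, smul_smul]
    · rfl
    · rw [slashMap_one]
      exact HasFiniteOrbit.of_fixed _ hfixed
    · rw [hsc]
      exact (HasFiniteOrbit.of_fixed _ hfixed).smul _ _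
  have hΛ' : ∀ j Z, Λ j Z = (p : ℂ) ^ (3 * j) * slashAvg k f (plusPow p ϖ j) Z := fun j Z => by
    rw [hΛ, heckePar, D.index_plusPow, Nat.cast_pow]
    rfl
  have hsa0 : slashAvg k f (plusPow p ϖ 0) = f := by
    rw [slashAvg, plusPow_zero, slashMap_one, orbitAvg_of_fixed _ hfixed]
  have hmul0 : ∀ x : IntMat, x * plusPow p ϖ 0 = x := fun x => by
    rw [plusPow_zero, mul_one]
  have hsm : IsSimilitude (toMat4 (diagInt (star ϖ) p (star ϖ) 1)) := s1 0
  have hst : IsSimilitude (toMat4 (diagInt 1 (star ϖ) p (star ϖ))) := s1 1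
  have hsx : IsSimilitude (toMat4 (diagInt ϖ (star ϖ) ϖ (star ϖ))) := s2 1
  -- Λ₋ consists of a single left coset, since its kernel ⟨e₂⟩ is fixed by the whole group. Hence
  -- F|Λ₋ is one slash, and later operators can be composed with it by multiplying matrices.
  have hfm : ∀ γ, parRep k γ (slashMap k (toMat4 (diagInt (star ϖ) p (star ϖ) 1)) f)
      = slashMap k (toMat4 (diagInt (star ϖ) p (star ϖ) 1)) f := fun γ =>
    le_vecStab le_rfl hinv (s1 0) (K := cosetStab (diagInt (star ϖ) p (star ϖ) 1))
      (fun _ hδ => hδ) (D.mem_cosetStab_lambdaMinus γ)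
  have hm : heckePar k (diagInt (star ϖ) p (star ϖ) 1) f
      = slashMap k (toMat4 (diagInt (star ϖ) p (star ϖ) 1)) f := by
    rw [heckePar, D.index_lambdaMinus, orbitAvg_of_fixed _ hfm, Nat.cast_one, one_smul]
  have ht : ∀ g, heckePar k (diagInt 1 (star ϖ) p (star ϖ)) g = ((p : ℂ) * (p + 1)) •
      orbitAvg (parRep k) (slashMap k (toMat4 (diagInt 1 (star ϖ) p (star ϖ))) g) := fun g => by
    rw [heckePar, D.index_tOne]
    push_cast
    rfl
  have hx : ∀ g, heckePar k (diagInt ϖ (star ϖ) ϖ (star ϖ)) g = ((p : ℂ) ^ 2) •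
      orbitAvg (parRep k) (slashMap k (toMat4 (diagInt ϖ (star ϖ) ϖ (star ϖ))) g) := fun g => by
    rw [heckePar, D.index_tMixed]
    push_cast
    rfl
  have hδ : ∀ g, (∀ γ, parRep k γ g = g) →
      heckePar k (diagInt (star ϖ) (star ϖ) (star ϖ) (star ϖ)) g = c • g := fun g hg => by
    have e : diagInt (star ϖ) (star ϖ) (star ϖ) (star ϖ) = star ϖ • 1 := by
      rw [one_eq_diagInt, smul_diagInt, mul_one]
    have hi : (cosetStab (star ϖ • (1 : IntMat))).index = 1 := by
      rw [Subgroup.index_eq_one, eq_top_iff]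
      exact fun δ _ => ⟨δ.1, parabolic_le_unitary δ.2, by simp [ParInt.mat]⟩
    rw [heckePar, e, hi, slashMap_smul_int k hs0 isSimilitude_one, slashMap_one,
      orbitAvg_smul _ _ (HasFiniteOrbit.of_fixed _ hg), orbitAvg_of_fixed _ hg, hcs,
      Nat.cast_one, one_smul]
  have hx1 : heckePar k (diagInt ϖ (star ϖ) ϖ (star ϖ)) (c • f)
      = ((p : ℂ) ^ 2 * c) • slashAvg k f (Matrix.diagonal (tTwoDiag p ϖ 1)) := by
    have ho : HasFiniteOrbit (parRep k) (slashMap k (toMat4 (diagInt ϖ (star ϖ) ϖ (star ϖ))) f) :=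
      o2 1
    rw [hx, map_smul, orbitAvg_smul _ _ ho, smul_smul]
    rfl
  -- The composites with Λ₋ produce ϖ' times diag(1, p, p, 1) and, below, ϖ' times the Λ₋ matrix of
  -- ϖ. These are the remainders A₁ and e of the recursions.
  have ht1 : heckePar k (diagInt 1 (star ϖ) p (star ϖ))
      (slashMap k (toMat4 (diagInt (star ϖ) p (star ϖ) 1)) f)
      = ((p : ℂ) * (p + 1) * c) • slashAvg k f (Matrix.diagonal (tTwoDiag p ϖ 0)) := by
    have e : diagInt (star ϖ) p (star ϖ) 1 * diagInt 1 (star ϖ) p (star ϖ)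
        = star ϖ • Matrix.diagonal (tTwoDiag p ϖ 0) := by
      change _ = star ϖ • diagInt 1 p p 1
      rw [diagInt_mul, smul_diagInt]
      congr 1 <;> ring
    rw [ht, ← slashMap_mul k hsm hst, ← map_mul, e, slashMap_smul_int k hs0 (s2 0),
      orbitAvg_smul _ _ (o2 0), smul_smul, hcs]
    rfl
  have hx2 : heckePar k (diagInt ϖ (star ϖ) ϖ (star ϖ))
      (c • slashMap k (toMat4 (diagInt (star ϖ) p (star ϖ) 1)) f)
      = ((p : ℂ) ^ 2 * c ^ 2) • slashAvg k f (Matrix.diagonal (tOneDiag p (star ϖ) 0)) := by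
    have e : diagInt (star ϖ) p (star ϖ) 1 * diagInt ϖ (star ϖ) ϖ (star ϖ)
        = star ϖ • Matrix.diagonal (tOneDiag p (star ϖ) 0) := by
      change _ = star ϖ • diagInt (star (star ϖ)) p (star (star ϖ)) 1
      rw [diagInt_mul, smul_diagInt, star_star]
      congr 1 <;> ring
    rw [hx, map_smul, ← slashMap_mul k hsm hsx, ← map_mul, e, slashMap_smul_int k hs0 (s3 0),
      smul_smul, orbitAvg_smul _ _ (o3 0), smul_smul, hcs, slashAvg]
    congr 1
    ring
  have hm' : slashMap k (toMat4 (diagInt (star ϖ) p (star ϖ) 1)) f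
      = slashAvg k f (Matrix.diagonal (tOneDiag p ϖ 0)) := (orbitAvg_of_fixed _ hfm).symm
  have ht' : heckePar k (diagInt 1 (star ϖ) p (star ϖ)) f
      = ((p : ℂ) * (p + 1)) • slashAvg k f (Matrix.diagonal (tOneDiag p ϖ 1)) := ht f
  rw [hm, hδ f hfixed, hδ _ hfm, hx1, ht1, hx2, ht', hm']
  refine ⟨?_, funext fun Z => ?_, funext fun Z => ?_, funext fun Z => ?_,
    fun n => funext fun Z => ?_⟩
  · ext Z
    simp [hΛ', hsa0]
  · have := h1 0 Z
    simp only [hmul0] at this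
    simp only [Pi.sub_apply, Pi.neg_apply, Pi.smul_apply, smul_eq_mul, hΛ']
    linear_combination -this
  · have := recursion_two (fun j => h1 j Z) (fun j => h2 j Z) (fun j => r1 j Z)
      (fun j => r2 j Z) 0
    simp only [hmul0] at this
    simp only [Pi.sub_apply, Pi.add_apply, Pi.smul_apply, smul_eq_mul, hΛ']
    linear_combination this
  · have := recursion_three (fun j => h1 j Z) (fun j => h2 j Z) (fun j => h3 j Z)
      (fun j => r1 j Z) (fun j => r2 j Z) (fun j => r3 j Z) (fun j => r4 j Z) 0
    simp only [hmul0] at this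
    simp only [Pi.sub_apply, Pi.add_apply, Pi.neg_apply, Pi.smul_apply, smul_eq_mul, hΛ']
    linear_combination this
  · have := recursion_four (fun j => h1 j Z) (fun j => h2 j Z) (fun j => h3 j Z)
      (fun j => r1 j Z) (fun j => r2 j Z) (fun j => r3 j Z) (fun j => r4 j Z)
      (fun j => r5 j Z) n
    simp only [Pi.sub_apply, Pi.add_apply, Pi.smul_apply, smul_eq_mul, hΛ', Pi.zero_apply]
    linear_combination this

end SplitPrime

/-! ### The lines `ω ↦ (τ, z₁; z₂, ω)` in the upper Hermitian plane -/

/-- The lower bound for `Im ω` on the line of `(τ, z₁, z₂)`. -/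
def lineBound (w : ℍ × ℂ × ℂ) : ℝ := Complex.normSq (w.2.1 - star w.2.2) / (4 * w.1.im)

lemma pointMat_imPart (w : ℍ × ℂ × ℂ) (ω : ℂ) :
    (2 * Complex.I)⁻¹ • (pointMat w ω - (pointMat w ω)ᴴ)
      = !![(w.1.im : ℂ), (2 * Complex.I)⁻¹ * (w.2.1 - star w.2.2);
        star ((2 * Complex.I)⁻¹ * (w.2.1 - star w.2.2)), (ω.im : ℂ)] := by
  have h : ∀ z : ℂ, (2 * Complex.I)⁻¹ * (z - star z) = z.im := fun z => by
    have : z - star z = (2 * z.im : ℝ) * Complex.I := Complex.sub_conj z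
    rw [this]
    field_simp
    push_cast
    ring
  ext i j
  fin_cases i <;> fin_cases j
  · simpa [pointMat] using h w.1
  · simp [pointMat]
  · simp [pointMat]
    ring
  · simpa [pointMat] using h ω

/-- A Hermitian 2 × 2 matrix with positive corner is positive definite exactly when its determinant
is positive, so every line meets the plane in a half plane. The converse direction completes the
square. -/
lemma pointMat_mem_iff {w : ℍ × ℂ × ℂ} {ω : ℂ} : pointMat w ω ∈ H2 ↔ lineBound w < ω.im := by
  have hy : 0 < w.1.im := w.1.im_pos
  set u : ℂ := (2 * Complex.I)⁻¹ * (w.2.1 - star w.2.2) with hu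
  have hb : lineBound w = Complex.normSq u / w.1.im := by
    rw [hu, lineBound, map_mul, Complex.normSq_inv]
    simp
    field_simp
    ring
  change ((2 * Complex.I)⁻¹ • (pointMat w ω - (pointMat w ω)ᴴ)).PosDef ↔ _
  rw [pointMat_imPart, ← hu, hb, div_lt_iff₀ hy]
  constructor
  · intro h
    have h1 := h.det_pos
    rw [Matrix.det_fin_two_of] at h1
    have h2 : u * star u = (Complex.normSq u : ℂ) := Complex.mul_conj u
    rw [h2, ← Complex.ofReal_mul, ← Complex.ofReal_sub] at h1
    have h3 : 0 < w.1.im * ω.im - Complex.normSq u := by exact_mod_cast h1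
    linarith
  · intro h
    refine Matrix.PosDef.of_dotProduct_mulVec_pos ?_ fun x hx => ?_
    · ext i j
      fin_cases i <;> fin_cases j <;> simp [Matrix.conjTranspose_apply]
    · set y := w.1.im
      have e : star x ⬝ᵥ !![(y : ℂ), u; star u, (ω.im : ℂ)] *ᵥ x
          = ((y⁻¹ * (Complex.normSq (y * x 0 + u * x 1)
            + (y * ω.im - Complex.normSq u) * Complex.normSq (x 1)) : ℝ) : ℂ) := by
        have hy' : (y : ℂ) ≠ 0 := by exact_mod_cast hy.ne'
        simp only [Complex.ofReal_mul, Complex.ofReal_add, Complex.ofReal_sub,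
          ← Complex.mul_conj, Complex.ofReal_inv, map_add, map_mul, Complex.conj_ofReal]
        simp [dotProduct, Matrix.mulVec, Fin.sum_univ_two]
        field_simp
        ring
      rw [e]
      have hpos : 0 < y * ω.im - Complex.normSq u := by linarith
      have : 0 < Complex.normSq (y * x 0 + u * x 1)
          + (y * ω.im - Complex.normSq u) * Complex.normSq (x 1) := by
        by_cases h1 : x 1 = 0
        · have h0 : x 0 ≠ 0 := fun h0 => hx (by ext i; fin_cases i <;> simp [h0, h1])
          rw [h1]
          simp only [mul_zero, add_zero, map_zero]
          exact Complex.normSq_pos.mpr (mul_ne_zero (by exact_mod_cast hy.ne') h0)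
        · have := mul_pos hpos (Complex.normSq_pos.mpr h1)
          have := Complex.normSq_nonneg (y * x 0 + u * x 1)
          linarith
      exact_mod_cast mul_pos (inv_pos.mpr hy) this

lemma lineBound_lt_basePoint (w : ℍ × ℂ × ℂ) : lineBound w < (basePoint w).im := by
  rw [basePoint, Complex.I_mul_im, Complex.ofReal_re, lineBound]
  linarith

lemma basePoint_add_mem (w : ℍ × ℂ × ℂ) (x : ℝ) : pointMat w (basePoint w + x) ∈ H2 := by
  rw [pointMat_mem_iff]
  simpa using lineBound_lt_basePoint w

lemma basePoint_mem (w : ℍ × ℂ × ℂ) : pointMat w (basePoint w) ∈ H2 :=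
  pointMat_mem_iff.mpr (lineBound_lt_basePoint w)

lemma exists_pointMat_eq {Z : Mat2} (hZ : Z ∈ H2) : ∃ w : ℍ × ℂ × ℂ,
    (w.1 : ℂ) = Z 0 0 ∧ w.2.1 = Z 0 1 ∧ w.2.2 = Z 1 0 := by
  have h := Matrix.PosDef.diag_pos hZ (i := 0)
  have e : ((2 * Complex.I)⁻¹ • (Z - Zᴴ)) 0 0 = ((Z 0 0).im : ℂ) := by
    have : Z 0 0 - star (Z 0 0) = (2 * (Z 0 0).im : ℝ) * Complex.I := Complex.sub_conj _
    simp only [Matrix.smul_apply, Matrix.sub_apply, Matrix.conjTranspose_apply, smul_eq_mul]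
    rw [this]
    field_simp
    push_cast
    ring
  rw [e] at h
  have h' : 0 < (Z 0 0).im := by exact_mod_cast h
  exact ⟨(⟨Z 0 0, h'⟩, Z 0 1, Z 1 0), rfl, rfl, rfl⟩

/-- The shape of the matrices in the rational parabolic group. -/
def IsParabolic (g : Mat4) : Prop :=
  (∀ j, j ≠ Sum.inr 1 → g (Sum.inr 1) j = 0) ∧ ∀ i, i ≠ Sum.inl 1 → g i (Sum.inl 1) = 0

/-- For parabolic g the variable ω does not enter CZ + D, and it enters AZ + B only in the lower
right entry. Hence the other three entries of g⟨Z⟩ are constant on the line and may be computed at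
the base point. -/
lemma exists_moebius_line {g : Mat4} (hg : IsSimilitude g) (hp : IsParabolic g)
    (w : ℍ × ℂ × ℂ) : ∃ (w' : ℍ × ℂ × ℂ) (h J : ℂ), ∀ ω, lineBound w < ω.im →
      (denom g (pointMat w ω)).det = J ∧ moebius g (pointMat w ω)
        = pointMat w' (g (Sum.inl 1) (Sum.inl 1) / g (Sum.inr 1) (Sum.inr 1) * ω + h) := by
  have hden : ∀ ω, denom g (pointMat w ω) = !![g (Sum.inr 0) (Sum.inl 0) * w.1
      + g (Sum.inr 0) (Sum.inr 0), g (Sum.inr 0) (Sum.inl 0) * w.2.1 + g (Sum.inr 0) (Sum.inr 1);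
      0, g (Sum.inr 1) (Sum.inr 1)] := fun ω => by
    have h1 := hp.1 (Sum.inl 0) (by simp)
    have h2 := hp.1 (Sum.inl 1) (by simp)
    have h3 := hp.1 (Sum.inr 0) (by simp)
    have h4 := hp.2 (Sum.inr 0) (by simp)
    ext i j
    fin_cases i <;> fin_cases j <;>
      simp [denom, pointMat, Matrix.toBlocks₂₁, Matrix.toBlocks₂₂, Matrix.mul_apply, h1, h2, h3,
        h4]
  set j := g (Sum.inr 0) (Sum.inl 0) * w.1 + g (Sum.inr 0) (Sum.inr 0) with hj
  set l := g (Sum.inr 0) (Sum.inl 0) * w.2.1 + g (Sum.inr 0) (Sum.inr 1) with hl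
  set b := g (Sum.inr 1) (Sum.inr 1) with hb
  set a := g (Sum.inl 1) (Sum.inl 1) with ha
  have hne : j * b ≠ 0 := by
    have h := (isUnit_denom hg (basePoint_mem w)).ne_zero
    rwa [hden, Matrix.det_fin_two_of, mul_zero, sub_zero] at h
  have hj0 : j ≠ 0 := left_ne_zero_of_mul hne
  have hb0 : b ≠ 0 := right_ne_zero_of_mul hne
  obtain ⟨w', h00, h01, h10⟩ := exists_pointMat_eq (moebius_mem hg (basePoint_mem w))
  have key : ∀ ω, lineBound w < ω.im →
      moebius g (pointMat w ω) 0 0 * j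
        = g (Sum.inl 0) (Sum.inl 0) * w.1 + g (Sum.inl 0) (Sum.inr 0) ∧
      moebius g (pointMat w ω) 1 0 * j
        = g (Sum.inl 1) (Sum.inl 0) * w.1 + a * w.2.2 + g (Sum.inl 1) (Sum.inr 0) ∧
      moebius g (pointMat w ω) 0 0 * l + moebius g (pointMat w ω) 0 1 * b
        = g (Sum.inl 0) (Sum.inl 0) * w.2.1 + g (Sum.inl 0) (Sum.inr 1) ∧
      moebius g (pointMat w ω) 1 0 * l + moebius g (pointMat w ω) 1 1 * b
        = g (Sum.inl 1) (Sum.inl 0) * w.2.1 + a * ω + g (Sum.inl 1) (Sum.inr 1) := by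
    intro ω hω
    have h := moebius_mul_denom (isUnit_denom hg (pointMat_mem_iff.mpr hω))
    rw [hden] at h
    have h4 := hp.2 (Sum.inl 0) (by simp)
    have e00 := congrFun (congrFun h 0) 0
    have e01 := congrFun (congrFun h 0) 1
    have e10 := congrFun (congrFun h 1) 0
    have e11 := congrFun (congrFun h 1) 1
    simp [pointMat, Matrix.toBlocks₁₁, Matrix.toBlocks₁₂, Matrix.mul_apply, Fin.sum_univ_two, h4]
      at e00 e01 e10 e11
    exact ⟨e00, e10, e01, e11⟩
  obtain ⟨k00, k10, k01, k11⟩ := key _ (lineBound_lt_basePoint w)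
  rw [← h00] at k00 k01
  rw [← h10] at k10 k11
  rw [← h01] at k01
  refine ⟨w', (g (Sum.inl 1) (Sum.inl 0) * w.2.1 + g (Sum.inl 1) (Sum.inr 1) - w'.2.2 * l) / b,
    j * b, fun ω hω => ⟨by rw [hden, Matrix.det_fin_two_of, mul_zero, sub_zero], ?_⟩⟩
  obtain ⟨m00, m10, m01, m11⟩ := key ω hω
  have n00 := mul_right_cancel₀ hj0 (m00.trans k00.symm)
  have n10 := mul_right_cancel₀ hj0 (m10.trans k10.symm)
  rw [n00] at m01
  rw [n10] at m11
  have n01 : moebius g (pointMat w ω) 0 1 = w'.2.1 :=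
    mul_right_cancel₀ hb0 (by linear_combination m01 - k01)
  have n11 : moebius g (pointMat w ω) 1 1 = a / b * ω
      + (g (Sum.inl 1) (Sum.inl 0) * w.2.1 + g (Sum.inl 1) (Sum.inr 1) - w'.2.2 * l) / b := by
    field_simp
    linear_combination m11
  rw [Matrix.eta_fin_two (moebius g (pointMat w ω)), n00, n10, n01, n11]
  rfl

/-! ### Fourier coefficients of periodic holomorphic functions on a half plane -/

section Periodic

variable {c : ℝ} {h : ℂ → ℂ} (hd : DifferentiableOn ℂ h {ω | c < ω.im})
  (hper : ∀ ω, c < ω.im → h (ω + 1) = h ω)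

include hper in
lemma periodic_line {ω : ℂ} (hω : c < ω.im) : Function.Periodic (fun x : ℝ => h (ω + x)) 1 := by
  intro x
  have := hper (ω + x) (by simpa using hω)
  simpa [add_assoc] using this

include hd in
lemma continuous_line {ω : ℂ} (hω : c < ω.im) : Continuous fun x : ℝ => h (ω + x) :=
  hd.continuousOn.comp_continuous (by fun_prop) fun x => by simpa using hω

include hper in
lemma integral_line_eq {ω : ℂ} (hω : c < ω.im) :
    ∫ x in (0 : ℝ)..1, h (ω + x) = ∫ x in (0 : ℝ)..1, h (x + ω.im * Complex.I) := by
  have h1 : ∀ x : ℝ, h (ω + x) = h (((x + ω.re : ℝ) : ℂ) + ω.im * Complex.I) := fun x => by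
    congr 1
    conv_lhs => rw [← Complex.re_add_im ω]
    push_cast
    ring
  have hp : Function.Periodic (fun x : ℝ => h (x + ω.im * Complex.I)) 1 := by
    have := periodic_line hper (ω := ω.im * Complex.I) (by simpa using hω)
    simpa only [add_comm] using this
  simp_rw [h1]
  rw [intervalIntegral.integral_comp_add_right (fun x : ℝ => h (x + ω.im * Complex.I))]
  have := hp.intervalIntegral_add_eq (0 + ω.re) 0
  rw [add_comm 1 ω.re, zero_add]
  simpa using this

-- Cauchy's theorem on a rectangle of width one: the vertical sides cancel by periodicity, so the
-- integral does not depend on the height. `integral_line_eq` removes the dependence on the real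
-- part.
include hd hper in
lemma integral_line_eq_of_periodic {ω ω' : ℂ} (hω : c < ω.im) (hω' : c < ω'.im) :
    ∫ x in (0 : ℝ)..1, h (ω + x) = ∫ x in (0 : ℝ)..1, h (ω' + x) := by
  rw [integral_line_eq hper hω, integral_line_eq hper hω']
  have h1 := Complex.integral_boundary_rect_eq_zero_of_differentiableOn h
    (ω.im * Complex.I) (1 + ω'.im * Complex.I) (hd.mono fun z hz => by
      have := hz.2
      simp only [Set.mem_preimage, Set.mem_uIcc] at this
      simp at this
      change c < z.im
      rcases this with h | h <;> linarith)
  have h2 : ∀ y ∈ Set.uIcc ω.im ω'.im, h ((1 : ℝ) + y * Complex.I) = h ((0 : ℝ) + y * Complex.I) := by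
    intro y hy
    have := hper (y * Complex.I) (by
      rw [Set.mem_uIcc] at hy
      simp only [Complex.mul_im, Complex.ofReal_re, Complex.I_im, mul_one, Complex.ofReal_im,
        Complex.I_re, mul_zero, add_zero]
      rcases hy with h | h <;> linarith)
    simpa [add_comm] using this
  simp only [Complex.mul_re, Complex.ofReal_re, Complex.I_re, mul_zero, Complex.ofReal_im,
    Complex.I_im, mul_one, sub_self, Complex.mul_im, add_zero, Complex.add_re,
    Complex.one_re, Complex.add_im, Complex.one_im, zero_add] at h1
  rw [intervalIntegral.integral_congr h2, add_sub_cancel_right] at h1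
  exact sub_eq_zero.mp h1

include hd hper in
lemma integral_line_mul {N : ℕ} (hN : 0 < N) {ω ω' : ℂ} (hω : c < ω.im) (hω' : c < ω'.im) :
    ∫ x in (0 : ℝ)..1, h (ω + N * x) = ∫ x in (0 : ℝ)..1, h (ω' + x) := by
  have hN' : (N : ℝ) ≠ 0 := by exact_mod_cast hN.ne'
  have h1 := intervalIntegral.integral_comp_mul_left (a := 0) (b := 1)
    (fun x : ℝ => h (ω + x)) hN'
  simp only [Complex.ofReal_mul, Complex.ofReal_natCast, mul_zero, mul_one] at h1
  have h2 := (periodic_line hper hω).intervalIntegral_add_zsmul_eq (N : ℤ) 0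
    (fun a b => (continuous_line hd hω).intervalIntegrable a b)
  simp only [zero_add, zsmul_eq_mul, mul_one, Int.cast_natCast] at h2
  rw [h1, h2, integral_line_eq_of_periodic hd hper hω hω', Complex.real_smul, ← mul_assoc,
    Complex.ofReal_inv, Complex.ofReal_natCast, inv_mul_cancel₀ (by exact_mod_cast hN.ne'), one_mul]

end Periodic

lemma e_add (z w : ℂ) : e (z + w) = e z * e w := by
  rw [e, e, e, ← Complex.exp_add]
  ring_nf

lemma e_intCast (n : ℤ) : e n = 1 := by
  rw [e, Complex.exp_eq_one_iff]
  exact ⟨n, by ring⟩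

lemma differentiable_e : Differentiable ℂ e := by
  unfold e
  fun_prop

/-! ### Functions holomorphic and periodic along the lines -/

/-- Holomorphy on the lines `ω ↦ (τ, z₁; z₂, ω)`. -/
def IsLineHolomorphic (f : PlaneFun) : Prop :=
  ∀ w, DifferentiableOn ℂ (fun ω => extend f (pointMat w ω)) {ω | lineBound w < ω.im}

/-- Invariance under `ω ↦ ω + 1`. -/
def IsLinePeriodic (f : PlaneFun) : Prop :=
  ∀ w ω, lineBound w < ω.im → extend f (pointMat w (ω + 1)) = extend f (pointMat w ω)

lemma extend_restrict (F : Mat2 → ℂ) {Z : Mat2} (hZ : Z ∈ H2) : extend (restrict F) Z = F Z :=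
  extend_of_mem _ hZ

lemma restrict_extend (f : PlaneFun) : restrict (extend f) = f :=
  funext fun Z => extend_of_mem f Z.2

section

attribute [local instance] Matrix.normedAddCommGroup Matrix.normedSpace

lemma IsCuspForm.isLineHolomorphic {k : ℤ} {F : Mat2 → ℂ} (hF : IsCuspForm k F) :
    IsLineHolomorphic (restrict F) := by
  intro w
  have h : DifferentiableOn ℂ (fun ω => F (pointMat w ω)) {ω | lineBound w < ω.im} := by
    refine DifferentiableOn.comp (t := H2) hF.holomorphic ?_ fun ω hω => pointMat_mem_iff.mpr hω
    have : pointMat w = fun ω => pointMat w 0 + ω • !![0, 0; 0, 1] := by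
      funext ω
      ext i j
      fin_cases i <;> fin_cases j <;> simp [pointMat]
    rw [this]
    exact ((differentiable_id.smul_const (!![0, 0; 0, 1] : Mat2)).const_add _).differentiableOn
  exact h.congr fun ω hω => extend_restrict F (pointMat_mem_iff.mpr hω)

end

lemma IsInvariant.isLinePeriodic {k : ℤ} {f : PlaneFun} (hf : IsInvariant k parabolicGroupInt f) :
    IsLinePeriodic f := by
  intro w ω hω
  have hZ := pointMat_mem_iff.mpr hω
  -- The central Heisenberg element acts as ω ↦ ω + 1 with trivial automorphy factor.
  have h := congrFun (hf (heisenberg 0 0 1).1 (heisenberg 0 0 1).2) ⟨_, hZ⟩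
  have hm : toMat4 (heisenberg 0 0 1).1.val
      = Matrix.fromBlocks 1 !![0, 0; 0, 1] 0 1 := by
    refine Matrix.ext fun i j => ?_
    rw [toMat4_apply]
    change ((heisenbergMat 0 0 1 i j : GaussianInt) : ℂ) = _
    rcases i with i | i <;> rcases j with j | j <;> fin_cases i <;> fin_cases j <;>
      simp [heisenbergMat, Matrix.fromBlocks]
  have hden : denom (toMat4 (heisenberg 0 0 1).1.val) (pointMat w ω) = 1 := by
    rw [hm]
    simp [denom]
  have hmo : moebius (toMat4 (heisenberg 0 0 1).1.val) (pointMat w ω) = pointMat w (ω + 1) := by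
    rw [moebius, hden, hm]
    ext i j
    fin_cases i <;> fin_cases j <;> simp [pointMat]
  have hs : simFactor (toMat4 (heisenberg 0 0 1).1.val) = 1 := by
    refine simFactor_eq ?_
    rw [← toMat4_conjTranspose, ← toMat4_J, ← map_mul, ← map_mul,
      mem_unitaryGroupInt.mp (heisenberg 0 0 1).2.1, one_smul]
  change slash k _ (extend f) (pointMat w ω) = _ at h
  simp only [slash] at h
  rw [hden, hmo, hs, one_zpow, Matrix.det_one, one_zpow, one_mul, one_mul] at h
  rw [h, extend_of_mem f hZ]

lemma exists_slash_line (k : ℤ) {g : Mat4} (hg : IsSimilitude g) (hp : IsParabolic g)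
    (w : ℍ × ℂ × ℂ) : ∃ (w' : ℍ × ℂ × ℂ) (h J : ℂ), ∀ ω, lineBound w < ω.im →
      lineBound w' < (g (Sum.inl 1) (Sum.inl 1) / g (Sum.inr 1) (Sum.inr 1) * ω + h).im ∧
      ∀ F, slash k g F (pointMat w ω) = J * F (pointMat w'
        (g (Sum.inl 1) (Sum.inl 1) / g (Sum.inr 1) (Sum.inr 1) * ω + h)) := by
  obtain ⟨w', h, J, H⟩ := exists_moebius_line hg hp w
  refine ⟨w', h, simFactor g ^ (2 * k - 4) * J ^ (-k), fun ω hω => ⟨?_, fun F => ?_⟩⟩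
  · rw [← pointMat_mem_iff, ← (H ω hω).2]
    exact moebius_mem hg (pointMat_mem_iff.mpr hω)
  · simp only [slash]
    rw [(H ω hω).1, (H ω hω).2]

lemma IsLineHolomorphic.differentiableOn_slash {k : ℤ} {f : PlaneFun} (hf : IsLineHolomorphic f)
    {g : Mat4} (hg : IsSimilitude g) (hp : IsParabolic g) (w : ℍ × ℂ × ℂ) :
    DifferentiableOn ℂ (fun ω => slash k g (extend f) (pointMat w ω))
      {ω | lineBound w < ω.im} := by
  obtain ⟨w', h, J, H⟩ := exists_slash_line k hg hp w
  refine DifferentiableOn.congr (f := fun ω => J * extend f (pointMat w'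
    (g (Sum.inl 1) (Sum.inl 1) / g (Sum.inr 1) (Sum.inr 1) * ω + h))) ?_
    fun ω hω => (H ω hω).2 _
  refine DifferentiableOn.const_mul ?_ J
  refine DifferentiableOn.comp (t := {ω : ℂ | lineBound w' < ω.im}) (hf w') ?_
    fun ω hω => (H ω hω).1
  exact ((differentiable_id.const_mul _).add_const h).differentiableOn

lemma IsLineHolomorphic.slashMap {k : ℤ} {f : PlaneFun} (hf : IsLineHolomorphic f)
    {g : Mat4} (hg : IsSimilitude g) (hp : IsParabolic g) :
    IsLineHolomorphic (slashMap k g f) := fun w =>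
  (hf.differentiableOn_slash hg hp w).congr fun _ hω =>
    extend_of_mem _ (pointMat_mem_iff.mpr hω)

lemma IsLineHolomorphic.smul {f : PlaneFun} (hf : IsLineHolomorphic f) (c : ℂ) :
    IsLineHolomorphic (c • f) := fun w =>
  ((hf w).const_mul c).congr fun ω hω => by
    have := pointMat_mem_iff.mpr hω
    rw [extend_of_mem _ this, extend_of_mem _ this]
    rfl

lemma IsLineHolomorphic.sum {ι : Type*} {s : Finset ι} {f : ι → PlaneFun}
    (hf : ∀ i ∈ s, IsLineHolomorphic (f i)) : IsLineHolomorphic (∑ i ∈ s, f i) := fun w =>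
  (DifferentiableOn.fun_sum fun i hi => hf i hi w).congr fun ω hω => by
    have := pointMat_mem_iff.mpr hω
    rw [extend_of_mem _ this, Finset.sum_apply]
    exact Finset.sum_congr rfl fun i _ => (extend_of_mem _ this).symm

lemma ParInt.isParabolic (γ : ParInt) : IsParabolic (toMat4 γ.mat) := by
  refine ⟨fun j hj => ?_, fun i hi => ?_⟩
  · rw [toMat4_apply, γ.last_row hj, map_zero]
  · rw [toMat4_apply, γ.second_col hi, map_zero]

lemma IsLineHolomorphic.orbitAvg {k : ℤ} {f : PlaneFun} (hf : IsLineHolomorphic f)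
    (hfin : HasFiniteOrbit (parRep k) f) : IsLineHolomorphic (orbitAvg (parRep k) f) := by
  have : (vecStab (parRep k) f).FiniteIndex := hfin
  let : Fintype (ParInt ⧸ vecStab (parRep k) f) := Subgroup.fintypeQuotientOfFiniteIndex
  rw [HermitianModular.orbitAvg, finsum_eq_sum_of_fintype]
  exact (IsLineHolomorphic.sum fun q _ =>
    hf.slashMap (q.out⁻¹).isSimilitude (q.out⁻¹).isParabolic).smul _

lemma IsParabolic.diagonal (y : Fin 2 ⊕ Fin 2 → GaussianInt) :
    IsParabolic (toMat4 (Matrix.diagonal y)) := by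
  refine ⟨fun j hj => ?_, fun i hi => ?_⟩
  · rw [toMat4_apply, Matrix.diagonal_apply_ne _ hj.symm, map_zero]
  · rw [toMat4_apply, Matrix.diagonal_apply_ne _ hi, map_zero]

lemma hasFiniteOrbit_parabolic {k : ℤ} {f : PlaneFun} (hf : IsInvariant k parabolicGroupInt f)
    {y : Fin 2 ⊕ Fin 2 → GaussianInt} (hy : ∀ i, y i ≠ 0)
    (hs : IsSimilitude (toMat4 (Matrix.diagonal y)))
    (hfin : (cosetStab (Matrix.diagonal y)).index ≠ 0) :
    HasFiniteOrbit (parRep k) (slashMap k (toMat4 (Matrix.diagonal y)) f) := by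
  have : (cosetStab (Matrix.diagonal y)).FiniteIndex := ⟨hfin⟩
  exact HasFiniteOrbit.of_le _ (K := cosetStab (Matrix.diagonal y))
    (le_vecStab parabolic_le_unitary hf hs fun δ hδ => (mem_cosetStab_iff_parabolic hy).mp hδ)

lemma IsLineHolomorphic.heckePar {k : ℤ} {f : PlaneFun} (hf : IsLineHolomorphic f)
    (hinv : IsInvariant k parabolicGroupInt f) {y : Fin 2 ⊕ Fin 2 → GaussianInt}
    (hy : ∀ i, y i ≠ 0) (hs : IsSimilitude (toMat4 (Matrix.diagonal y)))
    (hfin : (cosetStab (Matrix.diagonal y)).index ≠ 0) :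
    IsLineHolomorphic (heckePar k (Matrix.diagonal y) f) :=
  ((hf.slashMap hs (IsParabolic.diagonal y)).orbitAvg
    (hasFiniteOrbit_parabolic hinv hy hs hfin)).smul _

lemma IsInvariant.heckePar {k : ℤ} {f : PlaneFun}
    (hinv : IsInvariant k parabolicGroupInt f) {y : Fin 2 ⊕ Fin 2 → GaussianInt}
    (hy : ∀ i, y i ≠ 0) (hs : IsSimilitude (toMat4 (Matrix.diagonal y)))
    (hfin : (cosetStab (Matrix.diagonal y)).index ≠ 0) :
    IsInvariant k parabolicGroupInt (heckePar k (Matrix.diagonal y) f) := by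
  intro γ hγ
  have h := apply_orbitAvg (parRep k) (hasFiniteOrbit_parabolic hinv hy hs hfin) ⟨γ, hγ⟩⁻¹
  rw [parRep_apply, inv_inv] at h
  rw [HermitianModular.heckePar, map_smul]
  exact congrArg _ h

/-! ### Hecke operators on Fourier-Jacobi coefficients -/

section Line

variable {k : ℤ} {f : PlaneFun} (hf : IsLineHolomorphic f) (hp : IsLinePeriodic f)

lemma IsLineHolomorphic.differentiableOn_mul_e (hf : IsLineHolomorphic f) (m : ℕ)
    (w : ℍ × ℂ × ℂ) : DifferentiableOn ℂ (fun ω => extend f (pointMat w ω) * e (-(m * ω)))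
      {ω | lineBound w < ω.im} :=
  (hf w).mul (differentiable_e.comp (differentiable_id.const_mul (m : ℂ)).neg).differentiableOn

lemma IsLinePeriodic.mul_e (hp : IsLinePeriodic f) (m : ℕ) (w : ℍ × ℂ × ℂ) (ω : ℂ)
    (hω : lineBound w < ω.im) : extend f (pointMat w (ω + 1)) * e (-(m * (ω + 1)))
      = extend f (pointMat w ω) * e (-(m * ω)) := by
  have h1 : -((m : ℂ) * (ω + 1)) = -(m * ω) + ((-m : ℤ) : ℂ) := by
    push_cast
    ring
  rw [hp w ω hω, h1, e_add, e_intCast, mul_one]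

include hf hp

lemma fourierJacobi_eq_integral (m : ℕ) {N : ℕ} (hN : 0 < N) (w : ℍ × ℂ × ℂ) {ω : ℂ}
    (hω : lineBound w < ω.im) : fourierJacobi (extend f) m w
      = ∫ x in (0 : ℝ)..1, extend f (pointMat w (ω + N * x)) * e (-(m * (ω + N * x))) :=
  (integral_line_mul (hf.differentiableOn_mul_e m w) (hp.mul_e m w) hN hω
    (lineBound_lt_basePoint w)).symm

/-- On the line g acts as ω ↦ ω / N + h, so N periods upstairs become one period on the image line,
and the frequency m becomes mN there. -/
lemma integral_slash_eq_of_signature_natCast {g : Mat4} (hg : IsSimilitude g)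
    (hgp : IsParabolic g) {N : ℕ} (hN : 0 < N)
    (hr : g (Sum.inl 1) (Sum.inl 1) / g (Sum.inr 1) (Sum.inr 1) = (N : ℂ)⁻¹) (m : ℕ)
    (w : ℍ × ℂ × ℂ) {ω : ℂ} (hω : lineBound w < ω.im) :
    ∫ x in (0 : ℝ)..1, slash k g (extend f) (pointMat w (ω + N * x)) * e (-(m * (ω + N * x)))
      = slash k g (pForm (m * N) (fourierJacobi (extend f) (m * N))) (pointMat w ω)
        * e (-(m * ω)) := by
  obtain ⟨w', h, J, H⟩ := exists_slash_line k hg hgp w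
  rw [hr] at H
  have hN' : (N : ℂ) ≠ 0 := by exact_mod_cast hN.ne'
  have h1 : ∀ x : ℝ, slash k g (extend f) (pointMat w (ω + N * x)) * e (-(m * (ω + N * x)))
      = J * e ((m * N : ℕ) * h) * (extend f (pointMat w' (((N : ℂ)⁻¹ * ω + h) + (1 : ℕ) * x))
        * e (-((m * N : ℕ) * (((N : ℂ)⁻¹ * ω + h) + (1 : ℕ) * x)))) := fun x => by
    have e1 : (N : ℂ)⁻¹ * (ω + N * x) + h = ((N : ℂ)⁻¹ * ω + h) + (1 : ℕ) * x := by
      field_simp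
      push_cast
      ring
    have e2 : -((m : ℂ) * (ω + N * x)) = (m * N : ℕ) * h
        + -((m * N : ℕ) * (((N : ℂ)⁻¹ * ω + h) + (1 : ℕ) * x)) := by
      push_cast
      field_simp
      ring
    rw [(H (ω + N * x) (by simpa using hω)).2, e1, e2, e_add]
    ring
  simp_rw [h1]
  rw [intervalIntegral.integral_const_mul,
    ← fourierJacobi_eq_integral hf hp (m * N) one_pos w' (H ω hω).1, (H ω hω).2]
  have e3 : e (-(m * ω)) * e ((m * N : ℕ) * ((N : ℂ)⁻¹ * ω + h)) = e ((m * N : ℕ) * h) := by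
    rw [← e_add]
    congr 1
    push_cast
    field_simp
    ring
  simp only [pForm, pointMat]
  simp only [Matrix.of_apply, Matrix.cons_val', Matrix.cons_val_zero, Matrix.cons_val_one,
    Matrix.cons_val_fin_one, UpperHalfPlane.ofComplex_apply]
  rw [← e3]
  ring

/-- Here g acts as ω ↦ pω + h. If p divides m, one period covers p periods of the image line at
frequency m/p. Otherwise f|g is periodic under 1/p, so a shift multiplies the integral by e(-m/p) ≠
1 and it vanishes. -/
lemma integral_slash_eq_of_signature_inv {g : Mat4} (hg : IsSimilitude g)
    (hgp : IsParabolic g) {p : ℕ} (hp0 : 0 < p)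
    (hr : g (Sum.inl 1) (Sum.inl 1) / g (Sum.inr 1) (Sum.inr 1) = p) (m : ℕ)
    (w : ℍ × ℂ × ℂ) {ω : ℂ} (hω : lineBound w < ω.im) :
    ∫ x in (0 : ℝ)..1, slash k g (extend f) (pointMat w (ω + x)) * e (-(m * (ω + x)))
      = slash k g (pForm (m / p) (fourierJacobiDiv (extend f) m p)) (pointMat w ω)
        * e (-(m * ω)) := by
  obtain ⟨w', h, J, H⟩ := exists_slash_line k hg hgp w
  rw [hr] at H
  have hp' : (p : ℂ) ≠ 0 := by exact_mod_cast hp0.ne'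
  rw [(H ω hω).2]
  by_cases hm : p ∣ m
  · obtain ⟨n, rfl⟩ := hm
    have h1 : ∀ x : ℝ, slash k g (extend f) (pointMat w (ω + x)) * e (-((p * n : ℕ) * (ω + x)))
        = J * e (n * h) * (extend f (pointMat w' ((p * ω + h) + p * x))
          * e (-(n * ((p * ω + h) + p * x)))) := fun x => by
      have e1 : (p : ℂ) * (ω + x) + h = (p * ω + h) + p * x := by ring
      have e2 : -(((p * n : ℕ) : ℂ) * (ω + x)) = n * h + -(n * ((p * ω + h) + p * x)) := by
        push_cast
        ring
      rw [(H (ω + x) (by simpa using hω)).2, e1, e2, e_add]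
      ring
    simp_rw [h1]
    rw [intervalIntegral.integral_const_mul,
      ← fourierJacobi_eq_integral hf hp n hp0 w' (H ω hω).1, fourierJacobiDiv,
      if_pos (dvd_mul_right p n), Nat.mul_div_cancel_left n hp0]
    have e3 : e (-((p * n : ℕ) * ω)) * e (n * (p * ω + h)) = e (n * h) := by
      rw [← e_add]
      congr 1
      push_cast
      ring
    simp only [pForm, pointMat]
    simp only [Matrix.of_apply, Matrix.cons_val', Matrix.cons_val_zero, Matrix.cons_val_one,
      Matrix.cons_val_fin_one, UpperHalfPlane.ofComplex_apply]
    rw [← e3]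
    ring
  · rw [fourierJacobiDiv, if_neg hm]
    simp only [pForm, Pi.zero_apply, zero_mul, mul_zero]
    set u : ℝ → ℂ := fun x => slash k g (extend f) (pointMat w (ω + x)) * e (-(m * (ω + x)))
      with hu
    have hshift : ∀ x, u (x + (p : ℝ)⁻¹) = e (-(m / p)) * u x := fun x => by
      have hx : lineBound w < (ω + x).im := by simpa using hω
      have e1 : (p : ℂ) * (ω + ((x + (p : ℝ)⁻¹ : ℝ) : ℂ)) + h = (p * (ω + x) + h) + 1 := by
        push_cast
        field_simp
        ring
      have e2 : -((m : ℂ) * (ω + ((x + (p : ℝ)⁻¹ : ℝ) : ℂ))) = -(m / p) + -(m * (ω + x)) := by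
        push_cast
        field_simp
        ring
      simp only [hu]
      rw [(H _ (by simpa using hω)).2, (H _ hx).2, e1, e2, hp w' _ (H _ hx).1, e_add]
      ring
    have hper : Function.Periodic u 1 := fun x => by
      have hx : lineBound w < (ω + x).im := by simpa using hω
      have hshift' : ∀ n : ℕ, u (x + n * (p : ℝ)⁻¹) = e (-(m / p)) ^ n * u x := by
        intro n
        induction n with
        | zero => simp
        | succ n ih =>
          have : x + ((n + 1 : ℕ) : ℝ) * (p : ℝ)⁻¹ = (x + n * (p : ℝ)⁻¹) + (p : ℝ)⁻¹ := by
            push_cast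
            ring
          rw [this, hshift, ih]
          ring
      have h2 := hshift' p
      rw [mul_inv_cancel₀ (by exact_mod_cast hp0.ne')] at h2
      have h3 : e (-(m / p)) ^ p = 1 := by
        rw [e, ← Complex.exp_nat_mul, ← e_intCast (-m), e]
        congr 1
        push_cast
        field_simp
      rw [h2, h3, one_mul]
    have h4 : ∫ x in (0 : ℝ)..1, u x = e (-(m / p)) * ∫ x in (0 : ℝ)..1, u x := by
      rw [← intervalIntegral.integral_const_mul]
      simp_rw [← hshift]
      rw [intervalIntegral.integral_comp_add_right u]
      have := hper.intervalIntegral_add_eq 0 (0 + (p : ℝ)⁻¹)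
      rw [zero_add, zero_add] at this
      rw [this, zero_add, add_comm 1]
    have hne : e (-(m / p)) ≠ 1 := by
      intro h0
      rw [e, Complex.exp_eq_one_iff] at h0
      obtain ⟨n, hn⟩ := h0
      refine hm ?_
      have h5 : -((m : ℂ) / p) = n := by
        have : (2 * Real.pi * Complex.I : ℂ) ≠ 0 := Complex.two_pi_I_ne_zero
        refine mul_left_cancel₀ this ?_
        rw [hn]
        ring
      have h6 : (m : ℂ) = -n * p := by
        field_simp at h5
        linear_combination -h5
      have h7 : (m : ℤ) = p * -n := by
        have : (m : ℤ) = -n * p := by exact_mod_cast h6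
        rw [this]
        ring
      exact Int.natCast_dvd_natCast.mp ⟨_, h7⟩
    have h8 : (1 - e (-(m / p))) * ∫ x in (0 : ℝ)..1, u x = 0 := by linear_combination h4
    exact (mul_eq_zero.mp h8).resolve_left (sub_ne_zero.mpr hne.symm)

end Line

/-! ### Summation over the left cosets of a parabolic double coset -/

lemma ParInt.second_diag_eq_last_diag (γ : ParInt) :
    γ.mat (Sum.inl 1) (Sum.inl 1) = γ.mat (Sum.inr 1) (Sum.inr 1) ∧
      γ.mat (Sum.inr 1) (Sum.inr 1) ≠ 0 := by
  have h1 : γ.mat (Sum.inr 1) (Sum.inr 1) * star (γ.mat (Sum.inl 1) (Sum.inl 1)) = 1 := by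
    have h := congrFun (congrFun γ.mat_mul_inv (Sum.inr 1)) (Sum.inr 1)
    rw [Matrix.mul_apply, Finset.sum_eq_single (Sum.inr 1)
      (fun j _ hj => by rw [γ.last_row hj, zero_mul]) (by simp), Matrix.one_apply_eq] at h
    have h2 : (γ⁻¹).mat (Sum.inr 1) (Sum.inr 1) = star (γ.mat (Sum.inl 1) (Sum.inl 1)) := by
      have := inv_apply γ.2.1 (Sum.inr 1) (Sum.inr 1)
      refine this.trans ?_
      simp [blockSign, ParInt.mat]
    rwa [h2] at h
  set a := γ.mat (Sum.inl 1) (Sum.inl 1)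
  set b := γ.mat (Sum.inr 1) (Sum.inr 1)
  have hb : b ≠ 0 := left_ne_zero_of_mul_eq_one h1
  refine ⟨?_, hb⟩
  have h2 : star b * b = 1 := by
    have hn : b.norm = 1 := by
      rw [Zsqrtd.norm_eq_one_iff' (by norm_num)]
      exact IsUnit.of_mul_eq_one _ h1
    have := Zsqrtd.norm_eq_mul_conj b
    rw [hn] at this
    rw [mul_comm]
    exact_mod_cast this.symm
  have h3 : star a = star b := mul_left_cancel₀ hb (by rw [h1, mul_comm, h2])
  exact star_injective h3

section ParabolicCosets

variable {y : Fin 2 ⊕ Fin 2 → GaussianInt} (hy : ∀ i, y i ≠ 0)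
  (hs : IsSimilitude (toMat4 (Matrix.diagonal y)))
  (hfin : (cosetStab (Matrix.diagonal y)).index ≠ 0)

-- The representatives picked by `Quotient.out` are arbitrary in their cosets. The ratio survives
-- because the two relevant diagonal entries of an integral parabolic element are equal, being units
-- b and a with b * star a = 1.
include hs in
lemma out_spec {c : MulAction.orbitRel.Quotient Gamma11 Mat4}
    (hc : c ∈ leftCosets Gamma11 (toMat4 (Matrix.diagonal y))) :
    IsSimilitude (Quotient.out c) ∧ IsParabolic (Quotient.out c) ∧
      Quotient.out c (Sum.inl 1) (Sum.inl 1) / Quotient.out c (Sum.inr 1) (Sum.inr 1)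
        = (y (Sum.inl 1) : ℂ) / y (Sum.inr 1) := by
  obtain ⟨γ, hγ, rfl⟩ := (mem_leftCosets_iff (Γ := parabolicGroupInt)).mp hc
  obtain ⟨γ', hγ', h⟩ := exists_out_eq (Γ := parabolicGroupInt) (Matrix.diagonal y * γ.val)
  obtain ⟨δ, rfl⟩ : ∃ δ : ParInt, δ.1 = γ := ⟨⟨γ, hγ⟩, rfl⟩
  obtain ⟨δ', rfl⟩ : ∃ δ : ParInt, δ.1 = γ' := ⟨⟨γ', hγ'⟩, rfl⟩
  have hprod : ∀ i j, (δ'.1.val * (Matrix.diagonal y * δ.1.val)) i j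
      = ∑ l, δ'.mat i l * (y l * δ.mat l j) := fun i j => by
    rw [Matrix.mul_apply]
    simp only [Matrix.diagonal_mul]
    rfl
  have hrow : ∀ j, (δ'.1.val * (Matrix.diagonal y * δ.1.val)) (Sum.inr 1) j
      = δ'.mat (Sum.inr 1) (Sum.inr 1) * (y (Sum.inr 1) * δ.mat (Sum.inr 1) j) := fun j => by
    rw [hprod, Finset.sum_eq_single (Sum.inr 1) (fun l _ hl => by rw [δ'.last_row hl, zero_mul])
      (by simp)]
  have hcol : ∀ i, (δ'.1.val * (Matrix.diagonal y * δ.1.val)) i (Sum.inl 1)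
      = δ'.mat i (Sum.inl 1) * (y (Sum.inl 1) * δ.mat (Sum.inl 1) (Sum.inl 1)) := fun i => by
    rw [hprod, Finset.sum_eq_single (Sum.inl 1)
      (fun l _ hl => by rw [δ.second_col hl, mul_zero, mul_zero]) (by simp)]
  refine ⟨?_, ?_, ?_⟩
  · refine h ▸ ?_
    rw [map_mul, map_mul]
    exact δ'.isSimilitude.mul (hs.mul δ.isSimilitude)
  · refine h ▸ ⟨fun j hj => ?_, fun i hi => ?_⟩
    · rw [toMat4_apply, hrow, δ.last_row hj, mul_zero, mul_zero, map_zero]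
    · rw [toMat4_apply, hcol, δ'.second_col hi, zero_mul, map_zero]
  · have e1 := δ.second_diag_eq_last_diag
    have e2 := δ'.second_diag_eq_last_diag
    have n1 : (δ.mat (Sum.inr 1) (Sum.inr 1) : ℂ) ≠ 0 := by
      rw [Ne, GaussianInt.toComplex_eq_zero]; exact e1.2
    have n2 : (δ'.mat (Sum.inr 1) (Sum.inr 1) : ℂ) ≠ 0 := by
      rw [Ne, GaussianInt.toComplex_eq_zero]; exact e2.2
    have h' := congrFun (congrFun h (Sum.inl 1)) (Sum.inl 1)
    have h'' := congrFun (congrFun h (Sum.inr 1)) (Sum.inr 1)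
    rw [toMat4_apply, hcol, e1.1, e2.1] at h'
    rw [toMat4_apply, hrow] at h''
    refine (congrArg₂ (· / ·) h' h'').trans ?_
    simp only [map_mul]
    rw [mul_div_mul_left _ _ n2, mul_div_mul_right _ _ n1]

include hy hfin in
lemma finite_leftCosets : (leftCosets Gamma11 (toMat4 (Matrix.diagonal y))).Finite := by
  have hfi : (cosetStab (Matrix.diagonal y)).FiniteIndex := ⟨hfin⟩
  let _ : Fintype (ParInt ⧸ cosetStab (Matrix.diagonal y)) :=
    Subgroup.fintypeQuotientOfFiniteIndex
  have h := bijOn_leftCosets (Γ := parabolicGroupInt) le_rfl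
    (ι := Unit) (fun _ => Matrix.diagonal y) (Matrix.diagonal y)
    (fun _ => cosetStab (Matrix.diagonal y))
    (fun _ δ => mem_cosetStab_iff_parabolic hy)
    (fun _ => ⟨1, one_mem _, 1, one_mem _, by simp⟩)
    (fun γ hγ => ⟨(), ⟨γ, hγ⟩, 1, one_mem _, by simp [ParInt.mat]⟩) (fun _ _ _ _ _ _ _ => rfl)
  exact h.finite_iff_finite.mp Set.finite_univ

variable {k : ℤ} {f : PlaneFun} (hf : IsLineHolomorphic f)
  (hinv : IsInvariant k parabolicGroupInt f)

include hy hs hfin hf hinv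

/-- The whole Hecke sum has period one in ω, but its single terms need not. Averaging over N periods
leaves the coefficient of the sum unchanged and lets each term be integrated separately. -/
lemma fourierJacobi_heckePar (m : ℕ) {N : ℕ} (hN : 0 < N) (w : ℍ × ℂ × ℂ) (φ : Mat2 → ℂ)
    (hφ : ∀ g, IsSimilitude g → IsParabolic g →
      g (Sum.inl 1) (Sum.inl 1) / g (Sum.inr 1) (Sum.inr 1)
        = (y (Sum.inl 1) : ℂ) / y (Sum.inr 1) →
      ∫ x in (0 : ℝ)..1, slash k g (extend f) (pointMat w (basePoint w + N * x))
        * e (-(m * (basePoint w + N * x)))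
        = slash k g φ (pointMat w (basePoint w)) * e (-(m * basePoint w))) :
    fourierJacobi (extend (heckePar k (Matrix.diagonal y) f)) m w
      = hecke k Gamma11 (toMat4 (Matrix.diagonal y)) φ (pointMat w (basePoint w))
        * e (-(m * basePoint w)) := by
  have hfc := finite_leftCosets hy hfin
  have hb := lineBound_lt_basePoint w
  have hmem : ∀ x : ℝ, lineBound w < (basePoint w + N * x).im := fun x => by simpa using hb
  have h1 : ∀ x : ℝ, extend (heckePar k (Matrix.diagonal y) f) (pointMat w (basePoint w + N * x))
      = ∑ c ∈ hfc.toFinset, slash k (Quotient.out c) (extend f)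
        (pointMat w (basePoint w + N * x)) := fun x => by
    have hZ := pointMat_mem_iff.mpr (hmem x)
    have h := hecke_parabolic (F := extend f) (by rwa [restrict_extend]) hy hs hfin ⟨_, hZ⟩
    rw [restrict_extend] at h
    rw [extend_of_mem _ hZ, ← h, hecke, finsum_mem_eq_finite_toFinset_sum _ hfc]
  rw [fourierJacobi_eq_integral (hf.heckePar hinv hy hs hfin)
    (hinv.heckePar hy hs hfin).isLinePeriodic m hN w hb]
  simp_rw [h1, Finset.sum_mul]
  rw [intervalIntegral.integral_finsetSum, hecke, finsum_mem_eq_finite_toFinset_sum _ hfc,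
    Finset.sum_mul]
  · refine Finset.sum_congr rfl fun c hc => ?_
    obtain ⟨c1, c2, c3⟩ := out_spec hs (hfc.mem_toFinset.mp hc)
    exact hφ _ c1 c2 c3
  · intro c hc
    obtain ⟨c1, c2, c3⟩ := out_spec hs (hfc.mem_toFinset.mp hc)
    refine Continuous.intervalIntegrable ?_ _ _
    refine Continuous.mul ?_ ?_
    · exact (hf.differentiableOn_slash c1 c2 w).continuousOn.comp_continuous
        (by fun_prop) hmem
    · exact differentiable_e.continuous.comp (by fun_prop)

lemma jacobiHecke_of_signature_natCast {N : ℕ} (hN : 0 < N)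
    (hr : y (Sum.inr 1) = N * y (Sum.inl 1)) (m : ℕ) :
    jacobiHecke k (m * N) (toMat4 (Matrix.diagonal y)) (fourierJacobi (extend f) (m * N))
      = fourierJacobi (extend (heckePar k (Matrix.diagonal y) f)) m := by
  have hy1 : (y (Sum.inl 1) : ℂ) ≠ 0 := by
    rw [Ne, GaussianInt.toComplex_eq_zero]; exact hy _
  have hN' : (N : ℂ) ≠ 0 := by exact_mod_cast hN.ne'
  have hr' : (y (Sum.inl 1) : ℂ) / y (Sum.inr 1) = (N : ℂ)⁻¹ := by
    rw [hr, map_mul, map_natCast]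
    field_simp
  have hsig : signature (toMat4 (Matrix.diagonal y)) = N := by
    rw [signature, toMat4_apply, toMat4_apply, Matrix.diagonal_apply_eq, Matrix.diagonal_apply_eq,
      hr, map_mul, map_natCast]
    field_simp
  funext w
  rw [fourierJacobi_heckePar hy hs hfin hf hinv m hN w _ fun g h1 h2 h3 =>
    integral_slash_eq_of_signature_natCast hf hinv.isLinePeriodic h1 h2 hN (h3.trans hr') m w
      (lineBound_lt_basePoint w), jacobiHecke, hsig]
  congr 3
  push_cast
  field_simp

omit hy hs hfin hf hinv in
lemma jacobiHecke_zero (k : ℤ) (m : ℕ) (g : Mat4) : jacobiHecke k m g 0 = 0 := by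
  funext w
  simp [jacobiHecke, hecke, slash, pForm]

lemma jacobiHecke_of_signature_inv {p : ℕ} (hp : 0 < p)
    (hr : y (Sum.inl 1) = p * y (Sum.inr 1)) (m : ℕ) :
    jacobiHecke k (m / p) (toMat4 (Matrix.diagonal y)) (fourierJacobiDiv (extend f) m p)
      = fourierJacobi (extend (heckePar k (Matrix.diagonal y) f)) m := by
  have hy1 : (y (Sum.inr 1) : ℂ) ≠ 0 := by
    rw [Ne, GaussianInt.toComplex_eq_zero]; exact hy _
  have hp' : (p : ℂ) ≠ 0 := by exact_mod_cast hp.ne'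
  have hr' : (y (Sum.inl 1) : ℂ) / y (Sum.inr 1) = p := by
    rw [hr, map_mul, map_natCast]
    field_simp
  have hsig : signature (toMat4 (Matrix.diagonal y)) = (p : ℂ)⁻¹ := by
    rw [signature, toMat4_apply, toMat4_apply, Matrix.diagonal_apply_eq, Matrix.diagonal_apply_eq,
      hr, map_mul, map_natCast]
    field_simp
  funext w
  rw [fourierJacobi_heckePar hy hs hfin hf hinv m one_pos w
    (pForm (m / p) (fourierJacobiDiv (extend f) m p)) fun g h1 h2 h3 => by
      simpa using integral_slash_eq_of_signature_inv hf hinv.isLinePeriodic h1 h2 hp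
        (h3.trans hr') m w (lineBound_lt_basePoint w)]
  by_cases hm : p ∣ m
  · rw [jacobiHecke, hsig]
    congr 3
    rw [Nat.cast_div hm hp']
    field_simp
  -- When p does not divide m the index m / p is a rounded quotient, which is harmless because the
  -- function is zero.
  · rw [fourierJacobiDiv, if_neg hm, jacobiHecke_zero]
    simp [hecke, slash, pForm]

end ParabolicCosets

/-! ### The rationality theorem -/

lemma IsLineHolomorphic.add {f g : PlaneFun} (hf : IsLineHolomorphic f)
    (hg : IsLineHolomorphic g) : IsLineHolomorphic (f + g) := fun w =>
  ((hf w).add (hg w)).congr fun ω hω => by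
    have := pointMat_mem_iff.mpr hω
    simp only [Pi.add_apply, extend_of_mem _ this]

/-- The space of functions that are holomorphic on lines. -/
def lineHolomorphic : Submodule ℂ PlaneFun where
  carrier := {f | IsLineHolomorphic f}
  add_mem' hf hg := hf.add hg
  zero_mem' := fun w => (differentiableOn_const (0 : ℂ)).congr fun ω hω => by
    rw [extend_of_mem _ (pointMat_mem_iff.mpr hω)]
    rfl
  smul_mem' c _ hf := hf.smul c

/-- The `m`-th Fourier-Jacobi coefficient as a linear map. -/
def fourierJacobiMap (m : ℕ) : lineHolomorphic →ₗ[ℂ] JacobiFun where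
  toFun f := fourierJacobi (extend f.1) m
  map_add' f g := by
    funext w
    rw [Pi.add_apply, fourierJacobi, fourierJacobi, fourierJacobi,
      ← intervalIntegral.integral_add]
    · refine intervalIntegral.integral_congr fun x _ => ?_
      have hZ := basePoint_add_mem w x
      simp only [extend_of_mem _ hZ]
      exact add_mul _ _ _
    · exact (continuous_line (IsLineHolomorphic.differentiableOn_mul_e f.2 m w)
        (lineBound_lt_basePoint w)).intervalIntegrable _ _
    · exact (continuous_line (IsLineHolomorphic.differentiableOn_mul_e g.2 m w)
        (lineBound_lt_basePoint w)).intervalIntegrable _ _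
  map_smul' c f := by
    funext w
    rw [Pi.smul_apply, fourierJacobi, fourierJacobi, smul_eq_mul, RingHom.id_apply,
      ← intervalIntegral.integral_const_mul]
    refine intervalIntegral.integral_congr fun x _ => ?_
    have hZ := basePoint_add_mem w x
    simp only [extend_of_mem _ hZ]
    exact mul_assoc _ _ _

lemma fourierJacobi_extend_restrict (F : Mat2 → ℂ) (m : ℕ) :
    fourierJacobi (extend (restrict F)) m = fourierJacobi F m := by
  funext w
  refine intervalIntegral.integral_congr fun x _ => ?_
  simp only [extend_restrict F (basePoint_add_mem w x)]

lemma fourierJacobiDiv_extend_restrict (F : Mat2 → ℂ) (m d : ℕ) :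
    fourierJacobiDiv (extend (restrict F)) m d = fourierJacobiDiv F m d := by
  rw [fourierJacobiDiv, fourierJacobiDiv, fourierJacobi_extend_restrict]

/-! ### Coefficients of the two power series -/

lemma jacobiHecke_neg (k : ℤ) (m : ℕ) (g : Mat4) (φ : JacobiFun) :
    jacobiHecke k m g (-φ) = -jacobiHecke k m g φ := by
  funext w
  have h : ∀ c, slash k c (pForm m (-φ)) (pointMat w (basePoint w))
      = -slash k c (pForm m φ) (pointMat w (basePoint w)) := fun c => by
    simp [slash, pForm]
  simp only [jacobiHecke, hecke, h, Pi.neg_apply, finsum_neg_distrib, neg_mul]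

lemma coeff_quartic_mul {R : Type*} [CommRing R] (a b c d : R) (S T : PowerSeries R)
    (hT : T = (1 - PowerSeries.C a * PowerSeries.X + PowerSeries.C b * PowerSeries.X ^ 2
      - PowerSeries.C c * PowerSeries.X ^ 3 + PowerSeries.C d * PowerSeries.X ^ 4) * S) :
    PowerSeries.coeff 0 T = PowerSeries.coeff 0 S ∧
    PowerSeries.coeff 1 T = PowerSeries.coeff 1 S - a * PowerSeries.coeff 0 S ∧
    PowerSeries.coeff 2 T = PowerSeries.coeff 2 S - a * PowerSeries.coeff 1 S
      + b * PowerSeries.coeff 0 S ∧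
    PowerSeries.coeff 3 T = PowerSeries.coeff 3 S - a * PowerSeries.coeff 2 S
      + b * PowerSeries.coeff 1 S - c * PowerSeries.coeff 0 S ∧
    ∀ n, PowerSeries.coeff (n + 4) T = PowerSeries.coeff (n + 4) S
      - a * PowerSeries.coeff (n + 3) S + b * PowerSeries.coeff (n + 2) S
      - c * PowerSeries.coeff (n + 1) S + d * PowerSeries.coeff n S := by
  subst hT
  have h : (1 - PowerSeries.C a * PowerSeries.X + PowerSeries.C b * PowerSeries.X ^ 2
      - PowerSeries.C c * PowerSeries.X ^ 3 + PowerSeries.C d * PowerSeries.X ^ 4) * S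
      = S - PowerSeries.C a * (PowerSeries.X ^ 1 * S) + PowerSeries.C b * (PowerSeries.X ^ 2 * S)
      - PowerSeries.C c * (PowerSeries.X ^ 3 * S) + PowerSeries.C d * (PowerSeries.X ^ 4 * S) := by
    ring
  rw [h]
  simp only [map_add, map_sub, PowerSeries.coeff_C_mul, PowerSeries.coeff_X_pow_mul']
  refine ⟨?_, ?_, ?_, ?_, fun n => ?_⟩ <;> simp

/-- The input has one term in each of the degrees zero and one, so compatibility of the operators
with negation and with zero suffices and additivity is never needed. -/
lemma sAction_coeff (k : ℤ) (m p : ℕ) (ϖ : GaussianInt) (φ ψ : JacobiFun)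
    (T : PowerSeries JacobiFun)
    (hT : T = sAction k m p ϖ (PowerSeries.C φ - PowerSeries.C ψ * PowerSeries.X)) :
    PowerSeries.coeff 0 T = φ ∧
    PowerSeries.coeff 1 T = -ψ - jacobiHecke k m (tOne p (star ϖ)) φ ∧
    PowerSeries.coeff 2 T = jacobiHecke k m (tOne p (star ϖ)) ψ + (p : JacobiFun) *
      jacobiHecke k m (tMixed ϖ) (jacobiHecke k m (deltaMat (star ϖ)) φ) ∧
    PowerSeries.coeff 3 T = -((p : JacobiFun) *
      jacobiHecke k m (tMixed ϖ) (jacobiHecke k m (deltaMat (star ϖ)) ψ)) ∧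
    ∀ n, PowerSeries.coeff (n + 4) T = 0 := by
  subst hT
  set Ψ : PowerSeries JacobiFun := PowerSeries.C φ - PowerSeries.C ψ * PowerSeries.X with hΨ
  have h0 : PowerSeries.coeff 0 Ψ = φ := by simp [hΨ]
  have h1 : PowerSeries.coeff 1 Ψ = -ψ := by
    rw [hΨ, map_sub, PowerSeries.coeff_C, if_neg one_ne_zero, PowerSeries.coeff_C_mul,
      PowerSeries.coeff_one_X, mul_one, zero_sub]
  have h2 : ∀ n, PowerSeries.coeff (n + 2) Ψ = 0 := fun n => by
    rw [hΨ, map_sub, PowerSeries.coeff_C, if_neg (by omega), PowerSeries.coeff_C_mul,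
      PowerSeries.coeff_X, if_neg (by omega), mul_zero, sub_zero]
  have hp : (p : PowerSeries JacobiFun) = PowerSeries.C (p : JacobiFun) := (map_natCast _ p).symm
  have hs : sAction k m p ϖ Ψ = Ψ
      - PowerSeries.X ^ 1 * coeffwise (jacobiHecke k m (tOne p (star ϖ))) Ψ
      + PowerSeries.C (p : JacobiFun) * (PowerSeries.X ^ 2 * coeffwise (fun φ =>
        jacobiHecke k m (tMixed ϖ) (jacobiHecke k m (deltaMat (star ϖ)) φ)) Ψ) := by
    rw [sAction, hp]
    ring
  rw [hs]
  simp only [map_add, map_sub, PowerSeries.coeff_C_mul, PowerSeries.coeff_X_pow_mul', coeffwise,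
    PowerSeries.coeff_mk]
  have h3 : PowerSeries.coeff 2 Ψ = 0 := h2 0
  have h4 : PowerSeries.coeff 3 Ψ = 0 := h2 1
  refine ⟨?_, ?_, ?_, ?_, fun n => ?_⟩
  · simp [h0]
  · simp [h0, h1]
  · simp [h0, h1, h3, jacobiHecke_neg]
  · simp [h1, h3, h4, jacobiHecke_neg, jacobiHecke_zero]
  · have e1 : PowerSeries.coeff (n + 4) Ψ = 0 := h2 (n + 2)
    have e2 : PowerSeries.coeff (n + 4 - 1) Ψ = 0 := h2 (n + 1)
    have e3 : PowerSeries.coeff (n + 4 - 2) Ψ = 0 := h2 n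
    rw [e1, e2, e3, jacobiHecke_zero, jacobiHecke_zero, jacobiHecke_zero]
    simp

lemma elim_ne_zero {n : ℕ} (hn : 0 < n) {a b c d : GaussianInt} (h1 : star a * c = n)
    (h2 : star b * d = n) (i : Fin 2 ⊕ Fin 2) :
    (Sum.elim ![a, b] ![c, d] : Fin 2 ⊕ Fin 2 → GaussianInt) i ≠ 0 := by
  intro h0
  have := star_mul_swap_eq h1 h2 i
  rw [h0, star_zero, zero_mul] at this
  exact hn.ne' (by exact_mod_cast this.symm)

lemma scalarSeries_standardPoly (k : ℤ) (F : Mat2 → ℂ) (p : ℕ) (ϖ : GaussianInt) :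
    scalarSeries (standardPoly k F p ϖ) = 1
      - PowerSeries.C (algebraMap ℂ JacobiFun (heckeEigenvalue k F (tOne p (star ϖ))))
        * PowerSeries.X
      + PowerSeries.C (algebraMap ℂ JacobiFun (p * heckeEigenvalue k F (deltaMat (star ϖ))
        * heckeEigenvalue k F (tTwo p))) * PowerSeries.X ^ 2
      - PowerSeries.C (algebraMap ℂ JacobiFun (p ^ 3 * heckeEigenvalue k F (deltaMat (star ϖ)) ^ 2
        * heckeEigenvalue k F (tOne p ϖ))) * PowerSeries.X ^ 3
      + PowerSeries.C (algebraMap ℂ JacobiFun (p ^ 6 * heckeEigenvalue k F (deltaMat (star ϖ)) ^ 3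
        * heckeEigenvalue k F (deltaMat ϖ))) * PowerSeries.X ^ 4 := by
  simp only [scalarSeries, standardPoly, Polynomial.map_add, Polynomial.map_sub,
    Polynomial.map_one, Polynomial.map_mul, Polynomial.map_C, Polynomial.map_X, Polynomial.map_pow,
    Polynomial.coe_add, Polynomial.coe_sub, Polynomial.coe_one, Polynomial.coe_mul,
    Polynomial.coe_C, Polynomial.coe_X, Polynomial.coe_pow]

/-- Every operator in the statement is first rewritten as the linear map `fourierJacobiMap m`
applied to a function on the plane; each coefficient is then the image of one clause of
`hecke_identities`. -/
lemma SplitPrime.rationality {p : ℕ} [Fact p.Prime] {ϖ : GaussianInt} (D : SplitPrime p ϖ)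
    (D' : SplitPrime p (star ϖ)) {k : ℤ} {F : Mat2 → ℂ} (hF : IsHeckeEigenform k F) (m : ℕ) :
    scalarSeries (standardPoly k F p ϖ) * lambdaPlusSeries k F m p (star ϖ)
      = sAction k m p ϖ (PowerSeries.C (fourierJacobi F m)
        - PowerSeries.C (jacobiHecke k (m / p) (lambdaMinus p (star ϖ))
          (fourierJacobiDiv F m p)) * PowerSeries.X) := by
  have hp := (Fact.out : p.Prime).pos
  have hp0 := (Fact.out : p.Prime).ne_zero
  have hs0 : star ϖ ≠ 0 := star_ne_zero.mpr D.self_ne_zero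
  have hss : star (star ϖ) * star ϖ = p := by rw [star_star, D.mul_star]
  set f := restrict F with hf
  have hhol : IsLineHolomorphic f := hF.cusp.isLineHolomorphic
  have hinv : IsInvariant k parabolicGroupInt f :=
    hF.cusp.isInvariant.mono parabolic_le_unitary
  have iΔ : (cosetStab (diagInt (star ϖ) (star ϖ) (star ϖ) (star ϖ))).index ≠ 0 := by
    have e : diagInt (star ϖ) (star ϖ) (star ϖ) (star ϖ) = star ϖ • 1 := by
      rw [one_eq_diagInt, smul_diagInt, mul_one]
    have : (cosetStab (diagInt (star ϖ) (star ϖ) (star ϖ) (star ϖ))).index = 1 := by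
      rw [Subgroup.index_eq_one, eq_top_iff, e]
      exact fun δ _ => ⟨δ.1, parabolic_le_unitary δ.2, by simp [ParInt.mat]⟩
    rw [this]
    exact one_ne_zero
  have iM : (cosetStab (diagInt (star ϖ) p (star ϖ) 1)).index ≠ 0 := by
    rw [D.index_lambdaMinus]; exact one_ne_zero
  have iT : (cosetStab (diagInt 1 (star ϖ) p (star ϖ))).index ≠ 0 := by
    rw [D.index_tOne]; positivity
  have iX : (cosetStab (diagInt ϖ (star ϖ) ϖ (star ϖ))).index ≠ 0 := by
    rw [D.index_tMixed]; positivity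
  have iP : ∀ j, (cosetStab (plusPow p ϖ j)).index ≠ 0 := fun j => by
    rw [D.index_plusPow]; positivity
  have nM := elim_ne_zero hp hss (show star (p : GaussianInt) * 1 = p by simp)
  have nT := elim_ne_zero hp (show star (1 : GaussianInt) * p = p by simp) hss
  have nX := elim_ne_zero hp D.star_mul_self hss
  have nΔ := elim_ne_zero hp hss hss
  have nP := fun j => elim_ne_zero (pow_pos hp j) (D.plusPow_similar j)
    (show star (1 : GaussianInt) * p ^ j = (p ^ j : ℕ) by simp)
  have sM := isSimilitude_diagInt hp hss (show star (p : GaussianInt) * 1 = p by simp)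
  have sT := isSimilitude_diagInt hp (show star (1 : GaussianInt) * p = p by simp) hss
  have sX := isSimilitude_diagInt hp D.star_mul_self hss
  have sΔ := isSimilitude_diagInt hp hss hss
  have hM := hhol.heckePar hinv nM sM iM
  have vM := hinv.heckePar nM sM iM
  have hT := hhol.heckePar hinv nT sT iT
  have hMT := hM.heckePar vM nT sT iT
  have hΔ := hhol.heckePar hinv nΔ sΔ iΔ
  have vΔ := hinv.heckePar nΔ sΔ iΔ
  have hΔX := hΔ.heckePar vΔ nX sX iX
  have hMΔ := hM.heckePar vM nΔ sΔ iΔ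
  have vMΔ := vM.heckePar nΔ sΔ iΔ
  have hMΔX := hMΔ.heckePar vMΔ nX sX iX
  have hP := fun j => hhol.heckePar hinv (nP j) (D.isSimilitude_plusPow j) (iP j)
  let Λ : ℕ → lineHolomorphic := fun j => ⟨heckePar k (plusPow p ϖ j) f, hP j⟩
  have cP : ∀ j, PowerSeries.coeff j (lambdaPlusSeries k F m p (star ϖ))
      = fourierJacobiMap m (Λ j) := fun j => by
    have := jacobiHecke_of_signature_natCast (nP j) (D.isSimilitude_plusPow j) (iP j) hhol hinv
      (pow_pos hp j) (by simp) m
    rw [lambdaPlusSeries, PowerSeries.coeff_mk, ← fourierJacobi_extend_restrict]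
    refine Eq.trans ?_ this
    congr 1
    rw [lambdaPlus, ← toMat4_diagInt, Nat.cast_pow]
    rfl
  have cM : jacobiHecke k (m / p) (lambdaMinus p (star ϖ)) (fourierJacobiDiv F m p)
      = fourierJacobiMap m ⟨_, hM⟩ := by
    have := jacobiHecke_of_signature_inv nM sM iM hhol hinv hp (by simp) m
    rw [lambdaMinus, ← toMat4_diagInt, ← fourierJacobiDiv_extend_restrict]
    exact this
  -- Operators of signature one are the case N = 1. They are applied repeatedly, so holomorphy on
  -- lines and Γ_{1,1}-invariance are carried through each composition.
  have one : ∀ {y : Fin 2 ⊕ Fin 2 → GaussianInt} {g : PlaneFun}, (∀ i, y i ≠ 0) →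
      IsSimilitude (toMat4 (Matrix.diagonal y)) → (cosetStab (Matrix.diagonal y)).index ≠ 0 →
      IsLineHolomorphic g → IsInvariant k parabolicGroupInt g →
      y (Sum.inr 1) = y (Sum.inl 1) → jacobiHecke k m (toMat4 (Matrix.diagonal y))
        (fourierJacobi (extend g) m)
          = fourierJacobi (extend (heckePar k (Matrix.diagonal y) g)) m := by
    intro y g h1 h2 h3 h4 h5 h6
    have := jacobiHecke_of_signature_natCast h1 h2 h3 h4 h5 one_pos (by simpa using h6) m
    rwa [mul_one] at this
  have cT : ∀ {g : PlaneFun} (hg : IsLineHolomorphic g) (vg : IsInvariant k parabolicGroupInt g),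
      jacobiHecke k m (tOne p (star ϖ)) (fourierJacobiMap m ⟨g, hg⟩)
        = fourierJacobiMap m ⟨_, hg.heckePar vg nT sT iT⟩ := fun hg vg => by
    rw [tOne, ← toMat4_diagInt]
    exact one nT sT iT hg vg rfl
  have cX : ∀ {g : PlaneFun} (hg : IsLineHolomorphic g) (vg : IsInvariant k parabolicGroupInt g),
      jacobiHecke k m (tMixed ϖ) (fourierJacobiMap m ⟨g, hg⟩)
        = fourierJacobiMap m ⟨_, hg.heckePar vg nX sX iX⟩ := fun hg vg => by
    rw [tMixed, ← toMat4_diagInt]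
    exact one nX sX iX hg vg rfl
  have cΔ : ∀ {g : PlaneFun} (hg : IsLineHolomorphic g) (vg : IsInvariant k parabolicGroupInt g),
      jacobiHecke k m (deltaMat (star ϖ)) (fourierJacobiMap m ⟨g, hg⟩)
        = fourierJacobiMap m ⟨_, hg.heckePar vg nΔ sΔ iΔ⟩ := fun hg vg => by
    rw [deltaMat, ← toMat4_diagInt]
    exact one nΔ sΔ iΔ hg vg rfl
  have cF : fourierJacobi F m = fourierJacobiMap m ⟨f, hhol⟩ :=
    (fourierJacobi_extend_restrict F m).symm
  obtain ⟨t0, t1, t2, t3, t4⟩ := D.hecke_identities D' hF (fun j => heckePar k (plusPow p ϖ j) f)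
    _ _ _ _ _ (fun _ => rfl) rfl rfl rfl rfl rfl
  have q : (p : JacobiFun) = algebraMap ℂ JacobiFun p := (map_natCast _ p).symm
  rw [cM, cF]
  refine PowerSeries.ext fun n => ?_
  obtain ⟨l0, l1, l2, l3, l4⟩ := coeff_quartic_mul _ _ _ _ _ _
    (congrArg (· * lambdaPlusSeries k F m p (star ϖ)) (scalarSeries_standardPoly k F p ϖ))
  obtain ⟨r0, r1, r2, r3, r4⟩ := sAction_coeff k m p ϖ _ _ _ rfl
  rcases n with _ | _ | _ | _ | n
  · refine l0.trans (Eq.trans ?_ r0.symm)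
    rw [cP]
    exact congrArg (fourierJacobiMap m) (Subtype.ext t0)
  · refine l1.trans (Eq.trans ?_ r1.symm)
    rw [cP, cP, cT hhol hinv, ← Algebra.smul_def, ← map_smul, ← map_sub, ← map_neg, ← map_sub]
    exact congrArg (fourierJacobiMap m) (Subtype.ext t1)
  · refine l2.trans (Eq.trans ?_ r2.symm)
    rw [cP, cP, cP, cT hM vM, cΔ hhol hinv, cX hΔ vΔ, q]
    simp only [← Algebra.smul_def, ← map_smul, ← map_sub, ← map_add]
    exact congrArg (fourierJacobiMap m) (Subtype.ext t2)
  · refine l3.trans (Eq.trans ?_ r3.symm)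
    rw [cP, cP, cP, cP, cΔ hM vM, cX hMΔ vMΔ, q]
    simp only [← Algebra.smul_def, ← map_smul, ← map_sub, ← map_add, ← map_neg]
    exact congrArg (fourierJacobiMap m) (Subtype.ext t3)
  · refine (l4 n).trans (Eq.trans ?_ (r4 n).symm)
    rw [cP, cP, cP, cP, cP, ← map_zero (fourierJacobiMap m)]
    simp only [← Algebra.smul_def, ← map_smul, ← map_sub, ← map_add]
    exact congrArg (fourierJacobiMap m) (Subtype.ext (t4 n))

end HermitianModular

end

theorem mainTheorem7 (k : ℤ) (F : Mat2 → ℂ) (hF : IsHeckeEigenform k F)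
    (p : ℕ) (hp : p.Prime) (hp2 : p ≠ 2) (ϖ : GaussianInt) (hϖ : ϖ * star ϖ = p)
    (m : ℕ) (hm : 1 ≤ m) :
    scalarSeries (standardPoly k F p ϖ) * lambdaPlusSeries k F m p (star ϖ)
        = sAction k m p ϖ
            (PowerSeries.C (fourierJacobi F m)
              - PowerSeries.C (jacobiHecke k (m / p) (lambdaMinus p (star ϖ))
                  (fourierJacobiDiv F m p)) * PowerSeries.X)
    ∧ scalarSeries (standardPoly k F p (star ϖ)) * lambdaPlusSeries k F m p ϖ
        = sAction k m p (star ϖ)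
            (PowerSeries.C (fourierJacobi F m)
              - PowerSeries.C (jacobiHecke k (m / p) (lambdaMinus p ϖ)
                  (fourierJacobiDiv F m p)) * PowerSeries.X) := by
  have : Fact p.Prime := ⟨hp⟩
  have hϖ' : star ϖ * star (star ϖ) = p := by rw [star_star, mul_comm, hϖ]
  obtain ⟨D⟩ := exists_splitPrime hp hp2 hϖ
  obtain ⟨D'⟩ := exists_splitPrime hp hp2 hϖ'
  refine ⟨D.rationality D' hF m, ?_⟩
  -- The second identity is the first one for the conjugate prime, up to rewriting the double
  -- conjugate.
  have D'' : SplitPrime p (star (star ϖ)) := by rwa [star_star]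
  have h := D'.rationality D'' hF m
  rwa [star_star] at h
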